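/- Let $G=(V,E)$ be a finite unweighted undirected graph and $s\in V$. For a graph $G'$ on $V$ let $\mathrm{dist}(s,v,G')\in\{0,1,2,\dots\}\cup\{\infty\}$ be the number of edges of a shortest $s$–$v$ path in $G'$ ($\infty$ if there is none). A spanning subgraph $H\subseteq G$ is a (1-edge) $(1,4)$ FT-ABFS structure (fault-tolerant approximate BFS structure) of $G$ with respect to $s$ if, for every set $F\subseteq E$ with $|F|\le 1$ and every $v\in V$, $$\mathrm{dist}(s,v,H\setminus F)\;\le\;\mathrm{dist}(s,v,G\setminus F)+4 .$$ **Theorem.** There is a deterministic algorithm which, for every $n\ge 1$, every unweighted undirected graph $G$ with $n$ vertices (simple, not necessarily connected, given by its adjacency matrix) and every vertex $s$ of $G$, constructs in time polynomial in $n$ a $(1,4)$ FT-ABFS structure $H$ of $G$ with respect to $s$ that has $O(n^{4/3})$ edges, that is, at most $C\,n^{4/3}$ edges for an absolute constant $C$. (Time is counted in unit-cost steps on a random access machine with addition, subtraction and comparison, but no multiplication, of natural numbers; polynomial time there is the same as on Turing machines.) -/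

import Mathlib

noncomputable section

namespace FaultTolerant

/-! ## Fault-tolerant approximate BFS structures -/

/-- `H` is an `f`-edge `(α, β)` fault-tolerant approximate BFS structure of the unweighted
undirected graph `G` with respect to the source `s`: it is a spanning subgraph of `G`, and for
every set `F` of at most `f` failed edges of `G` and every vertex `v`,
`dist(s, v, H \ F) ≤ α * dist(s, v, G \ F) + β`.
Distances live in `ℕ∞`, the distance of two disconnected vertices being `⊤`. -/
structure IsEdgeFTApproxBFS {V : Type*} (f α β : ℕ) (G H : SimpleGraph V) (s : V) : Prop where
  le : H ≤ G
  edist_le : ∀ F : Finset (Sym2 V), (F : Set (Sym2 V)) ⊆ G.edgeSet → F.card ≤ f → ∀ v : V,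
    (H.deleteEdges (F : Set (Sym2 V))).edist s v ≤
      (α : ℕ∞) * (G.deleteEdges (F : Set (Sym2 V))).edist s v + (β : ℕ∞)

/-! ## The machine model

Deterministic while-programs over a random access memory of natural numbers: scalar registers and
two-dimensional arrays. Every operation (fetching a constant, a register or an array
entry, addition, truncated subtraction, comparison, assignment, test) costs one step. There is no
multiplication, so that one operation lengthens the largest number in use by at most a constant
number of bits; polynomially many steps in this model are therefore polynomially many steps of a
Turing machine, and conversely. -/

/-- Memory: `reg x` is the content of register `x`, and `arr a i j` the entry `(i, j)` of the
array `a`. A program mentions only finitely many registers and arrays. -/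
@[ext]
structure Store where
  reg : ℕ → ℕ
  arr : ℕ → ℕ → ℕ → ℕ

/-- Assign the value `w` to register `x`. -/
def Store.setReg (σ : Store) (x w : ℕ) : Store where
  reg := fun y => if y = x then w else σ.reg y
  arr := σ.arr

/-- Write the value `w` to entry `(i, j)` of the array `a`. -/
def Store.setArr (σ : Store) (a i j w : ℕ) : Store where
  reg := σ.reg
  arr := fun a' i' j' => if a' = a ∧ i' = i ∧ j' = j then w else σ.arr a' i' j'

/-- Arithmetic expressions. -/
inductive Expr where
  | const (c : ℕ)
  | reg (x : ℕ)
  | read (a : ℕ) (i j : Expr)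
  | add (e₁ e₂ : Expr)
  | sub (e₁ e₂ : Expr)
  | lt (e₁ e₂ : Expr)
  | eq (e₁ e₂ : Expr)

/-- The value of an expression; comparisons return `1` for true and `0` for false. -/
def Expr.eval (σ : Store) : Expr → ℕ
  | .const c => c
  | .reg x => σ.reg x
  | .read a i j => σ.arr a (i.eval σ) (j.eval σ)
  | .add e₁ e₂ => e₁.eval σ + e₂.eval σ
  | .sub e₁ e₂ => e₁.eval σ - e₂.eval σ
  | .lt e₁ e₂ => if e₁.eval σ < e₂.eval σ then 1 else 0
  | .eq e₁ e₂ => if e₁.eval σ = e₂.eval σ then 1 else 0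

/-- The number of operations needed to evaluate an expression. -/
def Expr.cost : Expr → ℕ
  | .const _ => 1
  | .reg _ => 1
  | .read _ i j => i.cost + j.cost + 1
  | .add e₁ e₂ => e₁.cost + e₂.cost + 1
  | .sub e₁ e₂ => e₁.cost + e₂.cost + 1
  | .lt e₁ e₂ => e₁.cost + e₂.cost + 1
  | .eq e₁ e₂ => e₁.cost + e₂.cost + 1

/-- Programs. A test succeeds when its value is nonzero. -/
inductive Program where
  | skip
  | assign (x : ℕ) (e : Expr)
  | write (a : ℕ) (i j e : Expr)
  | seq (p q : Program)
  | ite (b : Expr) (p q : Program)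
  | while (b : Expr) (p : Program)

/-- `Runs p σ t τ`: the program `p`, started in the store `σ`, halts after exactly `t` steps in
the store `τ`. -/
inductive Runs : Program → Store → ℕ → Store → Prop
  | skip (σ : Store) : Runs .skip σ 1 σ
  | assign (x : ℕ) (e : Expr) (σ : Store) :
      Runs (.assign x e) σ (e.cost + 1) (σ.setReg x (e.eval σ))
  | write (a : ℕ) (i j e : Expr) (σ : Store) :
      Runs (.write a i j e) σ (i.cost + j.cost + e.cost + 1)
        (σ.setArr a (i.eval σ) (j.eval σ) (e.eval σ))
  | seq {p q : Program} {σ τ υ : Store} {t u : ℕ} :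
      Runs p σ t τ → Runs q τ u υ → Runs (.seq p q) σ (t + u) υ
  | ite_true {b : Expr} {p q : Program} {σ τ : Store} {t : ℕ} :
      b.eval σ ≠ 0 → Runs p σ t τ → Runs (.ite b p q) σ (b.cost + 1 + t) τ
  | ite_false {b : Expr} {p q : Program} {σ τ : Store} {t : ℕ} :
      b.eval σ = 0 → Runs q σ t τ → Runs (.ite b p q) σ (b.cost + 1 + t) τ
  | while_true {b : Expr} {p : Program} {σ τ υ : Store} {t u : ℕ} :
      b.eval σ ≠ 0 → Runs p σ t τ → Runs (.while b p) τ u υ →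
        Runs (.while b p) σ (b.cost + 1 + t + u) υ
  | while_false {b : Expr} {p : Program} {σ : Store} :
      b.eval σ = 0 → Runs (.while b p) σ (b.cost + 1) σ

/-! ## Input and output -/

/-- The entry `(i, j)` of the 0-1 adjacency matrix of a graph on `{0, …, n - 1}`, and `0` outside
of the matrix. -/
def adjEntry {n : ℕ} (G : SimpleGraph (Fin n)) (i j : ℕ) : ℕ :=
  open Classical in
  if ∃ u v : Fin n, u.val = i ∧ v.val = j ∧ G.Adj u v then 1 else 0

/-- The initial store for a graph `G` with vertices `0, …, n - 1` and a source `s`: register `0`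
holds `n`, register `1` holds `s`, array `0` holds the adjacency matrix of `G`; everything else
is `0`. -/
def inputStore {n : ℕ} (G : SimpleGraph (Fin n)) (s : Fin n) : Store where
  reg := fun x => if x = 0 then n else if x = 1 then s.val else 0
  arr := fun a i j => if a = 0 then adjEntry G i j else 0

/-- The graph `H` is the output in the store `τ`: array `1` holds its adjacency matrix. -/
def IsOutput {n : ℕ} (τ : Store) (H : SimpleGraph (Fin n)) : Prop :=
  ∀ u v : Fin n, τ.arr 1 u.val v.val = adjEntry H u.val v.val

end FaultTolerant

end

/-! Fix a breadth-first search tree `T` rooted at `s`, and let `D_y(v)` be the distance from `s` to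
`v` in `G` after the failure of the tree edge above `y`. Once `H` contains `T`, failures of other
edges do no harm, so only the at most `n` failures of tree edges matter. With `K` close to
`n^(1/3)`, a skeleton of `O(nK)` edges is formed first and then enlarged by `O(nK + n²/K²)` edges at
most.

Small detours are made exact. Let `D_y(z)` exceed the depth of `z` by at most `2K`. If some shortest
replacement path ends with a tree edge, nothing has to be added. Among the other failures with the
same value of `D_y(z)`, a predecessor of `z` for the topmost one is a predecessor for all of them
(`IsBFSParent.isPred_of_isPred`). The excess takes at most `2K + 1` values, so `2K + 1` edges per
vertex suffice (`IsBFSParent.card_topmost_le`, `IsBFSParent.tdist_cut_le_of_near`).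

Clusters are formed greedily: a vertex with at least `K` unmarked non-tree neighbors becomes the
center of a star on them. There are at most `n/K` centers, and the edges at unmarked vertices that
remain number at most `nK`. Afterwards every missing edge joins marked vertices, and the star edges
survive each tree failure. Hence stretch `+2` at all centers gives stretch `+4` everywhere
(`IsSkeleton.tdist_cut_le`): detour through the center of the end of a missing edge.

Centers are repaired by path buying. If a center `c'` has stretch above `+2`, the end of a shortest
replacement path is added, from its last exactly reached vertex on. A shortest path meets a star in
at most three vertices, so the number of new edges is at most three times the number of clusters
entered. Each entered cluster, with center `c`, gains: either `c` comes closer to `c'`, or it comes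
closer to `K` vertices at the start of the detour, since otherwise `H` would already lead to `c'`
through `c` with error at most two. Weighting centers by `K + 1` and other vertices by `1`, the sum
of truncated distances to `c` drops by `K` in both cases (`row_potential_add_le`). The truncation
limits the total drop to `O(n²/K)`, so the purchases respect the bound (`buy_path`,
`IsPurchase.sq_mul_ncard_le`).

The algorithm consists of counted loops over vertices, which run in polynomial time
(`Cmd.exists_runs`); the lemmas on `exec` verify it with loop invariants. -/

namespace FaultTolerant

open SimpleGraph

/-! ### Distances as natural numbers, with a finite value for infinity. -/

section TruncatedDistance

variable {V : Type*} [Fintype V]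

open Classical in
/-- The distance in a finite graph, with the value `|V| + 4` for pairs that are not connected. -/
noncomputable def tdist (G : SimpleGraph V) (u v : V) : ℕ :=
  if G.Reachable u v then G.dist u v else Fintype.card V + 4

theorem tdist_of_reachable {G : SimpleGraph V} {u v : V} (h : G.Reachable u v) :
    tdist G u v = G.dist u v := if_pos h

theorem tdist_of_not_reachable {G : SimpleGraph V} {u v : V} (h : ¬ G.Reachable u v) :
    tdist G u v = Fintype.card V + 4 := if_neg h

theorem dist_lt_card {G : SimpleGraph V} {u v : V} (h : G.Reachable u v) :
    G.dist u v < Fintype.card V := by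
  obtain ⟨p, hp, hl⟩ := h.exists_path_of_dist
  exact hl ▸ hp.length_lt

theorem tdist_lt_card_iff {G : SimpleGraph V} {u v : V} :
    tdist G u v < Fintype.card V + 4 ↔ G.Reachable u v := by
  by_cases h : G.Reachable u v
  · have := dist_lt_card h
    simp only [tdist_of_reachable h, h, iff_true]; omega
  · simp [tdist_of_not_reachable h, h]

theorem tdist_lt_card {G : SimpleGraph V} {u v : V} (h : tdist G u v < Fintype.card V + 4) :
    tdist G u v < Fintype.card V := by
  have h' := tdist_lt_card_iff.1 h
  rw [tdist_of_reachable h']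
  exact dist_lt_card h'

theorem tdist_le_card (G : SimpleGraph V) (u v : V) : tdist G u v ≤ Fintype.card V + 4 := by
  by_cases h : G.Reachable u v
  · exact (tdist_lt_card_iff.2 h).le
  · exact (tdist_of_not_reachable h).le

theorem tdist_le_length {G : SimpleGraph V} {u v : V} (p : G.Walk u v) :
    tdist G u v ≤ p.length := by
  rw [tdist_of_reachable ⟨p⟩]; exact dist_le p

theorem exists_walk_length_eq_tdist {G : SimpleGraph V} {u v : V}
    (h : tdist G u v < Fintype.card V + 4) : ∃ p : G.Walk u v, p.length = tdist G u v := by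
  have h' := tdist_lt_card_iff.1 h
  obtain ⟨p, hp⟩ := h'.exists_walk_length_eq_dist
  exact ⟨p, by rw [hp, tdist_of_reachable h']⟩

@[simp] theorem tdist_self (G : SimpleGraph V) (v : V) : tdist G v v = 0 := by
  rw [tdist_of_reachable (Reachable.refl v)]; simp

theorem tdist_comm (G : SimpleGraph V) (u v : V) : tdist G u v = tdist G v u := by
  by_cases h : G.Reachable u v
  · rw [tdist_of_reachable h, tdist_of_reachable h.symm, dist_comm]
  · rw [tdist_of_not_reachable h, tdist_of_not_reachable (fun h' => h h'.symm)]

/-- No distance exceeds the value for infinity, so the inequality is trivial when a summand is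
infinite; otherwise two walks are concatenated. -/
theorem tdist_triangle (G : SimpleGraph V) (u v w : V) :
    tdist G u w ≤ tdist G u v + tdist G v w := by
  have hc := tdist_le_card G u w
  by_cases h₁ : tdist G u v < Fintype.card V + 4
  · by_cases h₂ : tdist G v w < Fintype.card V + 4
    · obtain ⟨p, hp⟩ := exists_walk_length_eq_tdist h₁
      obtain ⟨q, hq⟩ := exists_walk_length_eq_tdist h₂
      have := tdist_le_length (p.append q)
      rw [Walk.length_append] at this; omega
    · omega
  · omega

theorem tdist_anti {G H : SimpleGraph V} (h : H ≤ G) (u v : V) : tdist G u v ≤ tdist H u v := by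
  by_cases hr : tdist H u v < Fintype.card V + 4
  · obtain ⟨p, hp⟩ := exists_walk_length_eq_tdist hr
    have := tdist_le_length (p.mapLe h)
    rw [← hp]; simpa using this
  · have := tdist_le_card G u v
    omega

theorem tdist_le_one_of_adj {G : SimpleGraph V} {v w : V} (h : G.Adj v w) : tdist G v w ≤ 1 := by
  simpa using tdist_le_length (Walk.cons h Walk.nil)

theorem tdist_le_add_one {G : SimpleGraph V} (u : V) {v w : V} (h : G.Adj v w) :
    tdist G u w ≤ tdist G u v + 1 :=
  (tdist_triangle G u v w).trans (by have := tdist_le_one_of_adj h; omega)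

theorem tdist_add_tdist_le_length {G : SimpleGraph V} {u v x : V} (p : G.Walk u v)
    (hx : x ∈ p.support) : tdist G u x + tdist G x v ≤ p.length := by
  obtain ⟨q, r, rfl⟩ := Walk.mem_support_iff_exists_append.1 hx
  rw [Walk.length_append]
  exact add_le_add (tdist_le_length q) (tdist_le_length r)

theorem exists_adj_tdist_add_one {G : SimpleGraph V} {s v : V} (hv : v ≠ s)
    (h : tdist G s v < Fintype.card V + 4) : ∃ u, G.Adj u v ∧ tdist G s u + 1 = tdist G s v := by
  obtain ⟨p, hp⟩ := exists_walk_length_eq_tdist h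
  have hnil : ¬ p.Nil := fun hn => hv hn.eq.symm
  have hadj := p.adj_penultimate hnil
  refine ⟨p.penultimate, hadj, ?_⟩
  have h₁ := tdist_le_add_one s hadj
  have h₂ := tdist_le_length p.dropLast
  have h₃ : p.dropLast.length + 1 = p.length := by
    have := Walk.length_dropLast_add_one hnil
    exact this
  omega

theorem eq_of_tdist_eq_zero {G : SimpleGraph V} {u v : V} (h : tdist G u v = 0) : u = v := by
  obtain ⟨p, hp⟩ := exists_walk_length_eq_tdist (G := G) (u := u) (v := v) (by omega)
  exact Walk.eq_of_length_eq_zero (hp.trans h)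

/-- This is the reason for the default `|V| + 4`: finite distances are below `|V|`, so an additive
error of four cannot reach the default, and reachability in `G` forces reachability in `H`. -/
theorem edist_le_edist_add {G H : SimpleGraph V} {u v : V}
    (h : tdist H u v ≤ tdist G u v + 4) : H.edist u v ≤ G.edist u v + 4 := by
  by_cases hG : G.Reachable u v
  · have h₁ := tdist_lt_card (tdist_lt_card_iff.2 hG)
    have hH : H.Reachable u v := tdist_lt_card_iff.1 (by omega)
    rw [tdist_of_reachable hG, tdist_of_reachable hH] at h
    rw [← hG.coe_dist_eq_edist, ← hH.coe_dist_eq_edist]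
    exact_mod_cast h
  · rw [edist_eq_top_of_not_reachable hG]; simp

end TruncatedDistance

/-! ### Breadth-first search trees and the failure of a tree edge. -/

section Tree

variable {V : Type*} {G H : SimpleGraph V} {s : V} {par : V → V}

/-- The graph `G` after the failure of the tree edge from `y` to its parent. -/
def cut (G : SimpleGraph V) (par : V → V) (y : V) : SimpleGraph V := G.deleteEdges {s(par y, y)}

/-- `v` belongs to the subtree of `y`. -/
def Below (par : V → V) (y v : V) : Prop := ∃ i : ℕ, par^[i] v = y

/-- The tree of `par` is contained in `H`. -/
def ContainsTree (par : V → V) (H : SimpleGraph V) : Prop := ∀ v, par v ≠ v → H.Adj (par v) v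

theorem cut_le : cut G par s ≤ G := deleteEdges_le _

theorem cut_mono (h : H ≤ G) (y : V) : cut H par y ≤ cut G par y := deleteEdges_mono h

theorem cut_adj {y u v : V} : (cut G par y).Adj u v ↔ G.Adj u v ∧ s(u, v) ≠ s(par y, y) := by
  simp [cut, deleteEdges_adj]

/-- A vertex without a tree edge above it stands for no failure, because the deleted pair is then a
loop. Hence `y` may range over all vertices, and `y = s` yields the undamaged graph. -/
theorem cut_eq_self {y : V} (h : par y = y) : cut G par y = G := by
  ext u v
  rw [cut_adj, h]
  refine and_iff_left_of_imp fun hadj he => ?_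
  rw [Sym2.eq_iff] at he
  rcases he with ⟨rfl, rfl⟩ | ⟨rfl, rfl⟩ <;> exact hadj.ne rfl

theorem Below.refl (y : V) : Below par y y := ⟨0, rfl⟩

theorem Below.of_par {y v : V} (h : Below par y (par v)) : Below par y v := by
  obtain ⟨i, hi⟩ := h
  exact ⟨i + 1, hi⟩

theorem Below.eq_or_par {y v : V} (h : Below par y v) : v = y ∨ Below par y (par v) := by
  obtain ⟨i, hi⟩ := h
  rcases i with _ | i
  · exact .inl hi
  · exact .inr ⟨i, hi⟩

theorem Below.total {x y v : V} (hx : Below par x v) (hy : Below par y v) :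
    Below par x y ∨ Below par y x := by
  obtain ⟨i, rfl⟩ := hx
  obtain ⟨j, rfl⟩ := hy
  rcases le_total i j with h | h
  · exact .inr ⟨j - i, by rw [← Function.iterate_add_apply, Nat.sub_add_cancel h]⟩
  · exact .inl ⟨i - j, by rw [← Function.iterate_add_apply, Nat.sub_add_cancel h]⟩

variable [Fintype V]

/-- `par` is the parent function of a breadth-first search tree of the component of `s`; it fixes
`s` and the vertices outside of that component. -/
structure IsBFSParent (G : SimpleGraph V) (s : V) (par : V → V) : Prop where
  adj : ∀ v, v ≠ s → tdist G s v < Fintype.card V + 4 →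
    G.Adj (par v) v ∧ tdist G s (par v) + 1 = tdist G s v
  fix : ∀ v, v = s ∨ ¬ tdist G s v < Fintype.card V + 4 → par v = v

namespace IsBFSParent

theorem of_ne (hp : IsBFSParent G s par) {v : V} (h : par v ≠ v) :
    v ≠ s ∧ tdist G s v < Fintype.card V + 4 ∧ G.Adj (par v) v ∧
      tdist G s (par v) + 1 = tdist G s v := by
  have h₁ : v ≠ s := fun hv => h (hp.fix v (.inl hv))
  have h₂ : tdist G s v < Fintype.card V + 4 := by
    by_contra hv
    exact h (hp.fix v (.inr hv))
  exact ⟨h₁, h₂, hp.adj v h₁ h₂⟩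

theorem containsTree (hp : IsBFSParent G s par) : ContainsTree par G :=
  fun _ hv => (hp.of_ne hv).2.2.1

/-- Each tree edge is determined by its lower end, since depth increases by one along it; so the
failure above `y` destroys no tree edge with lower end `v ≠ y`. -/
theorem cut_par_adj (hp : IsBFSParent G s par) (hT : ContainsTree par H) {v y : V}
    (hv : par v ≠ v) (hvy : v ≠ y) : (cut H par y).Adj (par v) v := by
  refine cut_adj.2 ⟨hT v hv, fun he => ?_⟩
  rcases Sym2.eq_iff.1 he with ⟨-, h⟩ | ⟨h₁, h₂⟩
  · exact hvy h
  · have h₃ := (hp.of_ne hv).2.2.2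
    have h₄ : par y ≠ y := by rw [← h₂]; exact hvy
    have h₅ := (hp.of_ne h₄).2.2.2
    rw [h₁] at h₃
    rw [← h₂] at h₅
    omega

theorem depth_le_of_below (hp : IsBFSParent G s par) {x v : V} (h : Below par x v) :
    x = v ∨ tdist G s x < tdist G s v := by
  obtain ⟨i, hi⟩ := h
  induction i generalizing v with
  | zero => exact .inl hi.symm
  | succ i ih =>
    by_cases hv : par v = v
    · refine ih ?_
      rw [← hi, Function.iterate_succ_apply, hv]
    · have h₁ := (hp.of_ne hv).2.2.2
      rcases ih (v := par v) hi with h | h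
      · right; rw [h]; omega
      · right; omega

/-- The tree path from `x` down to `v` survives every failure not strictly below `x`. -/
theorem tdist_cut_add_le (hp : IsBFSParent G s par) (hT : ContainsTree par H) {x y v : V}
    (hxv : Below par x v) (hyx : tdist G s y ≤ tdist G s x) :
    tdist (cut H par y) x v + tdist G s x ≤ tdist G s v := by
  obtain ⟨i, hi⟩ := hxv
  induction i generalizing v with
  | zero => obtain rfl : v = x := hi; simp
  | succ i ih =>
    by_cases hv : par v = v
    · refine ih ?_
      rw [← hi, Function.iterate_succ_apply, hv]
    · have h₁ := (hp.of_ne hv).2.2.2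
      have h₂ := ih (v := par v) hi
      have hvy : v ≠ y := by rintro rfl; omega
      have := tdist_le_add_one x (hp.cut_par_adj hT hv hvy)
      omega

/-- Vertices outside of the subtree of `y` keep their distance when the edge above `y` fails. -/
theorem tdist_cut_le_of_not_below (hp : IsBFSParent G s par) (hT : ContainsTree par H) {y v : V}
    (h : ¬ Below par y v) : tdist (cut H par y) s v ≤ tdist G s v := by
  induction hd : tdist G s v using Nat.strong_induction_on generalizing v with
  | _ d ih =>
    subst hd
    by_cases hv : par v = v
    · by_cases hvs : v = s
      · simp [hvs]
      · by_cases hr : tdist G s v < Fintype.card V + 4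
        · exact absurd hv (hp.adj v hvs hr).1.ne
        · exact (tdist_le_card _ _ _).trans (not_lt.1 hr)
    · have h₁ := (hp.of_ne hv).2.2.2
      have hvy : v ≠ y := by rintro rfl; exact h (Below.refl v)
      have h₂ := ih _ (by omega) (fun hb => h hb.of_par) rfl
      have := tdist_le_add_one s (hp.cut_par_adj hT hv hvy)
      omega

theorem tdist_le_of_containsTree (hp : IsBFSParent G s par) (hT : ContainsTree par H) (v : V) :
    tdist H s v ≤ tdist G s v := by
  by_cases h : Below par s v
  · have := hp.tdist_cut_add_le hT h le_rfl
    rw [cut_eq_self (hp.fix s (.inl rfl))] at this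
    omega
  · have := hp.tdist_cut_le_of_not_below hT h
    rwa [cut_eq_self (hp.fix s (.inl rfl))] at this

/-- Distances within the subtree of `y` are unaffected by the failure of the edge above `y`. -/
theorem tdist_cut_le_of_below (hp : IsBFSParent G s par) (hT : ContainsTree par H) (hH : H ≤ G)
    {y w v : V} (hw : Below par y w) (hv : Below par y v) :
    tdist (cut H par y) w v ≤ tdist H w v := by
  by_cases hr : tdist H w v < Fintype.card V + 4
  · obtain ⟨p, hl⟩ := exists_walk_length_eq_tdist hr
    -- A shortest path that uses the failing edge visits `par y`. The tree paths from `y` to `w` and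
    -- to `v` survive, and joining them is shorter by at least two, as `par y` is one level higher
    -- than `y`.
    by_cases he : s(par y, y) ∈ p.edges
    · have hy : par y ≠ y := (p.adj_of_mem_edges he).ne
      have h₁ := (hp.of_ne hy).2.2.2
      have h₂ := tdist_add_tdist_le_length p (p.fst_mem_support_of_mem_edges he)
      have h₃ := tdist_anti hH w (par y)
      have h₄ := tdist_anti hH (par y) v
      have h₅ := tdist_triangle G s (par y) w
      have h₆ := tdist_triangle G s (par y) v
      have h₇ := hp.tdist_cut_add_le hT hw le_rfl
      have h₈ := hp.tdist_cut_add_le hT hv le_rfl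
      have h₉ := tdist_triangle (cut H par y) w y v
      rw [tdist_comm _ w y] at h₉
      rw [tdist_comm G w (par y)] at h₃
      omega
    · have := tdist_le_length (p.toDeleteEdges {s(par y, y)} (by
        intro e hep hes
        rw [Set.mem_singleton_iff] at hes
        exact he (hes ▸ hep)))
      rw [← hl]
      simpa [cut] using this
  · exact (tdist_le_card _ _ _).trans (not_lt.1 hr)

end IsBFSParent

end Tree

/-! ### Few edges make all replacement paths with small detours available. -/

section SmallDetours

variable {V : Type*} [Fintype V] {G H : SimpleGraph V} {s : V} {par : V → V} {K : ℕ}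

theorem Below.trans {V : Type*} {par : V → V} {x y z : V} (h₁ : Below par x y)
    (h₂ : Below par y z) : Below par x z := by
  obtain ⟨i, rfl⟩ := h₁
  obtain ⟨j, rfl⟩ := h₂
  exact ⟨i + j, Function.iterate_add_apply _ _ _ _⟩

/-- The failure of the edge above `y` increases the distance of `z` by at most `2 * K`. -/
def Near (G : SimpleGraph V) (s : V) (par : V → V) (K : ℕ) (y z : V) : Prop :=
  tdist (cut G par y) s z < Fintype.card V + 4 ∧
    tdist (cut G par y) s z ≤ tdist G s z + 2 * K

/-- `u` precedes `z` on a shortest path from `s` that avoids the edge above `y`. -/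
def IsPred (G : SimpleGraph V) (s : V) (par : V → V) (y u z : V) : Prop :=
  (cut G par y).Adj u z ∧ tdist (cut G par y) s u + 1 = tdist (cut G par y) s z

/-- No shortest path to `z` that avoids the edge above `y` ends with a tree edge. -/
def Need (G : SimpleGraph V) (s : V) (par : V → V) (K : ℕ) (y z : V) : Prop :=
  z ≠ s ∧ Near G s par K y z ∧
    ¬ (z ≠ y ∧ tdist (cut G par y) s (par z) + 1 = tdist (cut G par y) s z)

/-- The edge above `y` is the topmost one among those with the same replacement distance. -/
def Topmost (G : SimpleGraph V) (s : V) (par : V → V) (K : ℕ) (y z : V) : Prop :=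
  Need G s par K y z ∧ ∀ y', Need G s par K y' z →
    tdist (cut G par y') s z = tdist (cut G par y) s z → tdist G s y ≤ tdist G s y'

namespace IsBFSParent

variable (hp : IsBFSParent G s par)
include hp

/-- Outside of the subtree of `y` neither `z` nor its parent changes its distance, so the tree edge
into `z` would end a shortest path. -/
theorem below_of_need {y z : V} (h : Need G s par K y z) : Below par y z := by
  obtain ⟨hzs, ⟨hlt, -⟩, hpar⟩ := h
  by_contra hb
  have h₁ := hp.tdist_cut_le_of_not_below hp.containsTree hb
  have h₂ := tdist_anti (cut_le (G := G) (par := par) (s := y)) s z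
  obtain ⟨-, h₃⟩ := hp.adj z hzs (by omega)
  have h₄ := hp.tdist_cut_le_of_not_below hp.containsTree (fun h => hb h.of_par)
  have h₅ := tdist_anti (cut_le (G := G) (par := par) (s := y)) s (par z)
  exact hpar ⟨fun h => hb (by rw [h]; exact Below.refl y), by omega⟩

theorem eq_of_below_of_depth_eq {y y' z : V} (h : Below par y z) (h' : Below par y' z)
    (he : tdist G s y = tdist G s y') : y = y' := by
  rcases h.total h' with hb | hb <;> rcases hp.depth_le_of_below hb with h | h
  · exact h
  · omega
  · exact h.symm
  · omega

/-- A shortest path to `u` that avoids the higher failure `y` also avoids the upper end of the lower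
edge, hence that edge itself. So `u` is no farther after the failure above `y'`, and equality of the
two replacement distances of `z` makes it a predecessor there. -/
theorem isPred_of_isPred {y y' u z : V} (hy : Need G s par K y z) (hy' : Need G s par K y' z)
    (hD : tdist (cut G par y) s z = tdist (cut G par y') s z)
    (hlt : tdist G s y < tdist G s y') (hu : IsPred G s par y u z) : IsPred G s par y' u z := by
  have hT := hp.containsTree
  have hbz := hp.below_of_need hy
  have hbz' := hp.below_of_need hy'
  have hyz' : tdist G s y' ≤ tdist G s z := by
    rcases hp.depth_le_of_below hbz' with h | h
    · rw [h]
    · exact h.le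
  have hb : Below par y y' := by
    rcases hbz.total hbz' with h | h
    · exact h
    · rcases hp.depth_le_of_below h with h | h
      · rw [h] at hlt; omega
      · omega
  obtain ⟨hzs, ⟨hfin, -⟩, hnp⟩ := hy
  obtain ⟨huadj, huD⟩ := hu
  have hGz := tdist_anti (cut_le (G := G) (par := par) (s := y)) s z
  have hys' : y' ≠ s := by rintro rfl; simp at hlt
  obtain ⟨hadj', hdx⟩ := hp.adj y' hys' (by omega)
  obtain ⟨hadjz, hdz⟩ := hp.adj z hzs (by omega)
  have hzy : z ≠ y := by rintro rfl; omega
  have hyy' : y' ≠ y := by rintro rfl; omega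
  have hbx : Below par y (par y') := hb.eq_or_par.resolve_left hyy'
  have hxz : Below par (par y') z := Below.trans (Below.of_par (Below.refl _)) hbz'
  have hxpz : Below par (par y') (par z) := by
    refine hxz.eq_or_par.resolve_left ?_
    intro h
    rw [← h] at hdx
    omega
  have h₁ := tdist_le_add_one s (hp.cut_par_adj hT hadjz.ne hzy)
  have h₂ : tdist (cut G par y) s (par z) + 1 ≠ tdist (cut G par y) s z :=
    fun h => hnp ⟨hzy, h⟩
  obtain ⟨p, hlen⟩ := exists_walk_length_eq_tdist (G := cut G par y) (u := s) (v := u) (by omega)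
  -- If the path met `x = par y'`, its rest would be at least as long as the tree path from `x` to
  -- `par z`, because the depth of `z` is at most that of `u` plus one. This tree path survives the
  -- failure above `y`, so `par z` would be a predecessor of `z`, which `Need` excludes.
  have hx : par y' ∉ p.support := by
    intro hx
    have h₃ := tdist_add_tdist_le_length p hx
    have h₄ := tdist_anti (cut_le (G := G) (par := par) (s := y)) (par y') u
    have h₅ := tdist_triangle G s (par y') u
    have h₆ := tdist_le_add_one s (cut_adj.1 huadj).1
    have h₇ := hp.tdist_cut_add_le hT (y := y) hxpz (by omega)
    have h₈ := tdist_triangle (cut G par y) s (par y') (par z)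
    omega
  have hDu : tdist (cut G par y') s u ≤ tdist (cut G par y) s u := by
    have h₃ : tdist (cut G par y') s u ≤ _ := tdist_le_length ((p.mapLe cut_le).toDeleteEdges {s(par y', y')} (by
      intro e hep hes
      rw [Set.mem_singleton_iff] at hes
      rw [hes, Walk.edges_mapLe_eq_edges] at hep
      exact hx (p.fst_mem_support_of_mem_edges hep)))
    rw [← hlen]
    simpa using h₃
  have hadj : (cut G par y').Adj u z := by
    refine cut_adj.2 ⟨(cut_adj.1 huadj).1, fun he => ?_⟩
    rcases Sym2.eq_iff.1 he with ⟨h₃, h₄⟩ | ⟨h₃, h₄⟩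
    · rw [h₃, ← h₄] at huD
      exact h₂ huD
    · rw [← h₄] at hdx
      omega
  have := tdist_le_add_one s hadj
  exact ⟨hadj, by omega⟩

-- The excess of the replacement distance over the depth lies between `0` and `2 * K`. It is
-- injective on topmost failures: two with the same value have equal depth and are ancestors of `z`.
open Classical in
theorem card_topmost_le (z : V) :
    (Finset.univ.filter fun y => Topmost G s par K y z).card ≤ 2 * K + 1 := by
  rw [← Finset.card_range (2 * K + 1)]
  refine Finset.card_le_card_of_injOn (fun y => tdist (cut G par y) s z - tdist G s z) ?_ ?_
  · intro y hy
    have h := (Finset.mem_filter.1 hy).2.1.2.1.2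
    simp only [Finset.coe_range, Set.mem_Iio]
    omega
  · intro y hy y' hy' he
    have h := (Finset.mem_filter.1 hy).2
    have h' := (Finset.mem_filter.1 hy').2
    have h₁ := tdist_anti (cut_le (G := G) (par := par) (s := y)) s z
    have h₂ := tdist_anti (cut_le (G := G) (par := par) (s := y')) s z
    have he' : tdist (cut G par y) s z = tdist (cut G par y') s z := by
      simp only at he
      omega
    exact hp.eq_of_below_of_depth_eq (hp.below_of_need h.1) (hp.below_of_need h'.1)
      (le_antisymm (h.2 y' h'.1 he'.symm) (h'.2 y h.1 he'))

/-- One last edge for each topmost failure makes all replacement paths with small detours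
available. -/
theorem tdist_cut_le_of_near (hT : ContainsTree par H)
    (hH : ∀ y z, Topmost G s par K y z → ∃ u, IsPred G s par y u z ∧ H.Adj u z) {y z : V}
    (hn : Near G s par K y z) : tdist (cut H par y) s z ≤ tdist (cut G par y) s z := by
  induction hd : tdist (cut G par y) s z using Nat.strong_induction_on generalizing z with
  | _ d ih =>
    subst hd
    by_cases hzs : z = s
    · simp [hzs]
    obtain ⟨u, hu, hadj⟩ : ∃ u, IsPred G s par y u z ∧ (cut H par y).Adj u z := by
      by_cases hneed : Need G s par K y z
      · classical
        -- The edge stored for the topmost failure `y₀` of the same replacement distance also serves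
        -- `y`.
        obtain ⟨y₀, hy₀, hmin⟩ := Finset.exists_min_image
          (Finset.univ.filter fun y' => Need G s par K y' z ∧
            tdist (cut G par y') s z = tdist (cut G par y) s z) (fun y' => tdist G s y')
          ⟨y, by simpa using hneed⟩
        simp only [Finset.mem_filter, Finset.mem_univ, true_and] at hy₀ hmin
        obtain ⟨u, hu, hadj⟩ := hH y₀ z
          ⟨hy₀.1, fun y' hy' he => hmin y' ⟨hy', he.trans hy₀.2⟩⟩
        have hpred : IsPred G s par y u z := by
          rcases (hmin y ⟨hneed, rfl⟩).eq_or_lt with h | h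
          · obtain rfl := hp.eq_of_below_of_depth_eq (hp.below_of_need hy₀.1)
              (hp.below_of_need hneed) h
            exact hu
          · exact hp.isPred_of_isPred hy₀.1 hneed hy₀.2 h hu
        exact ⟨u, hpred, cut_adj.2 ⟨hadj, (cut_adj.1 hpred.1).2⟩⟩
      · have hpar : z ≠ y ∧ tdist (cut G par y) s (par z) + 1 = tdist (cut G par y) s z := by
          by_contra h
          exact hneed ⟨hzs, hn, h⟩
        have h₂ := tdist_anti (cut_le (G := G) (par := par) (s := y)) s z
        have hne := (hp.adj z hzs (h₂.trans_lt hn.1)).1.ne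
        exact ⟨par z, ⟨hp.cut_par_adj hp.containsTree hne hpar.1, hpar.2⟩,
          hp.cut_par_adj hT hne hpar.1⟩
    obtain ⟨huadj, huD⟩ := hu
    have h₁ := tdist_le_add_one s (cut_adj.1 huadj).1
    -- Passing to the predecessor lowers the replacement distance by one and the depth by at most
    -- one, so the detour stays small.
    have h₂ := ih _ (by omega) (z := u) ⟨by have := hn.1; omega, by have := hn.2; omega⟩ rfl
    have h₃ := tdist_le_add_one s hadj
    omega

end IsBFSParent

end SmallDetours

/-! ### Clusters, the potential, and the cost of bought paths. -/

section PathBuying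

variable {V : Type*} [Fintype V] {G H H' : SimpleGraph V} {s : V} {par : V → V} {K : ℕ}
  {S : Finset V} {marked : V → Prop} {cl : V → V}

theorem tdist_le_of_chain {A : SimpleGraph V} {P : ℕ → V} {i k : ℕ}
    (h : ∀ t, i ≤ t → t < i + k → A.Adj (P t) (P (t + 1))) : tdist A (P i) (P (i + k)) ≤ k := by
  induction k with
  | zero => simp
  | succ k ih =>
    have h₁ := ih (fun t h₁ h₂ => h t h₁ (by omega))
    have h₂ := tdist_le_add_one (P i) (h (i + k) (by omega) (by omega))
    rw [← add_assoc]
    omega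

/-- A subgraph `H` that contains the tree, is exact for small detours, and all of whose missing
edges join vertices that are marked; each marked vertex `z` is joined to a center `cl z ∈ S` by an
edge of `H` that is not a tree edge. -/
structure IsSkeleton (G H : SimpleGraph V) (s : V) (par : V → V) (K : ℕ) (S : Finset V)
    (marked : V → Prop) (cl : V → V) : Prop where
  le : H ≤ G
  tree : ContainsTree par H
  near : ∀ y z, Near G s par K y z → tdist (cut H par y) s z ≤ tdist (cut G par y) s z
  center_mem : ∀ z, marked z → cl z ∈ S
  center_adj : ∀ z, marked z → H.Adj (cl z) z
  center_ne : ∀ z, marked z → ∀ y, s(cl z, z) ≠ s(par y, y)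
  marked_of_missing : ∀ u v, G.Adj u v → ¬ H.Adj u v → marked v

theorem IsSkeleton.mono (h : IsSkeleton G H s par K S marked cl) (hH : H ≤ H') (hG : H' ≤ G) :
    IsSkeleton G H' s par K S marked cl where
  le := hG
  tree := fun v hv => hH (h.tree v hv)
  near := fun y z hn => (tdist_anti (cut_mono hH y) s z).trans (h.near y z hn)
  center_mem := h.center_mem
  center_adj := fun z hz => hH (h.center_adj z hz)
  center_ne := h.center_ne
  marked_of_missing := fun u v hG hH' => h.marked_of_missing u v hG fun hn => hH' (hH hn)

/-- The distance in `H`, truncated at the distance in `G` plus three. -/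
noncomputable def truncDist (G H : SimpleGraph V) (p c : V) : ℕ :=
  min (tdist H p c) (tdist G p c + 3)

open Classical in
/-- The weight of a vertex in the potential. -/
noncomputable def weight (K : ℕ) (S : Finset V) (p : V) : ℕ := 1 + if p ∈ S then K else 0

/-- The potential that pays for bought paths. -/
noncomputable def potential (G : SimpleGraph V) (K : ℕ) (S : Finset V) (H : SimpleGraph V) : ℕ :=
  ∑ c ∈ S, ∑ p, weight K S p * truncDist G H p c

theorem truncDist_anti (h : H ≤ H') (p c : V) : truncDist G H' p c ≤ truncDist G H p c :=
  min_le_min_right _ (tdist_anti h p c)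

theorem sum_weight (K : ℕ) (S : Finset V) :
    ∑ p, weight K S p = Fintype.card V + S.card * K := by
  classical
  simp [weight, Finset.sum_add_distrib]

/-- Truncation confines each distance to an interval of length three above the distance in `G`,
whatever the graph `H` is. Hence the potential can fall by at most three per unit of weight. -/
theorem potential_le_add (hH' : H' ≤ G) : potential G K S H ≤
    potential G K S H' + S.card * (3 * (Fintype.card V + S.card * K)) := by
  rw [potential, potential, ← smul_eq_mul S.card, ← Finset.sum_const, ← Finset.sum_add_distrib]
  refine Finset.sum_le_sum fun c _ => ?_
  rw [← sum_weight, Finset.mul_sum, ← Finset.sum_add_distrib]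
  refine Finset.sum_le_sum fun p _ => ?_
  have h₁ : truncDist G H p c ≤ truncDist G H' p c + 3 := by
    have := tdist_anti hH' p c
    simp only [truncDist]
    omega
  calc weight K S p * truncDist G H p c ≤ weight K S p * (truncDist G H' p c + 3) :=
        Nat.mul_le_mul_left _ h₁
    _ = _ := by ring

theorem add_mul_le_mul_of_succ_le {k w a b : ℕ} (hk : k ≤ w) (h : a + 1 ≤ b) :
    k + w * a ≤ w * b :=
  calc k + w * a ≤ w * (a + 1) := by rw [Nat.mul_add, mul_one]; omega
    _ ≤ w * b := Nat.mul_le_mul_left _ h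

/-- The new edges of a bought path enter pairwise distinct clusters up to a factor of three. -/
theorem card_le_three_mul_card_image [DecidableEq V] (hsk : IsSkeleton G H s par K S marked cl)
    {y : V} {x : ℕ → V} {J : Finset ℕ} {L : ℕ}
    (hD : ∀ j ∈ J, tdist (cut G par y) s (x j) + j = L) (hJ : ∀ j ∈ J, marked (x j)) :
    J.card ≤ 3 * (J.image fun j => cl (x j)).card := by
  refine Finset.card_le_mul_card_image _ _ fun c _ => ?_
  -- The vertices of a star lie in the layers `d - 1`, `d` and `d + 1` around its center, and on a
  -- shortest path the layer determines the index.
  set d := tdist (cut G par y) s c with hd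
  have h₀ : (Finset.Icc (d - 1) (d + 1)).card ≤ 3 := by simp only [Nat.card_Icc]; omega
  refine le_trans (Finset.card_le_card_of_injOn (fun j => tdist (cut G par y) s (x j)) ?_ ?_) h₀
  · intro j hj
    obtain ⟨hjJ, rfl⟩ := Finset.mem_filter.1 hj
    have hadj : (cut G par y).Adj (cl (x j)) (x j) := cut_adj.2
      ⟨hsk.le (hsk.center_adj _ (hJ j hjJ)), hsk.center_ne _ (hJ j hjJ) y⟩
    have h₁ := tdist_le_add_one s hadj
    have h₂ := tdist_le_add_one s hadj.symm
    simp only [Finset.coe_Icc, Set.mem_Icc]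
    omega
  · intro i hi j hj he
    have h₁ := hD i (Finset.mem_filter.1 hi).1
    have h₂ := hD j (Finset.mem_filter.1 hj).1
    simp only at he
    omega

/-- A shortest path of `H` to the exactly reached vertex `x m` is followed by the bought vertices in
reverse order. Each position equals the distance from `s`, which places `x j` at its replacement
distance. -/
theorem exists_path_through {y c' : V} {x : ℕ → V} {m j : ℕ} (hj : j < m)
    (hfin : tdist (cut G par y) s c' < Fintype.card V + 4) (hH : H ≤ G) (hHH' : H ≤ H')
    (hpred : ∀ j < m, IsPred G s par y (x (j + 1)) (x j))
    (hend : tdist (cut H par y) s (x m) = tdist (cut G par y) s (x m))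
    (hadj : ∀ j < m, H'.Adj (x (j + 1)) (x j))
    (hD : ∀ i ≤ m, tdist (cut G par y) s (x i) + i = tdist (cut G par y) s c') :
    ∃ P : ℕ → V, P 0 = s ∧ P (tdist (cut G par y) s (x j)) = x j ∧
      ∀ i < tdist (cut G par y) s (x j), (cut G par y).Adj (P i) (P (i + 1)) ∧
        H'.Adj (P i) (P (i + 1)) := by
  have hDm := hD m le_rfl
  have hDj := hD j hj.le
  obtain ⟨w, hw⟩ := exists_walk_length_eq_tdist (G := cut H par y) (u := s) (v := x m) (by omega)
  rw [hend] at hw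
  set a := tdist (cut G par y) s (x m) with ha
  refine ⟨fun i => if i ≤ a then w.getVert i else x (m - (i - a)), by simp, ?_, ?_⟩
  · have : ¬ tdist (cut G par y) s (x j) ≤ a := by omega
    simp only [this, if_false]
    congr 1
    omega
  · intro i hi
    rcases lt_trichotomy i a with h | h | h
    · have h₁ := w.adj_getVert_succ (i := i) (by omega)
      simp only [h.le, Nat.succ_le_of_lt h, if_true]
      exact ⟨cut_mono hH y h₁, hHH' (cut_le h₁)⟩
    · have h₁ : x m = x (m - 1 + 1) := by congr 1; omega
      have h₂ : w.getVert a = x (m - 1 + 1) := by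
        rw [← h₁, ← hw]; exact w.getVert_length
      rw [h]
      simp only [le_refl, if_true, Nat.not_succ_le_self, if_false, Nat.add_sub_cancel_left]
      rw [h₂]
      exact ⟨(hpred (m - 1) (by omega)).1, hadj (m - 1) (by omega)⟩
    · have h₁ : ¬ i ≤ a := by omega
      have h₂ : ¬ i + 1 ≤ a := by omega
      have h₃ : m - (i - a) = m - (i + 1 - a) + 1 := by omega
      simp only [h₁, h₂, if_false, h₃]
      exact ⟨(hpred _ (by omega)).1, hadj _ (by omega)⟩

/-- Buying a path lowers the potential of every cluster that the path enters by a new edge. -/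
theorem row_potential_add_le (hp : IsBFSParent G s par) (hK : 1 ≤ K)
    (hsk : IsSkeleton G H s par K S marked cl) {y c' : V} (hc' : c' ∈ S)
    (hbad : tdist (cut G par y) s c' + 2 < tdist (cut H par y) s c')
    {x : ℕ → V} {m : ℕ} (hx0 : x 0 = c')
    (hne : ∀ j < m, tdist (cut H par y) s (x j) ≠ tdist (cut G par y) s (x j))
    (hpred : ∀ j < m, IsPred G s par y (x (j + 1)) (x j))
    (hend : tdist (cut H par y) s (x m) = tdist (cut G par y) s (x m))
    (hHH' : H ≤ H') (hadj : ∀ j < m, H'.Adj (x (j + 1)) (x j))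
    (hD : ∀ i ≤ m, tdist (cut G par y) s (x i) + i = tdist (cut G par y) s c')
    {j : ℕ} (hj : j < m) (hjm : marked (x j)) :
    K + ∑ p, weight K S p * truncDist G H' p (cl (x j)) ≤
      ∑ p, weight K S p * truncDist G H p (cl (x j)) := by
  classical
  -- It is enough to distribute the gain `K` over the vertices: either all of it to `c'`, or one
  -- unit to each of `K` vertices of the path.
  suffices h : ∃ f : V → ℕ, ∑ p, f p = K ∧ ∀ p,
      f p + weight K S p * truncDist G H' p (cl (x j)) ≤
        weight K S p * truncDist G H p (cl (x j)) by
    obtain ⟨f, hf, hle⟩ := h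
    have h := Finset.sum_le_sum fun p (_ : p ∈ Finset.univ) => hle p
    rwa [Finset.sum_add_distrib, hf] at h
  have hfin : tdist (cut G par y) s c' < Fintype.card V + 4 := by
    have := tdist_le_card (cut H par y) s c'
    omega
  have hcutG : ∀ v, tdist G s v ≤ tdist (cut G par y) s v := fun v => tdist_anti cut_le s v
  have hcutH : ∀ v, tdist (cut G par y) s v ≤ tdist (cut H par y) s v :=
    fun v => tdist_anti (cut_mono hsk.le y) s v
  have hys : y ≠ s := by
    rintro rfl
    have h := hp.tdist_le_of_containsTree hsk.tree c'
    rw [cut_eq_self (hp.fix y (.inl rfl)), cut_eq_self (hp.fix y (.inl rfl))] at hbad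
    omega
  have hout : ∀ v, ¬ Below par y v → tdist (cut G par y) s v ≤ tdist G s v :=
    fun v => hp.tdist_cut_le_of_not_below hp.containsTree
  have hbelow : ∀ i < m, Below par y (x i) := by
    intro i hi
    by_contra hb
    have h₁ := hp.tdist_cut_le_of_not_below hsk.tree hb
    have h₂ := hcutG (x i)
    have h₃ := hcutH (x i)
    exact hne i hi (by omega)
  set z := x j with hz
  set c := cl z with hc
  have hDz : tdist (cut G par y) s z + j = tdist (cut G par y) s c' := hD j hj.le
  have hstarH : (cut H par y).Adj c z :=
    cut_adj.2 ⟨hsk.center_adj z hjm, hsk.center_ne z hjm y⟩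
  have hstarG : (cut G par y).Adj c z := cut_mono hsk.le y hstarH
  have hstarH' : H'.Adj c z := hHH' (hsk.center_adj z hjm)
  have hznear : tdist G s z + 2 * K < tdist (cut G par y) s z := by
    by_contra hn
    exact hne j hj (le_antisymm (hsk.near y z ⟨by omega, by omega⟩) (hcutH z))
  -- A center outside of the subtree of `y` keeps its distance, and then its neighbor `z` would have
  -- a detour of at most `2`, hence at most `2 * K` because `1 ≤ K`.
  have hcbelow : Below par y c := by
    by_contra hb
    have h₁ := hout c hb
    have h₂ := tdist_le_add_one s hstarG
    have h₃ := tdist_le_add_one s (cut_adj.1 hstarG).1.symm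
    omega
  have hzbelow : Below par y z := hbelow j hj
  -- If `c` and `c'` were farther apart in `H` than the new route of length `j + 1`, this pair
  -- gains, and the weight of `c'` exceeds `K`. The new length is at most the distance in `G` plus
  -- two, hence below the truncation.
  by_cases hright : j + 1 < tdist H c c'
  · refine ⟨fun p => if p = c' then K else 0, by simp, fun p => ?_⟩
    beta_reduce
    have hanti := truncDist_anti (G := G) hHH' p c
    by_cases hpc : p = c'
    · subst hpc
      have h₁ : truncDist G H' p c + 1 ≤ truncDist G H p c := by
        have h₂ : tdist H' p z ≤ j := by
          have := tdist_le_of_chain (A := H') (P := x) (i := 0) (k := j)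
            (fun t _ ht => (hadj t (by omega)).symm)
          rwa [zero_add, hx0] at this
        have h₃ := tdist_le_add_one p hstarH'.symm
        have h₄ : tdist (cut G par y) z p ≤ tdist (cut G par y) z c + tdist (cut G par y) c p :=
          tdist_triangle _ _ _ _
        have h₅ := tdist_le_one_of_adj hstarG.symm
        have h₆ := hp.tdist_cut_le_of_below hp.containsTree le_rfl hcbelow
          (hx0 ▸ hbelow 0 (by omega) : Below par y p)
        have h₇ := tdist_triangle (cut G par y) s z p
        rw [tdist_comm H] at hright
        rw [tdist_comm G] at h₆
        simp only [truncDist]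
        omega
      have h₂ : weight K S p = 1 + K := by simp [weight, hc']
      rw [if_pos rfl]
      exact add_mul_le_mul_of_succ_le (by omega) h₁
    · rw [if_neg hpc, zero_add]
      exact Nat.mul_le_mul_left _ hanti
  -- Otherwise `c'` is within `j + 1` of `c` in `H`, also after the failure, as both lie below `y`.
  -- The stretch of `c'` is above two, so `c` itself must be reached too late.
  · have hleft : tdist (cut G par y) s z + 1 < tdist (cut H par y) s c := by
      by_contra hl
      have h₁ := hp.tdist_cut_le_of_below hsk.tree hsk.le hcbelow
        (hx0 ▸ hbelow 0 (by omega) : Below par y c')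
      have h₂ := tdist_triangle (cut H par y) s c c'
      omega
    obtain ⟨P, hP0, hPz, hP⟩ := exists_path_through hj hfin hsk.le hHH' hpred hend hadj hD
    rw [← hz] at hPz hP
    set d := tdist (cut G par y) s z with hd
    have hchain : ∀ i k, i + k ≤ d → tdist (cut G par y) (P i) (P (i + k)) ≤ k ∧
        tdist H' (P i) (P (i + k)) ≤ k := fun i k hik =>
      ⟨tdist_le_of_chain fun t _ ht => (hP t (by omega)).1,
        tdist_le_of_chain fun t _ ht => (hP t (by omega)).2⟩
    have hDP : ∀ i ≤ d, tdist (cut G par y) s (P i) = i := by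
      intro i hi
      have h₁ := (hchain 0 i (by omega)).1
      have h₂ := (hchain i (d - i) (by omega)).1
      rw [zero_add, hP0] at h₁
      rw [Nat.add_sub_cancel' hi, hPz] at h₂
      have h₃ := tdist_triangle (cut G par y) s (P i) z
      omega
    -- The path enters the subtree of `y` for the last time right after position `i₀`; up to there
    -- its length agrees with the depth.
    obtain ⟨i₀, hi₀d, hi₀, hafter⟩ : ∃ i₀ ≤ d, ¬ Below par y (P i₀) ∧
        ∀ i, i₀ < i → i ≤ d → Below par y (P i) := by
      refine ⟨Nat.findGreatest (fun i => ¬ Below par y (P i)) d, Nat.findGreatest_le _,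
        Nat.findGreatest_spec (P := fun i => ¬ Below par y (P i)) (Nat.zero_le d) ?_, ?_⟩
      · rw [hP0]
        intro hb
        rcases hp.depth_le_of_below hb with h | h
        · exact hys h
        · simp at h
      · intro i hi hid
        by_contra hb
        exact Nat.findGreatest_is_greatest hi hid hb
    -- Moving `k` steps on from position `i₀` lowers the depth by at most `k` and raises the
    -- replacement distance by `k`, so the detour is at most `2 * k`.
    have hdepth : ∀ k, i₀ + k ≤ d → i₀ ≤ tdist G s (P (i₀ + k)) + k := by
      intro k hk
      have h₁ := (hchain i₀ k hk).1
      have h₂ := tdist_anti (cut_le (G := G) (par := par) (s := y)) (P i₀) (P (i₀ + k))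
      have h₃ := tdist_triangle G s (P (i₀ + k)) (P i₀)
      rw [tdist_comm G (P (i₀ + k))] at h₃
      have h₄ := hout _ hi₀
      have h₅ := hcutG (P i₀)
      have h₆ := hDP i₀ hi₀d
      omega
    -- The detour of `z` exceeds `2 * K`, so more than `K` steps follow position `i₀`. The first `K`
    -- of them lead to vertices with small detours, which `H` reaches exactly.
    have hdK : i₀ + K < d := by
      have h₁ := hdepth (d - i₀) (by omega)
      rw [Nat.add_sub_cancel' hi₀d, hPz] at h₁
      omega
    have hinj : Set.InjOn (fun i => P (i₀ + 1 + i)) (Finset.range K : Set ℕ) := by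
      intro i hi k hk he
      simp only [Finset.coe_range, Set.mem_Iio] at hi hk
      have h₁ := hDP (i₀ + 1 + i) (by omega)
      have h₂ := hDP (i₀ + 1 + k) (by omega)
      simp only at he
      rw [he] at h₁
      omega
    refine ⟨fun p => if p ∈ (Finset.range K).image (fun i => P (i₀ + 1 + i)) then 1 else 0, ?_,
      fun p => ?_⟩
    · rw [Finset.sum_ite_mem, Finset.univ_inter, Finset.sum_const,
        Finset.card_image_of_injOn hinj]
      simp
    · beta_reduce
      have hanti := truncDist_anti (G := G) hHH' p c
      split_ifs with hmem
      · obtain ⟨i, hi, rfl⟩ := Finset.mem_image.1 hmem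
        rw [Finset.mem_range] at hi
        have hi' : i₀ + 1 + i ≤ d := by omega
        have h₁ := hDP _ hi'
        have h₂ := hdepth (1 + i) (by omega)
        rw [← add_assoc i₀ 1 i] at h₂
        have h₃ := hsk.near y (P (i₀ + 1 + i)) ⟨by omega, by omega⟩
        have h₄ := tdist_triangle (cut H par y) s (P (i₀ + 1 + i)) c
        have hb := hafter (i₀ + 1 + i) (by omega) hi'
        have h₅ := hp.tdist_cut_le_of_below hsk.tree hsk.le hb hcbelow
        have h₆ := (hchain (i₀ + 1 + i) (d - (i₀ + 1 + i)) (by omega)).2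
        rw [Nat.add_sub_cancel' hi', hPz] at h₆
        have h₇ := tdist_le_add_one (P (i₀ + 1 + i)) hstarH'.symm
        have h₈ := tdist_triangle (cut G par y) s (P (i₀ + 1 + i)) z
        have h₉ := hp.tdist_cut_le_of_below hp.containsTree le_rfl hb hcbelow
        have h₁₀ := tdist_le_add_one (P (i₀ + 1 + i)) hstarG
        -- The vertex is reached exactly in `H` but `c` too late, so the bought route to `c` beats
        -- their distance in `H`. Its length is at most the distance in `G` plus two, as both
        -- vertices lie below `y`, so the truncated distance drops as well.
        have h₁₁ : truncDist G H' (P (i₀ + 1 + i)) c + 1 ≤ truncDist G H (P (i₀ + 1 + i)) c := by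
          simp only [truncDist]
          omega
        have h₁₂ : 1 ≤ weight K S (P (i₀ + 1 + i)) := by simp [weight]
        exact add_mul_le_mul_of_succ_le h₁₂ h₁₁
      · rw [zero_add]
        exact Nat.mul_le_mul_left _ hanti

/-- The amortized cost of buying a path. -/
theorem buy_path (hp : IsBFSParent G s par) (hK : 1 ≤ K)
    (hsk : IsSkeleton G H s par K S marked cl) {y c' : V} (hc' : c' ∈ S)
    (hbad : tdist (cut G par y) s c' + 2 < tdist (cut H par y) s c')
    {x : ℕ → V} {m : ℕ} (hx0 : x 0 = c')
    (hne : ∀ j < m, tdist (cut H par y) s (x j) ≠ tdist (cut G par y) s (x j))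
    (hpred : ∀ j < m, IsPred G s par y (x (j + 1)) (x j))
    (hend : tdist (cut H par y) s (x m) = tdist (cut G par y) s (x m))
    (hHH' : H ≤ H') (hadj : ∀ j < m, H'.Adj (x (j + 1)) (x j))
    (hedge : ∀ e ∈ H'.edgeSet, e ∈ H.edgeSet ∨ ∃ j < m, e = s(x (j + 1), x j)) :
    K * H'.edgeSet.ncard + 3 * potential G K S H' ≤
      K * H.edgeSet.ncard + 3 * potential G K S H := by
  classical
  have hD : ∀ i ≤ m, tdist (cut G par y) s (x i) + i = tdist (cut G par y) s c' := by
    intro i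
    induction i with
    | zero => intro _; rw [hx0, add_zero]
    | succ i ih =>
      intro hi
      have h₁ := ih (by omega)
      have h₂ := (hpred i (by omega)).2
      omega
  set J := (Finset.range m).filter fun j => ¬ H.Adj (x (j + 1)) (x j) with hJ
  have hJm : ∀ j ∈ J, j < m ∧ marked (x j) := by
    intro j hj
    rw [hJ, Finset.mem_filter, Finset.mem_range] at hj
    exact ⟨hj.1, hsk.marked_of_missing _ _ (cut_adj.1 (hpred j hj.1).1).1 hj.2⟩
  have hcard : H'.edgeSet.ncard ≤ H.edgeSet.ncard + J.card := by
    have h₁ : H'.edgeSet ⊆ H.edgeSet ∪ ((J.image fun j => s(x (j + 1), x j) : Finset (Sym2 V)) :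
        Set (Sym2 V)) := by
      intro e he
      rcases hedge e he with h | ⟨j, hj, rfl⟩
      · exact .inl h
      · by_cases hHj : H.Adj (x (j + 1)) (x j)
        · exact .inl hHj
        · refine .inr ?_
          rw [Finset.mem_coe]
          exact Finset.mem_image_of_mem (fun j => s(x (j + 1), x j))
            (Finset.mem_filter.2 ⟨Finset.mem_range.2 hj, hHj⟩)
    refine (Set.ncard_le_ncard h₁ (Set.toFinite _)).trans ((Set.ncard_union_le _ _).trans ?_)
    rw [Set.ncard_coe_finset]
    exact Nat.add_le_add_left Finset.card_image_le _
  have hthree := card_le_three_mul_card_image hsk (fun j hj => hD j (hJm j hj).1.le)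
    (fun j hj => (hJm j hj).2)
  set I := J.image fun j => cl (x j) with hI
  have hpot : I.card * K + potential G K S H' ≤ potential G K S H := by
    have hIS : I ⊆ S := by
      intro c hc
      obtain ⟨j, hj, rfl⟩ := Finset.mem_image.1 hc
      exact hsk.center_mem _ (hJm j hj).2
    have h₁ : I.card * K = ∑ c ∈ S, if c ∈ I then K else 0 := by
      rw [Finset.sum_ite_mem, Finset.inter_eq_right.2 hIS, Finset.sum_const, smul_eq_mul]
    rw [h₁, potential, potential, ← Finset.sum_add_distrib]
    refine Finset.sum_le_sum fun c _ => ?_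
    split_ifs with hcI
    · obtain ⟨j, hj, rfl⟩ := Finset.mem_image.1 hcI
      exact row_potential_add_le hp hK hsk hc' hbad hx0 hne hpred hend hHH' hadj hD
        (hJm j hj).1 (hJm j hj).2
    · rw [zero_add]
      exact Finset.sum_le_sum fun p _ => Nat.mul_le_mul_left _ (truncDist_anti hHH' p c)
  calc K * H'.edgeSet.ncard + 3 * potential G K S H'
      ≤ K * (H.edgeSet.ncard + 3 * I.card) + 3 * potential G K S H' := by gcongr; omega
    _ = K * H.edgeSet.ncard + 3 * (I.card * K + potential G K S H') := by ring
    _ ≤ _ := by gcongr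

/-- If all centers have stretch two after every tree edge failure, then all vertices have stretch
four. -/
theorem IsSkeleton.tdist_cut_le (hsk : IsSkeleton G H s par K S marked cl) {y : V}
    (hS : ∀ c ∈ S, tdist (cut H par y) s c ≤ tdist (cut G par y) s c + 2) (v : V) :
    tdist (cut H par y) s v ≤ tdist (cut G par y) s v + 4 := by
  induction hd : tdist (cut G par y) s v using Nat.strong_induction_on generalizing v with
  | _ d ih =>
    subst hd
    by_cases hvs : v = s
    · simp [hvs]
    by_cases hr : tdist (cut G par y) s v < Fintype.card V + 4
    · obtain ⟨u, hu, hD⟩ := exists_adj_tdist_add_one hvs hr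
      by_cases hH : H.Adj u v
      · have h₁ := ih _ (by omega) u rfl
        have h₂ := tdist_le_add_one s (cut_adj.2 ⟨hH, (cut_adj.1 hu).2⟩ : (cut H par y).Adj u v)
        omega
      -- Going through the center costs one step each way. With the error two at the center this
      -- makes four, independently of the error at `u`.
      · have hm := hsk.marked_of_missing u v (cut_adj.1 hu).1 hH
        have hstarH : (cut H par y).Adj (cl v) v :=
          cut_adj.2 ⟨hsk.center_adj v hm, hsk.center_ne v hm y⟩
        have h₁ := hS _ (hsk.center_mem v hm)
        have h₂ := tdist_le_add_one s hstarH
        have h₃ := tdist_le_add_one s (cut_mono hsk.le y hstarH).symm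
        omega
    · have := tdist_le_card (cut H par y) s v
      omega

/-- A set of at most one failed edge is either the edge above some `y` or misses the tree; in the
latter case the tree alone preserves the distances of `G`. -/
theorem IsSkeleton.isEdgeFTApproxBFS (hp : IsBFSParent G s par)
    (hsk : IsSkeleton G H s par K S marked cl)
    (hS : ∀ y, ∀ c ∈ S, tdist (cut H par y) s c ≤ tdist (cut G par y) s c + 2) :
    IsEdgeFTApproxBFS 1 1 4 G H s where
  le := hsk.le
  edist_le := by
    intro F hF hcard v
    rw [Nat.cast_one, one_mul]
    refine edist_le_edist_add (G := G.deleteEdges F) (H := H.deleteEdges F) ?_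
    by_cases hT : ∃ y, par y ≠ y ∧ s(par y, y) ∈ F
    · obtain ⟨y, -, hyF⟩ := hT
      have hFy : F = {s(par y, y)} :=
        (Finset.eq_singleton_iff_unique_mem.2 ⟨hyF, fun e he =>
          Finset.card_le_one.1 hcard e he _ hyF⟩)
      subst hFy
      have := hsk.tdist_cut_le (hS y) v
      simpa [cut] using this
    · have hT' : ContainsTree par (H.deleteEdges F) := by
        intro w hw
        rw [deleteEdges_adj]
        exact ⟨hsk.tree w hw, fun hmem => hT ⟨w, hw, hmem⟩⟩
      have h₁ := hp.tdist_le_of_containsTree hT' v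
      have h₂ := tdist_anti (deleteEdges_le (G := G) (F : Set (Sym2 V))) s v
      omega

end PathBuying
/-! ### Programs with bounded loops -/

@[simp] theorem Store.setReg_reg (σ : Store) (x w y : ℕ) :
    (σ.setReg x w).reg y = if y = x then w else σ.reg y := rfl

@[simp] theorem Store.setReg_arr (σ : Store) (x w : ℕ) : (σ.setReg x w).arr = σ.arr := rfl

@[simp] theorem Store.setArr_reg (σ : Store) (a i j w : ℕ) : (σ.setArr a i j w).reg = σ.reg := rfl

@[simp] theorem Store.setArr_arr (σ : Store) (a i j w a' i' j' : ℕ) :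
    (σ.setArr a i j w).arr a' i' j' =
      if a' = a ∧ i' = i ∧ j' = j then w else σ.arr a' i' j' := rfl

/-- Commands whose loops let a counter run through `0, …, n - 1`, where `n` is the content of
register `0`. -/
inductive Cmd where
  | skip
  | assign (x : ℕ) (e : Expr)
  | write (a : ℕ) (i j e : Expr)
  | seq (p q : Cmd)
  | ite (b : Expr) (p q : Cmd)
  | loop (x : ℕ) (p : Cmd)

infixr:60 " ;; " => Cmd.seq

/-- The iteration of a counted loop body. -/
def iterateBody (f : Store → Store) (x : ℕ) : ℕ → Store → Store
  | 0, σ => σ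
  | k + 1, σ => f ((iterateBody f x k σ).setReg x k)

namespace Cmd

/-- The while-program of a command. -/
def toProgram : Cmd → Program
  | skip => .skip
  | assign x e => .assign x e
  | write a i j e => .write a i j e
  | seq p q => .seq p.toProgram q.toProgram
  | ite b p q => .ite b p.toProgram q.toProgram
  | loop x p => .seq (.assign x (.const 0)) (.while (.lt (.reg x) (.reg 0))
      (.seq p.toProgram (.assign x (.add (.reg x) (.const 1)))))

/-- The effect of a command. -/
def exec : Cmd → Store → Store
  | skip, σ => σ
  | assign x e, σ => σ.setReg x (e.eval σ)
  | write a i j e, σ => σ.setArr a (i.eval σ) (j.eval σ) (e.eval σ)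
  | seq p q, σ => q.exec (p.exec σ)
  | ite b p q, σ => if b.eval σ ≠ 0 then p.exec σ else q.exec σ
  | loop x p, σ => (iterateBody p.exec x (σ.reg 0) σ).setReg x (σ.reg 0)

/-- The registers that a command modifies. -/
def regs : Cmd → List ℕ
  | skip => []
  | assign x _ => [x]
  | write _ _ _ _ => []
  | seq p q => p.regs ++ q.regs
  | ite _ p q => p.regs ++ q.regs
  | loop x p => x :: p.regs

/-- The arrays that a command modifies. -/
def arrs : Cmd → List ℕ
  | skip => []
  | assign _ _ => []
  | write a _ _ _ => [a]
  | seq p q => p.arrs ++ q.arrs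
  | ite _ p q => p.arrs ++ q.arrs
  | loop _ p => p.arrs

/-- Loop bodies change neither the loop counter nor the loop bound. -/
def WellFormed : Cmd → Prop
  | skip => True
  | assign _ _ => True
  | write _ _ _ _ => True
  | seq p q => p.WellFormed ∧ q.WellFormed
  | ite _ p q => p.WellFormed ∧ q.WellFormed
  | loop x p => x ≠ 0 ∧ 0 ∉ p.regs ∧ x ∉ p.regs ∧ p.WellFormed

/-- A polynomial bound for the running time. -/
noncomputable def time : Cmd → Polynomial ℕ
  | skip => 1
  | assign _ e => (e.cost + 1 : ℕ)
  | write _ i j e => (i.cost + j.cost + e.cost + 1 : ℕ)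
  | seq p q => p.time + q.time
  | ite b p q => (b.cost + 1 : ℕ) + (p.time + q.time)
  | loop _ p => 2 + (Polynomial.X * (p.time + 8) + 4)

theorem exec_reg {p : Cmd} {y : ℕ} (h : y ∉ p.regs) (σ : Store) :
    (p.exec σ).reg y = σ.reg y := by
  induction p generalizing σ with
  | skip => rfl
  | assign x e => simp only [regs, List.mem_singleton] at h; simp [exec, h]
  | write a i j e => rfl
  | seq p q hp hq =>
    simp only [regs, List.mem_append, not_or] at h
    simp only [exec]; rw [hq h.2, hp h.1]
  | ite b p q hp hq =>
    simp only [regs, List.mem_append, not_or] at h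
    simp only [exec]; split_ifs
    · exact hp h.1 σ
    · exact hq h.2 σ
  | loop x p hp =>
    simp only [regs, List.mem_cons, not_or] at h
    simp only [exec, Store.setReg_reg, if_neg h.1]
    generalize σ.reg 0 = k
    induction k with
    | zero => rfl
    | succ k ih => simp only [iterateBody, hp h.2, Store.setReg_reg, if_neg h.1, ih]

theorem exec_arr {p : Cmd} {a : ℕ} (h : a ∉ p.arrs) (σ : Store) :
    (p.exec σ).arr a = σ.arr a := by
  induction p generalizing σ with
  | skip => rfl
  | assign x e => rfl
  | write b i j e =>
    simp only [arrs, List.mem_singleton] at h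
    ext i' j'
    simp [exec, h]
  | seq p q hp hq =>
    simp only [arrs, List.mem_append, not_or] at h
    simp only [exec]; rw [hq h.2, hp h.1]
  | ite b p q hp hq =>
    simp only [arrs, List.mem_append, not_or] at h
    simp only [exec]; split_ifs
    · exact hp h.1 σ
    · exact hq h.2 σ
  | loop x p hp =>
    simp only [arrs] at h
    simp only [exec, Store.setReg_arr]
    generalize σ.reg 0 = k
    induction k with
    | zero => rfl
    | succ k ih => simp only [iterateBody, hp h, Store.setReg_arr, ih]

theorem iterateBody_reg {p : Cmd} {x y : ℕ} (h : y ∉ p.regs) (hxy : y ≠ x) (k : ℕ) (σ : Store) :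
    (iterateBody p.exec x k σ).reg y = σ.reg y := by
  induction k with
  | zero => rfl
  | succ k ih => simp only [iterateBody, exec_reg h, Store.setReg_reg, if_neg hxy, ih]

theorem iterateBody_arr {p : Cmd} {a : ℕ} (h : a ∉ p.arrs) (x k : ℕ) (σ : Store) :
    (iterateBody p.exec x k σ).arr a = σ.arr a := by
  induction k with
  | zero => rfl
  | succ k ih => simp only [iterateBody, exec_arr h, Store.setReg_arr, ih]

/-- Induction on the number `k` of rounds still to run. The body changes neither counter nor bound,
so the loop resumes with counter `n - k`, where `n` is the content of register `0`. -/
theorem runs_while {x : ℕ} {p : Cmd} (hx : x ≠ 0) (h0 : 0 ∉ p.regs) (hxp : x ∉ p.regs) {B : ℕ}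
    {σ : Store}
    (ih : ∀ τ : Store, τ.reg 0 = σ.reg 0 → ∃ t ≤ B, Runs p.toProgram τ t (p.exec τ))
    (k : ℕ) (hk : k ≤ σ.reg 0) :
    ∃ t ≤ k * (B + 8) + 4, Runs (.while (.lt (.reg x) (.reg 0))
      (.seq p.toProgram (.assign x (.add (.reg x) (.const 1)))))
      ((iterateBody p.exec x (σ.reg 0 - k) σ).setReg x (σ.reg 0 - k)) t
      ((iterateBody p.exec x (σ.reg 0) σ).setReg x (σ.reg 0)) := by
  have hreg0 : ∀ i, (iterateBody p.exec x i σ).reg 0 = σ.reg 0 :=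
    fun i => iterateBody_reg h0 hx.symm i σ
  induction k with
  | zero =>
    -- A test takes four steps and an increment four more: eight per round besides the body, and
    -- four for the final failing test.
    refine ⟨4, by omega, ?_⟩
    rw [Nat.sub_zero]
    exact Runs.while_false (b := .lt (.reg x) (.reg 0)) (by simp [Expr.eval, hx.symm, hreg0])
  | succ k hk' =>
    obtain ⟨t, ht, hrun⟩ := hk' (by omega)
    set i := σ.reg 0 - (k + 1) with hi
    have hi' : σ.reg 0 - k = i + 1 := by omega
    rw [hi'] at hrun
    obtain ⟨u, hu, hbody⟩ := ih ((iterateBody p.exec x i σ).setReg x i)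
      (by simp [hx.symm, hreg0])
    have hinc := Runs.assign x (.add (.reg x) (.const 1))
      (p.exec ((iterateBody p.exec x i σ).setReg x i))
    have hval : (Expr.add (.reg x) (.const 1)).eval
        (p.exec ((iterateBody p.exec x i σ).setReg x i)) = i + 1 := by
      simp [Expr.eval, exec_reg hxp]
    rw [hval] at hinc
    refine ⟨_, ?_, Runs.while_true (b := .lt (.reg x) (.reg 0)) ?_ (Runs.seq hbody hinc) hrun⟩
    · simp only [Expr.cost]
      have : (k + 1) * (B + 8) = k * (B + 8) + (B + 8) := by ring
      omega
    · simp only [Expr.eval, Store.setReg_reg, if_true, if_neg hx.symm, hreg0]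
      rw [if_pos (by omega)]
      exact one_ne_zero

/-- Commands run in polynomial time. -/
theorem exists_runs {p : Cmd} (hp : p.WellFormed) (h0 : 0 ∉ p.regs) (σ : Store) :
    ∃ t ≤ p.time.eval (σ.reg 0), Runs p.toProgram σ t (p.exec σ) := by
  induction p generalizing σ with
  | skip => exact ⟨1, by simp [time], Runs.skip σ⟩
  | assign x e => exact ⟨_, by simp [time], Runs.assign x e σ⟩
  | write a i j e => exact ⟨_, by simp [time], Runs.write a i j e σ⟩
  | seq p q ihp ihq =>
    simp only [regs, List.mem_append, not_or] at h0
    obtain ⟨t, ht, hrt⟩ := ihp hp.1 h0.1 σ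
    obtain ⟨u, hu, hru⟩ := ihq hp.2 h0.2 (p.exec σ)
    rw [exec_reg h0.1] at hu
    refine ⟨t + u, ?_, Runs.seq hrt hru⟩
    simp only [time, Polynomial.eval_add]
    omega
  | ite b p q ihp ihq =>
    simp only [regs, List.mem_append, not_or] at h0
    obtain ⟨t, ht, hrt⟩ := ihp hp.1 h0.1 σ
    obtain ⟨u, hu, hru⟩ := ihq hp.2 h0.2 σ
    by_cases hb : b.eval σ = 0
    · refine ⟨b.cost + 1 + u, ?_, ?_⟩
      · simp only [time, Polynomial.eval_add, Polynomial.eval_natCast, Nat.cast_id]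
        omega
      · simp only [exec, hb, ne_eq, not_true_eq_false, if_false]
        exact Runs.ite_false hb hru
    · refine ⟨b.cost + 1 + t, ?_, ?_⟩
      · simp only [time, Polynomial.eval_add, Polynomial.eval_natCast, Nat.cast_id]
        omega
      · simp only [exec, hb, ne_eq, not_false_eq_true, if_true]
        exact Runs.ite_true hb hrt
  | loop x p ihp =>
    obtain ⟨hx, h0p, hxp, hp⟩ := hp
    obtain ⟨t, ht, hrun⟩ := runs_while hx h0p hxp (σ := σ) (B := p.time.eval (σ.reg 0))
      (fun τ hτ => hτ ▸ ihp hp h0p τ) (σ.reg 0) le_rfl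
    rw [Nat.sub_self] at hrun
    refine ⟨2 + t, ?_, Runs.seq (Runs.assign x (.const 0) σ) hrun⟩
    simp only [time, Polynomial.eval_add, Polynomial.eval_mul, Polynomial.eval_X,
      Polynomial.eval_ofNat]
    omega

/-- Well-formedness is decidable. -/
instance decidableWellFormed : (p : Cmd) → Decidable p.WellFormed
  | skip => isTrue trivial
  | assign _ _ => isTrue trivial
  | write _ _ _ _ => isTrue trivial
  | seq p q => @instDecidableAnd _ _ (decidableWellFormed p) (decidableWellFormed q)
  | ite _ p q => @instDecidableAnd _ _ (decidableWellFormed p) (decidableWellFormed q)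
  | loop x p => by
      have := decidableWellFormed p
      exact inferInstanceAs (Decidable (x ≠ 0 ∧ 0 ∉ p.regs ∧ x ∉ p.regs ∧ p.WellFormed))

/-- The two stores agree on everything that `p` and its loop counter `x` do not modify. -/
def Frame (p : Cmd) (x : ℕ) (σ τ : Store) : Prop :=
  (∀ a, a ∉ p.arrs → τ.arr a = σ.arr a) ∧ ∀ y, y ∉ p.regs → y ≠ x → τ.reg y = σ.reg y

/-- The invariant rule for counted loops. -/
theorem exec_loop (P : ℕ → Store → Prop) (x : ℕ) (p : Cmd) (σ : Store) (h0 : P 0 σ)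
    (step : ∀ i < σ.reg 0, ∀ τ, Frame p x σ τ → P i τ → P (i + 1) (p.exec (τ.setReg x i))) :
    ∃ τ, P (σ.reg 0) τ ∧ Frame p x σ τ ∧ (loop x p).exec σ = τ.setReg x (σ.reg 0) := by
  have hframe : ∀ k, Frame p x σ (iterateBody p.exec x k σ) := fun k =>
    ⟨fun a ha => iterateBody_arr ha x k σ, fun y hy hyx => iterateBody_reg hy hyx k σ⟩
  refine ⟨_, ?_, hframe (σ.reg 0), rfl⟩
  have h : ∀ k ≤ σ.reg 0, P k (iterateBody p.exec x k σ) := by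
    intro k
    induction k with
    | zero => exact fun _ => h0
    | succ k ih => exact fun hk => step k (by omega) _ (hframe k) (ih (by omega))
  exact h _ le_rfl

end Cmd

/-! ### Tests -/

namespace Expr

/-- An expression holds when its value is nonzero. -/
def Holds (σ : Store) (e : Expr) : Prop := e.eval σ ≠ 0

/-- Negation. -/
def not (e : Expr) : Expr := .eq e (.const 0)

/-- Conjunction. -/
def and (e₁ e₂ : Expr) : Expr := (Expr.add e₁.not e₂.not).not

theorem holds_lt {σ : Store} {e₁ e₂ : Expr} :
    (Expr.lt e₁ e₂).Holds σ ↔ e₁.eval σ < e₂.eval σ := by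
  simp [Holds, eval]

theorem holds_eq {σ : Store} {e₁ e₂ : Expr} :
    (Expr.eq e₁ e₂).Holds σ ↔ e₁.eval σ = e₂.eval σ := by
  simp [Holds, eval]

theorem holds_not {σ : Store} {e : Expr} : e.not.Holds σ ↔ ¬ e.Holds σ := by
  by_cases h : e.eval σ = 0 <;> simp [Holds, not, eval, h]

theorem holds_and {σ : Store} {e₁ e₂ : Expr} :
    (e₁.and e₂).Holds σ ↔ e₁.Holds σ ∧ e₂.Holds σ := by
  by_cases h₁ : e₁.eval σ = 0 <;> by_cases h₂ : e₂.eval σ = 0 <;>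
    simp [Holds, and, not, eval, h₁, h₂]

theorem holds_read {σ : Store} {a : ℕ} {i j : Expr} :
    (Expr.read a i j).Holds σ ↔ σ.arr a (i.eval σ) (j.eval σ) ≠ 0 := Iff.rfl

/-- The registers that an expression reads. -/
def vars : Expr → List ℕ
  | .const _ => []
  | .reg x => [x]
  | .read _ i j => i.vars ++ j.vars
  | .add e₁ e₂ => e₁.vars ++ e₂.vars
  | .sub e₁ e₂ => e₁.vars ++ e₂.vars
  | .lt e₁ e₂ => e₁.vars ++ e₂.vars
  | .eq e₁ e₂ => e₁.vars ++ e₂.vars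

theorem eval_congr {e : Expr} {σ τ : Store} (harr : σ.arr = τ.arr)
    (hreg : ∀ y ∈ e.vars, σ.reg y = τ.reg y) : e.eval σ = e.eval τ := by
  induction e with
  | const c => rfl
  | reg x => exact hreg x (by simp [vars])
  | read a i j hi hj =>
    simp only [vars, List.mem_append] at hreg
    simp only [eval, harr, hi (fun y hy => hreg y (.inl hy)), hj (fun y hy => hreg y (.inr hy))]
  | add e₁ e₂ h₁ h₂ | sub e₁ e₂ h₁ h₂ | lt e₁ e₂ h₁ h₂ | eq e₁ e₂ h₁ h₂ =>
    simp only [vars, List.mem_append] at hreg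
    simp only [eval, h₁ (fun y hy => hreg y (.inl hy)), h₂ (fun y hy => hreg y (.inr hy))]

end Expr

namespace Cmd

open Classical in
theorem exec_ite {b : Expr} {p q : Cmd} {σ : Store} :
    (ite b p q).exec σ = if b.Holds σ then p.exec σ else q.exec σ := by
  simp only [exec, Expr.Holds]
  congr

/-- Search for a value of the register `x` that makes `b` true; the result is put in the register
`r` and is the content of register `0` if there is none. -/
def find (r x : ℕ) (b : Expr) : Cmd :=
  assign r (.reg 0) ;; loop x (ite b (assign r (.reg x)) skip)

/-- The content of register `0` is out of range and signals failure. The test does not read the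
result register, so its truth at each `i` can be stated in the initial store. Any successful value
may be returned; minimality is never needed. -/
theorem exec_find {r x : ℕ} {b : Expr} (hr : r ∉ b.vars) (hrx : r ≠ x) (hr0 : r ≠ 0)
    (σ : Store) :
    ((find r x b).exec σ).arr = σ.arr ∧
    (∀ y, y ≠ r → y ≠ x → ((find r x b).exec σ).reg y = σ.reg y) ∧
    ((((find r x b).exec σ).reg r < σ.reg 0 ∧
        b.Holds (σ.setReg x (((find r x b).exec σ).reg r))) ∨
      (((find r x b).exec σ).reg r = σ.reg 0 ∧ ∀ i < σ.reg 0, ¬ b.Holds (σ.setReg x i))) := by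
  refine ⟨?_, ?_, ?_⟩
  · ext a
    rw [exec_arr (by simp [find, arrs])]
  · intro y hy hyx
    rw [exec_reg (by simp [find, regs, hy, hyx])]
  · have hloop := exec_loop (fun k τ => τ.arr = σ.arr ∧
        (∀ y, y ≠ r → y ≠ x → τ.reg y = σ.reg y) ∧
        ((τ.reg r < k ∧ b.Holds (σ.setReg x (τ.reg r))) ∨
          (τ.reg r = σ.reg 0 ∧ ∀ i < k, ¬ b.Holds (σ.setReg x i)))) x
      (ite b (assign r (.reg x)) skip) (σ.setReg r (σ.reg 0))
      ⟨rfl, fun y hy _ => by simp [hy], .inr ⟨by simp, by simp⟩⟩ ?_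
    · obtain ⟨τ, hP, -, he⟩ := hloop
      have hfind : (find r x b).exec σ = τ.setReg x (σ.reg 0) := by
        simpa [find, exec, Expr.eval, hr0.symm] using he
      simp only [Store.setReg_reg, hr0.symm, if_false] at hP
      rw [hfind]
      simp only [Store.setReg_reg, if_neg hrx]
      exact hP.2.2
    · intro i hi τ _ ⟨harr, hreg, hcase⟩
      have hb : b.Holds (τ.setReg x i) ↔ b.Holds (σ.setReg x i) := by
        unfold Expr.Holds
        rw [Expr.eval_congr (σ := τ.setReg x i) (τ := σ.setReg x i) harr]
        intro y hy
        have hyr : y ≠ r := fun h => hr (h ▸ hy)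
        simp only [Store.setReg_reg]
        split_ifs with hyx
        · rfl
        · exact hreg y hyr hyx
      rw [exec_ite]
      split_ifs with hbi
      · refine ⟨harr, fun y hy hyx => by simp [exec, hy, hyx, hreg], .inl ?_⟩
        simp only [exec, Expr.eval, Store.setReg_reg, if_true]
        exact ⟨by omega, hb.1 hbi⟩
      · refine ⟨harr, fun y hy hyx => by simp [exec, hyx, hreg y hy hyx], ?_⟩
        simp only [exec, Store.setReg_reg, if_neg hrx]
        rcases hcase with h | ⟨h, hall⟩
        · exact .inl ⟨by omega, h.2⟩
        · refine .inr ⟨h, fun k hk => ?_⟩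
          rcases Nat.lt_succ_iff_lt_or_eq.1 hk with hk | rfl
          · exact hall k hk
          · exact fun hh => hbi (hb.2 hh)

/-- Count the values of the register `x` that make `b` true. -/
def count (r x : ℕ) (b : Expr) : Cmd :=
  assign r (.const 0) ;; loop x (ite b (assign r (.add (.reg r) (.const 1))) skip)

open Classical in
theorem exec_count {r x : ℕ} {b : Expr} (hr : r ∉ b.vars) (hrx : r ≠ x) (hr0 : r ≠ 0)
    (σ : Store) :
    ((count r x b).exec σ).arr = σ.arr ∧
    (∀ y, y ≠ r → y ≠ x → ((count r x b).exec σ).reg y = σ.reg y) ∧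
    ((count r x b).exec σ).reg r =
      ((Finset.range (σ.reg 0)).filter fun i => b.Holds (σ.setReg x i)).card := by
  refine ⟨?_, ?_, ?_⟩
  · ext a
    rw [exec_arr (by simp [count, arrs])]
  · intro y hy hyx
    rw [exec_reg (by simp [count, regs, hy, hyx])]
  · have hloop := exec_loop (fun k τ => τ.arr = σ.arr ∧
        (∀ y, y ≠ r → y ≠ x → τ.reg y = σ.reg y) ∧
        τ.reg r = ((Finset.range k).filter fun i => b.Holds (σ.setReg x i)).card) x
      (ite b (assign r (.add (.reg r) (.const 1))) skip) (σ.setReg r 0)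
      ⟨rfl, fun y hy _ => by simp [hy], by simp⟩ ?_
    · obtain ⟨τ, hP, -, he⟩ := hloop
      have hfind : (count r x b).exec σ = τ.setReg x (σ.reg 0) := by
        simpa [count, exec, Expr.eval, hr0.symm] using he
      simp only [Store.setReg_reg, hr0.symm, if_false] at hP
      rw [hfind]
      simp only [Store.setReg_reg, if_neg hrx]
      exact hP.2.2
    · intro i hi τ _ ⟨harr, hreg, hcase⟩
      have hb : b.Holds (τ.setReg x i) ↔ b.Holds (σ.setReg x i) := by
        unfold Expr.Holds
        rw [Expr.eval_congr (σ := τ.setReg x i) (τ := σ.setReg x i) harr]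
        intro y hy
        have hyr : y ≠ r := fun h => hr (h ▸ hy)
        simp only [Store.setReg_reg]
        split_ifs with hyx
        · rfl
        · exact hreg y hyr hyx
      rw [exec_ite, Finset.range_add_one, Finset.filter_insert]
      split_ifs with hbi h h
      · refine ⟨harr, fun y hy hyx => by simp [exec, hy, hyx, hreg], ?_⟩
        rw [Finset.card_insert_of_notMem (by simp), ← hcase]
        simp [exec, Expr.eval, hrx]
      · exact absurd (hb.1 hbi) h
      · exact absurd (hb.2 h) hbi
      · refine ⟨harr, fun y hy hyx => by simp [exec, hyx, hreg y hy hyx], ?_⟩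
        rw [← hcase]
        simp [exec, hrx]

/-- Multiplication by repeated addition. -/
def mul (r x : ℕ) (e₁ e₂ : Expr) : Cmd :=
  assign r (.const 0) ;; loop x (ite (.lt (.reg x) e₂) (assign r (.add (.reg r) e₁)) skip)

/-- The loop runs as often as register `0` says, hence the bound on the second factor. Neither
factor may read the result register or the counter, both of which change. -/
theorem exec_mul {r x : ℕ} {e₁ e₂ : Expr} (h₁ : r ∉ e₁.vars) (h₂ : r ∉ e₂.vars)
    (h₁' : x ∉ e₁.vars) (h₂' : x ∉ e₂.vars) (hrx : r ≠ x) (hr0 : r ≠ 0)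
    (σ : Store) (hle : e₂.eval σ ≤ σ.reg 0) :
    ((mul r x e₁ e₂).exec σ).arr = σ.arr ∧
    (∀ y, y ≠ r → y ≠ x → ((mul r x e₁ e₂).exec σ).reg y = σ.reg y) ∧
    ((mul r x e₁ e₂).exec σ).reg r = e₁.eval σ * e₂.eval σ := by
  refine ⟨?_, ?_, ?_⟩
  · ext a
    rw [exec_arr (by simp [mul, arrs])]
  · intro y hy hyx
    rw [exec_reg (by simp [mul, regs, hy, hyx])]
  · have hloop := exec_loop (fun k τ => τ.arr = σ.arr ∧
        (∀ y, y ≠ r → y ≠ x → τ.reg y = σ.reg y) ∧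
        τ.reg r = e₁.eval σ * min k (e₂.eval σ)) x
      (ite (.lt (.reg x) e₂) (assign r (.add (.reg r) e₁)) skip) (σ.setReg r 0)
      ⟨rfl, fun y hy _ => by simp [hy], by simp⟩ ?_
    · obtain ⟨τ, hP, -, he⟩ := hloop
      have hmul : (mul r x e₁ e₂).exec σ = τ.setReg x (σ.reg 0) := by
        simpa [mul, exec, Expr.eval, hr0.symm] using he
      simp only [Store.setReg_reg, hr0.symm, if_false] at hP
      rw [hmul]
      simp only [Store.setReg_reg, if_neg hrx]
      rw [hP.2.2, min_eq_right hle]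
    · intro i hi τ _ ⟨harr, hreg, hcase⟩
      have hcongr : ∀ e : Expr, r ∉ e.vars → x ∉ e.vars → e.eval (τ.setReg x i) = e.eval σ := by
        intro e he he'
        refine Expr.eval_congr harr fun y hy => ?_
        have hyx : y ≠ x := fun h => he' (h ▸ hy)
        rw [Store.setReg_reg, if_neg hyx]
        exact hreg y (fun h => he (h ▸ hy)) hyx
      rw [exec_ite]
      simp only [Expr.holds_lt, hcongr e₂ h₂ h₂']
      split_ifs with hlt
      · refine ⟨harr, fun y hy hyx => by simp [exec, hy, hyx, hreg], ?_⟩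
        simp only [Expr.eval, Store.setReg_reg, if_true] at hlt
        rw [min_eq_left hlt.le] at hcase
        rw [min_eq_left (Nat.succ_le_of_lt hlt), Nat.mul_succ, ← hcase]
        simp [exec, Expr.eval, hrx, hcongr e₁ h₁ h₁']
      · refine ⟨harr, fun y hy hyx => by simp [exec, hyx, hreg y hy hyx], ?_⟩
        simp only [Expr.eval, Store.setReg_reg, if_true, not_lt] at hlt
        rw [min_eq_right hlt] at hcase
        rw [min_eq_right (by omega), ← hcase]
        simp [exec, hrx]

end Cmd

/-! ### Breadth-first search -/

open Classical in
/-- The function `f` is the adjacency matrix of `A`. -/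
def IsMatrix {n : ℕ} (f : ℕ → ℕ → ℕ) (A : SimpleGraph (Fin n)) : Prop :=
  ∀ u v : Fin n, f u v = if A.Adj u v then 1 else 0

theorem IsMatrix.ne_zero_iff {n : ℕ} {f : ℕ → ℕ → ℕ} {A : SimpleGraph (Fin n)}
    (h : IsMatrix f A) (u v : Fin n) : f u v ≠ 0 ↔ A.Adj u v := by
  rw [h u v]
  split_ifs with hA <;> simp [hA]

theorem adjEntry_eq {n : ℕ} (A : SimpleGraph (Fin n)) : IsMatrix (adjEntry A) A := by
  intro u v
  have h : (∃ u' v' : Fin n, u'.val = u.val ∧ v'.val = v.val ∧ A.Adj u' v') ↔ A.Adj u v := by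
    constructor
    · rintro ⟨u', v', hu, hv, h⟩
      rwa [Fin.ext hu, Fin.ext hv] at h
    · exact fun h => ⟨u, v, rfl, rfl, h⟩
  unfold adjEntry
  by_cases hA : A.Adj u v
  · rw [if_pos (h.2 hA), if_pos hA]
  · rw [if_neg (fun h' => hA (h.1 h')), if_neg hA]

/-! Registers: `0` the number `n` of vertices, `1` the source, `2` a vertex `y` whose tree edge
fails, `3` a center, `4` the number `n + 4` that stands for infinite distances, `5` the size of
clusters, `6`, `7`, `8` loop counters, `9` search results, `10` a walking vertex, `11`, `12`
numbers.

Arrays: `0` the graph, `1` the structure, `2` the distances in the graph after the failure of the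
edge above the row index, `3` in row `0` the tree, `4` the same as `2` for the structure, `5` in
row `0` the clusters (`0` for none, otherwise the center plus one) and in row `1` the centers. -/

/-- The parent in the tree. -/
def parExpr (v : Expr) : Expr := .read 3 (.const 0) v

/-- The edge `uv` in the graph of array `a` is not the failing tree edge. -/
def cutAdjExpr (a : ℕ) (u v : Expr) : Expr :=
  (Expr.read a u v).and
    ((((Expr.eq v (.reg 2)).and (.eq u (parExpr (.reg 2)))).not).and
      (((Expr.eq u (.reg 2)).and (.eq v (parExpr (.reg 2)))).not))

/-- The body of the breadth-first search. -/
def bfsBody (a d : ℕ) : Cmd :=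
  .ite ((Expr.eq (.read d (.reg 2) (.reg 7)) (.reg 4)).and
      ((cutAdjExpr a (.reg 8) (.reg 7)).and (.eq (.read d (.reg 2) (.reg 8)) (.reg 6))))
    (.write d (.reg 2) (.reg 7) (.add (.reg 6) (.const 1))) .skip

/-- Breadth-first search in the graph of array `a` after the failure of the edge above the vertex
in register `2`; the distances are written to the corresponding row of array `d`. -/
def bfs (a d : ℕ) : Cmd :=
  .loop 7 (.write d (.reg 2) (.reg 7) (.reg 4)) ;;
  .write d (.reg 2) (.reg 1) (.const 0) ;;
  .loop 6 (.loop 7 (.loop 8 (bfsBody a d)))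

theorem holds_cutAdjExpr {n : ℕ} {A : SimpleGraph (Fin n)} {par : Fin n → Fin n} {y u v : Fin n}
    {σ : Store} {a : ℕ} {ue ve : Expr} (hA : IsMatrix (σ.arr a) A)
    (hpar : ∀ v : Fin n, σ.arr 3 0 v = par v) (hy : σ.reg 2 = y) (hu : ue.eval σ = u)
    (hv : ve.eval σ = v) : (cutAdjExpr a ue ve).Holds σ ↔ (cut A par y).Adj u v := by
  simp only [cutAdjExpr, Expr.holds_and, Expr.holds_not, Expr.holds_eq, Expr.holds_read, parExpr,
    Expr.eval, hu, hv, hy, hpar, hA.ne_zero_iff, cut_adj, Fin.val_inj, ne_eq, Sym2.eq_iff]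
  tauto

section BFS

variable {n : ℕ}

/-- The distances after `r` rounds of the breadth-first search. -/
noncomputable def level (A : SimpleGraph (Fin n)) (s : Fin n) (r : ℕ) (v : Fin n) : ℕ :=
  if tdist A s v ≤ r then tdist A s v else n + 4

/-- The frontier of round `r` can be read off after round `r` or at any later time: finite entries
never change, and `r` differs from the default. -/
theorem level_eq_iff {A : SimpleGraph (Fin n)} {s u : Fin n} {r r' : ℕ} (hr : r < n + 4)
    (hr' : r ≤ r') : level A s r' u = r ↔ tdist A s u = r := by
  unfold level
  split_ifs <;> omega

theorem level_card (A : SimpleGraph (Fin n)) (s v : Fin n) : level A s n v = tdist A s v := by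
  unfold level
  have h₁ := tdist_le_card A s v
  have h₂ := tdist_lt_card (G := A) (u := s) (v := v)
  rw [Fintype.card_fin] at h₁ h₂
  split_ifs <;> omega

theorem level_succ_of_adj {A : SimpleGraph (Fin n)} {s u v : Fin n} {r : ℕ} (hr : r < n)
    (hu : tdist A s u = r) (hadj : A.Adj u v) :
    (level A s r v = n + 4 → level A s (r + 1) v = r + 1) ∧
      level A s (r + 1) v ≠ n + 4 ∧
      (level A s r v ≠ n + 4 → level A s (r + 1) v = level A s r v) := by
  have := tdist_le_add_one s hadj
  unfold level
  split_ifs <;> omega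

theorem level_succ_of_forall {A : SimpleGraph (Fin n)} {s v : Fin n} {r : ℕ} (hr : r < n)
    (h : ∀ u, A.Adj u v → tdist A s u ≠ r) : level A s (r + 1) v = level A s r v := by
  have h₁ : tdist A s v ≠ r + 1 := by
    intro h₁
    have hvs : v ≠ s := by rintro rfl; simp at h₁
    obtain ⟨u, hu, hd⟩ := exists_adj_tdist_add_one hvs (by rw [h₁, Fintype.card_fin]; omega)
    exact h u hu (by omega)
  unfold level
  split_ifs <;> omega

variable {A : SimpleGraph (Fin n)} {par : Fin n → Fin n} {s y : Fin n} {a d : ℕ}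

/-- The store holds the data that a breadth-first search needs. -/
structure BFSInput (A : SimpleGraph (Fin n)) (par : Fin n → Fin n) (s y : Fin n) (a : ℕ)
    (σ : Store) : Prop where
  reg0 : σ.reg 0 = n
  reg1 : σ.reg 1 = s
  reg2 : σ.reg 2 = y
  reg4 : σ.reg 4 = n + 4
  mat : IsMatrix (σ.arr a) A
  par : ∀ v : Fin n, σ.arr 3 0 v = par v

theorem BFSInput.of_frame {p : Cmd} {x : ℕ} {σ τ : Store} (h : BFSInput A par s y a σ)
    (hf : Cmd.Frame p x σ τ) (ha : a ∉ p.arrs) (h3 : 3 ∉ p.arrs)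
    (hr : ∀ i ∈ [0, 1, 2, 4], i ∉ p.regs ∧ i ≠ x) : BFSInput A par s y a τ := by
  have hreg : ∀ i ∈ [0, 1, 2, 4], τ.reg i = σ.reg i := fun i hi => hf.2 i (hr i hi).1 (hr i hi).2
  exact ⟨by rw [hreg 0 (by simp), h.reg0], by rw [hreg 1 (by simp), h.reg1],
    by rw [hreg 2 (by simp), h.reg2], by rw [hreg 4 (by simp), h.reg4],
    by rw [hf.1 a ha]; exact h.mat, by rw [hf.1 3 h3]; exact h.par⟩

/-- Distances are updated in place, so during round `r` the entries are a mixture of the levels `r`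
and `r + 1`. This is harmless, as both levels have the same entries equal to `r`, and only those are
used to extend the search. -/
theorem exec_bfsBody {σ : Store} (h : BFSInput A par s y a σ) {r : ℕ} {v u : Fin n}
    (hr : r < n) (h6 : σ.reg 6 = r) (h7 : σ.reg 7 = v) (h8 : σ.reg 8 = u) {D : Fin n → ℕ}
    (hD : ∀ w : Fin n, σ.arr d y w = D w)
    (hDl : ∀ w, D w = level (cut A par y) s r w ∨ D w = level (cut A par y) s (r + 1) w) :
    ∃ D' : Fin n → ℕ, (∀ w : Fin n, ((bfsBody a d).exec σ).arr d y w = D' w) ∧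
      (∀ w, w ≠ v → D' w = D w) ∧ (D v = level (cut A par y) s (r + 1) v → D' v = D v) ∧
      (∀ w, D' w = level (cut A par y) s r w ∨ D' w = level (cut A par y) s (r + 1) w) ∧
      ((cut A par y).Adj u v → tdist (cut A par y) s u = r →
        D' v = level (cut A par y) s (r + 1) v) := by
  have hDu : D u = r ↔ tdist (cut A par y) s u = r := by
    rcases hDl u with hu | hu <;> rw [hu]
    · exact level_eq_iff (by omega) le_rfl
    · exact level_eq_iff (by omega) (by omega)
  have hc := holds_cutAdjExpr (ue := .reg 8) (ve := .reg 7) h.mat h.par h.reg2 h8 h7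
  have hiff : ((Expr.eq (.read d (.reg 2) (.reg 7)) (.reg 4)).and
      ((cutAdjExpr a (.reg 8) (.reg 7)).and (.eq (.read d (.reg 2) (.reg 8)) (.reg 6)))).Holds σ ↔
      D v = n + 4 ∧ (cut A par y).Adj u v ∧ tdist (cut A par y) s u = r := by
    simp only [Expr.holds_and, Expr.holds_eq, hc, Expr.eval, h.reg2, h.reg4, h6, h7, h8, hD, hDu]
  rw [bfsBody, Cmd.exec_ite]
  by_cases hcond : D v = n + 4 ∧ (cut A par y).Adj u v ∧ tdist (cut A par y) s u = r
  · rw [if_pos (hiff.2 hcond)]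
    obtain ⟨h₁, hadj, htd⟩ := hcond
    obtain ⟨h₂, h₃, -⟩ := level_succ_of_adj hr htd hadj
    have h₄ : level (cut A par y) s (r + 1) v = r + 1 := by
      rcases hDl v with hv | hv
      · exact h₂ (hv ▸ h₁)
      · exact absurd (hv.symm.trans h₁) h₃
    refine ⟨fun w => if w = v then r + 1 else D w, fun w => ?_, fun w hw => if_neg hw,
      fun hv => absurd (hv.symm.trans h₁) h₃, fun w => ?_, fun _ _ => by simp [h₄]⟩
    · simp only [Cmd.exec, Store.setArr_arr, Expr.eval, h.reg2, h7, h6, true_and, Fin.val_inj]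
      split_ifs
      · rfl
      · exact hD w
    · by_cases hw : w = v
      · subst hw; simp [h₄]
      · simpa [hw] using hDl w
  · rw [if_neg (mt hiff.1 hcond)]
    refine ⟨D, fun w => hD w, fun _ _ => rfl, fun _ => rfl, hDl, fun hadj htd => ?_⟩
    obtain ⟨h₂, h₃, h₅⟩ := level_succ_of_adj hr htd hadj
    rcases hDl v with hv | hv
    · rw [hv, h₅]
      intro h₆
      exact hcond ⟨hv.trans h₆, hadj, htd⟩
    · exact hv

/-- Once all `u` have been tried, the entry of `v` belongs to level `r + 1`: either a neighbor in
the frontier was found, or there is none and the two levels agree at `v`. -/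
theorem exec_bfs_loop8 (ha : a ≠ d) (h3 : d ≠ 3) {σ : Store} (h : BFSInput A par s y a σ)
    {r : ℕ} {v : Fin n} (hr : r < n) (h6 : σ.reg 6 = r) (h7 : σ.reg 7 = v) {D : Fin n → ℕ}
    (hD : ∀ w : Fin n, σ.arr d y w = D w)
    (hDl : ∀ w, D w = level (cut A par y) s r w ∨ D w = level (cut A par y) s (r + 1) w) :
    ∃ D' : Fin n → ℕ, (∀ w : Fin n, ((Cmd.loop 8 (bfsBody a d)).exec σ).arr d y w = D' w) ∧
      (∀ w, w ≠ v → D' w = D w) ∧ D' v = level (cut A par y) s (r + 1) v := by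
  obtain ⟨τ, ⟨D', h₁, h₂, h₃, h₄⟩, hf, he⟩ := Cmd.exec_loop (fun k τ => ∃ D' : Fin n → ℕ,
      (∀ w : Fin n, τ.arr d y w = D' w) ∧ (∀ w, w ≠ v → D' w = D w) ∧
      (∀ w, D' w = level (cut A par y) s r w ∨ D' w = level (cut A par y) s (r + 1) w) ∧
      (∀ u : Fin n, u.val < k → (cut A par y).Adj u v → tdist (cut A par y) s u = r →
        D' v = level (cut A par y) s (r + 1) v)) 8 (bfsBody a d) σ
    ⟨D, hD, fun _ _ => rfl, hDl, fun u hu => absurd hu (Nat.not_lt_zero _)⟩ (by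
      rintro i hi τ hf ⟨D', h₁, h₂, h₃, h₄⟩
      rw [h.reg0] at hi
      have hτ := h.of_frame hf (by simpa [bfsBody, Cmd.arrs] using ha)
        (by simpa [bfsBody, Cmd.arrs] using h3.symm) (by simp [bfsBody, Cmd.regs])
      have hτ' : BFSInput A par s y a (τ.setReg 8 i) :=
        ⟨hτ.reg0, hτ.reg1, hτ.reg2, hτ.reg4, hτ.mat, hτ.par⟩
      have h6' : τ.reg 6 = r := by rw [hf.2 6 (by simp [bfsBody, Cmd.regs]) (by simp), h6]
      have h7' : τ.reg 7 = v := by rw [hf.2 7 (by simp [bfsBody, Cmd.regs]) (by simp), h7]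
      obtain ⟨D'', g₁, g₂, g₃, g₄, g₅⟩ := exec_bfsBody (d := d) (v := v) (u := ⟨i, hi⟩) hτ' hr
        (by simpa using h6') (by simpa using h7') (by simp) h₁ h₃
      refine ⟨D'', g₁, fun w hw => (g₂ w hw).trans (h₂ w hw), g₄, fun u hu hadj htd => ?_⟩
      rcases Nat.lt_succ_iff_lt_or_eq.1 hu with hu | hu
      · have h₅ := h₄ u hu hadj htd
        rw [g₃ h₅, h₅]
      · obtain rfl : u = ⟨i, hi⟩ := Fin.ext hu
        exact g₅ hadj htd)
  refine ⟨D', fun w => by rw [he]; exact h₁ w, h₂, ?_⟩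
  by_cases hex : ∃ u, (cut A par y).Adj u v ∧ tdist (cut A par y) s u = r
  · obtain ⟨u, hadj, htd⟩ := hex
    exact h₄ u (by rw [h.reg0]; exact u.isLt) hadj htd
  · have h₅ := level_succ_of_forall hr (fun u hadj htd => hex ⟨u, hadj, htd⟩)
    rcases h₃ v with hv | hv
    · rw [hv, h₅]
    · exact hv

theorem exec_bfs_loop7 (ha : a ≠ d) (h3 : d ≠ 3) {σ : Store} (h : BFSInput A par s y a σ)
    {r : ℕ} (hr : r < n) (h6 : σ.reg 6 = r)
    (hD : ∀ w : Fin n, σ.arr d y w = level (cut A par y) s r w) (w : Fin n) :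
    ((Cmd.loop 7 (.loop 8 (bfsBody a d))).exec σ).arr d y w =
      level (cut A par y) s (r + 1) w := by
  obtain ⟨τ, h₁, hf, he⟩ := Cmd.exec_loop (fun k τ =>
      ∀ w : Fin n, τ.arr d y w = if w.val < k then level (cut A par y) s (r + 1) w
        else level (cut A par y) s r w) 7 (.loop 8 (bfsBody a d)) σ
    (by simpa using hD) (by
      intro i hi τ hf h₁
      rw [h.reg0] at hi
      have hτ := h.of_frame hf (by simpa [bfsBody, Cmd.arrs] using ha)
        (by simpa [bfsBody, Cmd.arrs] using h3.symm) (by simp [bfsBody, Cmd.regs])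
      have hτ' : BFSInput A par s y a (τ.setReg 7 i) :=
        ⟨hτ.reg0, hτ.reg1, hτ.reg2, hτ.reg4, hτ.mat, hτ.par⟩
      have h6' : τ.reg 6 = r := by rw [hf.2 6 (by simp [bfsBody, Cmd.regs]) (by simp), h6]
      obtain ⟨D', g₁, g₂, g₃⟩ := exec_bfs_loop8 (v := ⟨i, hi⟩) ha h3 hτ' hr
        (by simpa using h6') (by simp) h₁ (by intro w; split_ifs <;> simp)
      intro w
      rw [g₁ w]
      by_cases hw : w = ⟨i, hi⟩
      · rw [hw, g₃]; simp
      · have hw' : w.val ≠ i := fun h => hw (Fin.ext h)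
        rw [g₂ w hw]
        split_ifs <;> first | rfl | omega)
  rw [he]
  exact (h₁ w).trans (if_pos (by rw [h.reg0]; exact w.isLt))

/-- Breadth-first search computes the distances from the source after the failure. -/
theorem exec_bfs (ha : a ≠ d) (h3 : d ≠ 3) {σ : Store} (h : BFSInput A par s y a σ) (w : Fin n) :
    ((bfs a d).exec σ).arr d y w = tdist (cut A par y) s w := by
  obtain ⟨τ, h₁, hf, he⟩ := Cmd.exec_loop (fun k τ => ∀ w : Fin n, w.val < k →
      τ.arr d y w = n + 4) 7 (.write d (.reg 2) (.reg 7) (.reg 4)) σ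
    (fun w hw => absurd hw (Nat.not_lt_zero _)) (by
      intro i hi τ hf h₁ w hw
      have h2 : τ.reg 2 = y := by rw [hf.2 2 (by simp [Cmd.regs]) (by simp), h.reg2]
      have h4 : τ.reg 4 = n + 4 := by rw [hf.2 4 (by simp [Cmd.regs]) (by simp), h.reg4]
      by_cases hwi : w.val = i
      · simp [Cmd.exec, Expr.eval, hwi, h2, h4]
      · have := h₁ w (by omega)
        simpa [Cmd.exec, Expr.eval, hwi] using this)
  have hτ := h.of_frame hf (by simpa [Cmd.arrs] using ha) (by simpa [Cmd.arrs] using h3.symm)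
    (by simp [Cmd.regs])
  set τ₁ := (Cmd.write d (.reg 2) (.reg 1) (.const 0)).exec (τ.setReg 7 (σ.reg 0)) with hτ₁
  have hin : BFSInput A par s y a τ₁ := by
    refine ⟨hτ.reg0, hτ.reg1, hτ.reg2, hτ.reg4, ?_, ?_⟩
    · rw [hτ₁, Cmd.exec_arr (by simpa [Cmd.arrs] using ha)]; exact hτ.mat
    · rw [hτ₁, Cmd.exec_arr (by simpa [Cmd.arrs] using h3.symm)]; exact hτ.par
  have hD : ∀ w : Fin n, τ₁.arr d y w = level (cut A par y) s 0 w := by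
    intro w
    rw [hτ₁]
    by_cases hw : w = s
    · subst hw; simp [level, Cmd.exec, Expr.eval, hτ.reg2, hτ.reg1]
    · have hw' : w.val ≠ s.val := fun h => hw (Fin.ext h)
      have h₂ : ¬ tdist (cut A par y) s w ≤ 0 := by
        intro h₂
        exact hw (eq_of_tdist_eq_zero (Nat.le_zero.1 h₂)).symm
      simp [level, Cmd.exec, Expr.eval, h₂, hw', h₁ w (by rw [h.reg0]; exact w.isLt), hτ.reg1]
  obtain ⟨τ₂, h₂, -, he₂⟩ := Cmd.exec_loop (fun k τ => ∀ w : Fin n,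
      τ.arr d y w = level (cut A par y) s k w) 6 (.loop 7 (.loop 8 (bfsBody a d))) τ₁ hD (by
      intro r hr τ hf h₂
      rw [hin.reg0] at hr
      have hτ := hin.of_frame hf (by simpa [bfsBody, Cmd.arrs] using ha)
        (by simpa [bfsBody, Cmd.arrs] using h3.symm) (by simp [bfsBody, Cmd.regs])
      have hτ' : BFSInput A par s y a (τ.setReg 6 r) :=
        ⟨hτ.reg0, hτ.reg1, hτ.reg2, hτ.reg4, hτ.mat, hτ.par⟩
      exact exec_bfs_loop7 ha h3 hτ' hr (by simp) h₂)
  have hexec : (bfs a d).exec σ = τ₂.setReg 6 n := by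
    change (Cmd.loop 6 _).exec ((Cmd.write d (.reg 2) (.reg 1) (.const 0)).exec
      ((Cmd.loop 7 _).exec σ)) = _
    rw [he, ← hτ₁, he₂, hin.reg0]
  rw [hin.reg0] at h₂
  rw [hexec, ← level_card]
  exact h₂ w

end BFS

/-! ### Commands that write to a single row of an array. -/

namespace Cmd

/-- All writes to the array `d` are to the row given by the register `y`. -/
def WritesRow (d y : ℕ) : Cmd → Prop
  | skip => True
  | assign _ _ => True
  | write a i _ _ => a = d → i = .reg y
  | seq p q => p.WritesRow d y ∧ q.WritesRow d y
  | ite _ p q => p.WritesRow d y ∧ q.WritesRow d y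
  | loop _ p => p.WritesRow d y

/-- The replacement distances of all failures share one array, so a frame rule for whole arrays is
too coarse; the search for one failure has to leave the rows of the others intact. -/
theorem exec_row {p : Cmd} {d y : ℕ} (h : p.WritesRow d y) (hy : y ∉ p.regs) {σ : Store} {i : ℕ}
    (hi : i ≠ σ.reg y) (j : ℕ) : (p.exec σ).arr d i j = σ.arr d i j := by
  induction p generalizing σ with
  | skip => rfl
  | assign x e => rfl
  | write a i' j' e =>
    by_cases had : d = a
    · have h₁ : i' = .reg y := h had.symm
      subst h₁
      simp [exec, Expr.eval, hi]
    · simp [exec, had]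
  | seq p q hp hq =>
    simp only [regs, List.mem_append, not_or] at hy
    rw [exec, hq h.2 hy.2 (by rwa [exec_reg hy.1]), hp h.1 hy.1 hi]
  | ite b p q hp hq =>
    simp only [regs, List.mem_append, not_or] at hy
    rw [exec]
    split_ifs
    · exact hp h.1 hy.1 hi
    · exact hq h.2 hy.2 hi
  | loop x p hp =>
    simp only [regs, List.mem_cons, not_or] at hy
    rw [exec, Store.setReg_arr]
    generalize σ.reg 0 = k
    induction k with
    | zero => rfl
    | succ k ih =>
      rw [iterateBody, hp h hy.2, Store.setReg_arr, ih]
      rw [Store.setReg_reg, if_neg hy.1, iterateBody_reg hy.2 hy.1]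
      exact hi

end Cmd

/-! ### The cluster size, the tree and the table of replacement distances. -/

/-- The distance of `v` from the source in the graph. -/
def depthExpr (v : Expr) : Expr := .read 2 (.reg 1) v

/-- The least number whose cube is at least `n`, in register `5`. -/
def cubeRoot : Cmd :=
  .loop 6 (.mul 11 7 (.reg 6) (.reg 6) ;; .mul 12 7 (.reg 11) (.reg 6) ;;
    .ite (.lt (.reg 12) (.reg 0)) (.assign 5 (.add (.reg 6) (.const 1))) .skip)

/-- The test whether `u` is a possible parent of `v`. -/
def isParentExpr : Expr :=
  (Expr.read 0 (.reg 8) (.reg 7)).and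
    ((Expr.eq (.add (depthExpr (.reg 8)) (.const 1)) (depthExpr (.reg 7))).and
      (.lt (depthExpr (.reg 7)) (.reg 4)))

/-- The parents in the breadth-first search tree. -/
def computeParents : Cmd :=
  .loop 7 (.find 9 8 isParentExpr ;;
    .ite (.lt (.reg 9) (.reg 0)) (.write 3 (.const 0) (.reg 7) (.reg 9)) .skip)

/-- The computation of the tree and of all replacement distances. -/
def setup : Cmd :=
  .assign 4 (.add (.reg 0) (.const 4)) ;; cubeRoot ;;
  .loop 7 (.write 3 (.const 0) (.reg 7) (.reg 7)) ;; .assign 2 (.reg 1) ;; bfs 0 2 ;;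
  computeParents ;; .loop 2 (bfs 0 2)

section Setup

variable {n : ℕ} {G : SimpleGraph (Fin n)} {s : Fin n} {par : Fin n → Fin n} {K : ℕ}

/-- The invariant makes register `5` one more than the largest number tried so far whose cube is
below `n`, and `0` before the first success. The number `0` always succeeds, so the result is
positive. -/
theorem exec_cubeRoot {σ : Store} (h0 : σ.reg 0 = n) (h5 : σ.reg 5 = 0) (hn : 1 ≤ n) :
    1 ≤ (cubeRoot.exec σ).reg 5 ∧ n ≤ (cubeRoot.exec σ).reg 5 ^ 3 ∧
      ((cubeRoot.exec σ).reg 5 - 1) ^ 3 < n := by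
  obtain ⟨τ, ⟨h₁, h₂, h₃⟩, -, he⟩ := Cmd.exec_loop (fun k τ => τ.reg 5 ≤ k ∧
      (∀ j < k, j ^ 3 < n → j < τ.reg 5) ∧ (τ.reg 5 = 0 ∨ (τ.reg 5 - 1) ^ 3 < n)) 6
      (.mul 11 7 (.reg 6) (.reg 6) ;; .mul 12 7 (.reg 11) (.reg 6) ;;
        .ite (.lt (.reg 12) (.reg 0)) (.assign 5 (.add (.reg 6) (.const 1))) .skip) σ
    ⟨by omega, by simp, .inl h5⟩ (by
      intro i hi τ hf ⟨h₁, h₂, h₃⟩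
      rw [h0] at hi
      have h0' : τ.reg 0 = n := by rw [hf.2 0 (by decide) (by decide), h0]
      set τ₁ := (Cmd.mul 11 7 (.reg 6) (.reg 6)).exec (τ.setReg 6 i) with hτ₁
      obtain ⟨-, hr₁, hm₁⟩ := Cmd.exec_mul (r := 11) (x := 7) (e₁ := .reg 6) (e₂ := .reg 6)
        (by decide) (by decide) (by decide) (by decide) (by decide) (by decide) (τ.setReg 6 i)
        (by simp [Expr.eval, h0']; omega)
      rw [← hτ₁] at hr₁ hm₁
      have h6₁ : τ₁.reg 6 = i := by rw [hr₁ 6 (by decide) (by decide)]; simp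
      have h0₁ : τ₁.reg 0 = n := by rw [hr₁ 0 (by decide) (by decide)]; simpa using h0'
      set τ₂ := (Cmd.mul 12 7 (.reg 11) (.reg 6)).exec τ₁ with hτ₂
      obtain ⟨-, hr₂, hm₂⟩ := Cmd.exec_mul (r := 12) (x := 7) (e₁ := .reg 11) (e₂ := .reg 6)
        (by decide) (by decide) (by decide) (by decide) (by decide) (by decide) τ₁
        (by simp [Expr.eval, h6₁, h0₁]; omega)
      rw [← hτ₂] at hr₂ hm₂
      have h12 : τ₂.reg 12 = i ^ 3 := by
        rw [hm₂]
        simp only [Expr.eval, h6₁, hm₁, Store.setReg_reg, if_true]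
        ring
      have h6₂ : τ₂.reg 6 = i := by rw [hr₂ 6 (by decide) (by decide), h6₁]
      have h0₂ : τ₂.reg 0 = n := by rw [hr₂ 0 (by decide) (by decide), h0₁]
      have h5₂ : τ₂.reg 5 = τ.reg 5 := by
        rw [hr₂ 5 (by decide) (by decide), hr₁ 5 (by decide) (by decide)]; simp
      have hexec : (Cmd.mul 11 7 (.reg 6) (.reg 6) ;; .mul 12 7 (.reg 11) (.reg 6) ;;
          .ite (.lt (.reg 12) (.reg 0)) (.assign 5 (.add (.reg 6) (.const 1))) .skip).exec
          (τ.setReg 6 i) = (Cmd.ite (.lt (.reg 12) (.reg 0))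
            (.assign 5 (.add (.reg 6) (.const 1))) .skip).exec τ₂ := rfl
      rw [hexec, Cmd.exec_ite]
      have hiff : (Expr.lt (.reg 12) (.reg 0)).Holds τ₂ ↔ i ^ 3 < n := by
        rw [Expr.holds_lt, Expr.eval, Expr.eval, h12, h0₂]
      by_cases hlt : i ^ 3 < n
      · rw [if_pos (hiff.2 hlt)]
        simp only [Cmd.exec, Expr.eval, Store.setReg_reg, if_true, h6₂]
        exact ⟨le_rfl, fun j hj _ => hj, .inr (by simpa using hlt)⟩
      · rw [if_neg (mt hiff.1 hlt)]
        simp only [Cmd.exec, h5₂]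
        refine ⟨by omega, fun j hj hjn => ?_, h₃⟩
        rcases Nat.lt_succ_iff_lt_or_eq.1 hj with hj | rfl
        · exact h₂ j hj hjn
        · exact absurd hjn hlt)
  have h5' : (cubeRoot.exec σ).reg 5 = τ.reg 5 := by
    rw [cubeRoot, he]; simp
  rw [h0] at h₁ h₂
  rw [h5']
  have hpos : 0 < τ.reg 5 := h₂ 0 (by omega) (by simpa using Nat.pos_of_ne_zero (by omega))
  refine ⟨hpos, ?_, h₃.resolve_left (by omega)⟩
  -- If the result is `n`, its cube is trivially large enough. Otherwise the result itself was
  -- tried, and a cube below `n` would have raised register `5` above it.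
  rcases h₁.eq_or_lt with h | h
  · rw [h]
    exact Nat.le_self_pow (by norm_num) n
  · by_contra hlt
    exact lt_irrefl _ (h₂ _ h (not_le.1 hlt))

/-- The array starts as the identity, so vertices without a candidate stay fixed. The source has
none because its depth is zero, and unreachable vertices are excluded by the test for a finite
depth. -/
theorem exec_computeParents {σ : Store} (h0 : σ.reg 0 = n) (h1 : σ.reg 1 = s)
    (h4 : σ.reg 4 = n + 4) (hG : IsMatrix (σ.arr 0) G) (hpar : ∀ v : Fin n, σ.arr 3 0 v = v)
    (hd : ∀ v : Fin n, σ.arr 2 s v = tdist G s v) :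
    ∃ par : Fin n → Fin n, IsBFSParent G s par ∧
      ∀ v : Fin n, (computeParents.exec σ).arr 3 0 v = par v := by
  obtain ⟨τ, ⟨par, h₁, h₂⟩, -, he⟩ := Cmd.exec_loop (fun k τ => ∃ par : Fin n → Fin n,
      (∀ v : Fin n, τ.arr 3 0 v = par v) ∧ ∀ v : Fin n,
        (k ≤ v.val → par v = v) ∧
        (v.val < k → v ≠ s → tdist G s v < n + 4 →
          G.Adj (par v) v ∧ tdist G s (par v) + 1 = tdist G s v) ∧
        (v = s ∨ ¬ tdist G s v < n + 4 → par v = v)) 7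
      (.find 9 8 isParentExpr ;;
        .ite (.lt (.reg 9) (.reg 0)) (.write 3 (.const 0) (.reg 7) (.reg 9)) .skip) σ
    ⟨id, hpar, fun v => ⟨fun _ => rfl, fun h => absurd h (Nat.not_lt_zero _), fun _ => rfl⟩⟩ (by
      rintro i hi τ hf ⟨par, h₁, h₂⟩
      rw [h0] at hi
      have h0' : τ.reg 0 = n := by rw [hf.2 0 (by decide) (by decide), h0]
      have h1' : τ.reg 1 = s := by rw [hf.2 1 (by decide) (by decide), h1]
      have h4' : τ.reg 4 = n + 4 := by rw [hf.2 4 (by decide) (by decide), h4]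
      have hG' : IsMatrix (τ.arr 0) G := by rw [hf.1 0 (by decide)]; exact hG
      have hd' : ∀ v : Fin n, τ.arr 2 s v = tdist G s v := by rw [hf.1 2 (by decide)]; exact hd
      have hiff : ∀ u : Fin n, isParentExpr.Holds ((τ.setReg 7 i).setReg 8 u) ↔
          G.Adj u ⟨i, hi⟩ ∧ tdist G s u + 1 = tdist G s ⟨i, hi⟩ ∧ tdist G s ⟨i, hi⟩ < n + 4 := by
        intro u
        have g₁ := hG'.ne_zero_iff u ⟨i, hi⟩
        have g₂ := hd' ⟨i, hi⟩
        simp only at g₁ g₂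
        simp [isParentExpr, depthExpr, Expr.holds_and, Expr.holds_read, Expr.holds_eq,
          Expr.holds_lt, Expr.eval, g₁, g₂, h1', h4', hd']
      obtain ⟨hfa, hfr, hfind⟩ := Cmd.exec_find (r := 9) (x := 8) (b := isParentExpr) (by decide)
        (by decide) (by decide) (τ.setReg 7 i)
      set τ₁ := (Cmd.find 9 8 isParentExpr).exec (τ.setReg 7 i) with hτ₁
      have h7₁ : τ₁.reg 7 = i := by rw [hfr 7 (by decide) (by decide)]; simp
      have h0₁ : τ₁.reg 0 = n := by rw [hfr 0 (by decide) (by decide)]; simpa using h0'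
      have hr0 : (τ.setReg 7 i).reg 0 = n := by simpa using h0'
      rw [hr0] at hfind
      have hexec : (Cmd.find 9 8 isParentExpr ;;
          .ite (.lt (.reg 9) (.reg 0)) (.write 3 (.const 0) (.reg 7) (.reg 9)) .skip).exec
          (τ.setReg 7 i) = (Cmd.ite (.lt (.reg 9) (.reg 0))
            (.write 3 (.const 0) (.reg 7) (.reg 9)) .skip).exec τ₁ := rfl
      rw [hexec, Cmd.exec_ite]
      have hlt : (Expr.lt (.reg 9) (.reg 0)).Holds τ₁ ↔ τ₁.reg 9 < n := by
        rw [Expr.holds_lt, Expr.eval, Expr.eval, h0₁]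
      rcases hfind with ⟨hlt', hb⟩ | ⟨heq, hall⟩
      · rw [if_pos (hlt.2 hlt')]
        have hb' := (hiff ⟨_, hlt'⟩).1 hb
        refine ⟨Function.update par ⟨i, hi⟩ ⟨_, hlt'⟩, fun v => ?_, fun v => ?_⟩
        · by_cases hv : v = ⟨i, hi⟩
          · subst hv
            simp [Cmd.exec, Expr.eval, h7₁]
          · have hv' : v.val ≠ i := fun h => hv (Fin.ext h)
            simp [Cmd.exec, Expr.eval, h7₁, hv, hv', hfa, h₁]
        · by_cases hv : v = ⟨i, hi⟩
          · subst hv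
            rw [Function.update_self]
            refine ⟨fun h => absurd h (by simp), fun _ _ _ => ⟨hb'.1, hb'.2.1⟩, ?_⟩
            rintro (h | h)
            · rw [h] at hb'
              simp at hb'
            · exact absurd hb'.2.2 h
          · have hv' : v.val ≠ i := fun h => hv (Fin.ext h)
            rw [Function.update_of_ne hv]
            exact ⟨fun h => (h₂ v).1 (by omega), fun h => (h₂ v).2.1 (by omega), (h₂ v).2.2⟩
      · rw [if_neg (fun h => by have := hlt.1 h; omega)]
        refine ⟨par, fun v => by simp [Cmd.exec, hfa, h₁], fun v => ?_⟩
        refine ⟨fun h => (h₂ v).1 (by omega), fun h hvs hfin => ?_, (h₂ v).2.2⟩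
        by_cases hv : v = ⟨i, hi⟩
        · subst hv
          obtain ⟨u, hu, hud⟩ := exists_adj_tdist_add_one hvs
            (by rw [Fintype.card_fin]; exact hfin)
          exact absurd ((hiff u).2 ⟨hu, hud, hfin⟩) (hall u u.isLt)
        · have hv' : v.val ≠ i := fun h => hv (Fin.ext h)
          exact (h₂ v).2.1 (by omega) hvs hfin)
  refine ⟨par, ⟨fun v hvs hfin => ?_, fun v hv => ?_⟩, fun v => by rw [computeParents, he]; exact h₁ v⟩
  · rw [Fintype.card_fin] at hfin
    exact (h₂ v).2.1 (by rw [h0]; exact v.isLt) hvs hfin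
  · rw [Fintype.card_fin] at hv
    exact (h₂ v).2.2 hv

/-- The store holds the graph, the tree and all replacement distances. -/
structure Ready (G : SimpleGraph (Fin n)) (s : Fin n) (par : Fin n → Fin n) (K : ℕ) (σ : Store) :
    Prop where
  reg0 : σ.reg 0 = n
  reg1 : σ.reg 1 = s
  reg4 : σ.reg 4 = n + 4
  reg5 : σ.reg 5 = K
  mat : IsMatrix (σ.arr 0) G
  parent : ∀ v : Fin n, σ.arr 3 0 v = par v
  dist : ∀ y v : Fin n, σ.arr 2 y v = tdist (cut G par y) s v

theorem Ready.congr {σ τ : Store} (h : Ready G s par K σ)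
    (ha : ∀ a ∈ [0, 2, 3], τ.arr a = σ.arr a) (hr : ∀ i ∈ [0, 1, 4, 5], τ.reg i = σ.reg i) :
    Ready G s par K τ := by
  refine ⟨?_, ?_, ?_, ?_, ?_, ?_, ?_⟩
  · rw [hr 0 (by simp), h.reg0]
  · rw [hr 1 (by simp), h.reg1]
  · rw [hr 4 (by simp), h.reg4]
  · rw [hr 5 (by simp), h.reg5]
  · rw [ha 0 (by simp)]; exact h.mat
  · rw [ha 3 (by simp)]; exact h.parent
  · rw [ha 2 (by simp)]; exact h.dist

theorem Ready.setReg {σ : Store} (h : Ready G s par K σ) {x : ℕ} (w : ℕ)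
    (hx : x ∉ [0, 1, 4, 5]) : Ready G s par K (σ.setReg x w) :=
  h.congr (fun _ _ => rfl) fun i hi => by
    have hix : i ≠ x := by rintro rfl; exact hx hi
    simp [hix]

theorem Ready.exec {σ : Store} (h : Ready G s par K σ) {p : Cmd}
    (hp : (∀ a ∈ [0, 2, 3], a ∉ p.arrs) ∧ ∀ i ∈ [0, 1, 4, 5], i ∉ p.regs) :
    Ready G s par K (p.exec σ) :=
  h.congr (fun a ha => Cmd.exec_arr (hp.1 a ha) σ) fun i hi => Cmd.exec_reg (hp.2 i hi) σ

theorem Ready.of_frame {σ τ : Store} (h : Ready G s par K σ) {p : Cmd} {x : ℕ}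
    (hf : Cmd.Frame p x σ τ)
    (hp : (∀ a ∈ [0, 2, 3], a ∉ p.arrs) ∧ ∀ i ∈ [0, 1, 4, 5], i ∉ p.regs ∧ i ≠ x) :
    Ready G s par K τ :=
  h.congr (fun a ha => hf.1 a (hp.1 a ha)) fun i hi => hf.2 i (hp.2 i hi).1 (hp.2 i hi).2

theorem setup_regs_arrs : 1 ∉ setup.arrs ∧ 5 ∉ setup.arrs := by decide

theorem exec_setup (G : SimpleGraph (Fin n)) (s : Fin n) :
    ∃ (par : Fin n → Fin n) (K : ℕ), IsBFSParent G s par ∧ 1 ≤ K ∧ n ≤ K ^ 3 ∧ (K - 1) ^ 3 < n ∧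
      Ready G s par K (setup.exec (inputStore G s)) := by
  have hn : 1 ≤ n := by have := s.isLt; omega
  set σ := inputStore G s with hσ
  have hσ0 : σ.reg 0 = n := rfl
  have hσ1 : σ.reg 1 = s := rfl
  have hσG : IsMatrix (σ.arr 0) G := adjEntry_eq G
  set σ₁ := (Cmd.assign 4 (.add (.reg 0) (.const 4))).exec σ with hσ₁
  have h4₁ : σ₁.reg 4 = n + 4 := by simp [hσ₁, Cmd.exec, Expr.eval, hσ0]
  have hreg₁ : ∀ i, i ≠ 4 → σ₁.reg i = σ.reg i := fun i hi => by simp [hσ₁, Cmd.exec, hi]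
  have harr₁ : σ₁.arr = σ.arr := rfl
  obtain ⟨hK₁, hK₂, hK₃⟩ := exec_cubeRoot (σ := σ₁) (n := n) (by rw [hreg₁ 0 (by decide), hσ0])
    (by rw [hreg₁ 5 (by decide)]; rfl) hn
  set σ₂ := cubeRoot.exec σ₁ with hσ₂
  have harr₂ : ∀ a, σ₂.arr a = σ.arr a := fun a => by
    rw [hσ₂, Cmd.exec_arr (by simp [cubeRoot, Cmd.arrs, Cmd.mul]), harr₁]
  have h0₂ : σ₂.reg 0 = n := by rw [hσ₂, Cmd.exec_reg (by decide), hreg₁ 0 (by decide), hσ0]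
  have h1₂ : σ₂.reg 1 = s := by rw [hσ₂, Cmd.exec_reg (by decide), hreg₁ 1 (by decide), hσ1]
  have h4₂ : σ₂.reg 4 = n + 4 := by rw [hσ₂, Cmd.exec_reg (by decide), h4₁]
  obtain ⟨τ, hP, hf, he⟩ := Cmd.exec_loop (fun k τ => ∀ v : Fin n, v.val < k →
      τ.arr 3 0 v = v) 7 (.write 3 (.const 0) (.reg 7) (.reg 7)) σ₂
    (fun v hv => absurd hv (Nat.not_lt_zero _)) (by
      intro i hi τ hf h₁ v hv
      by_cases hvi : v.val = i
      · simp [Cmd.exec, Expr.eval, hvi]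
      · have := h₁ v (by omega)
        simpa [Cmd.exec, Expr.eval, hvi] using this)
  set σ₃ := (Cmd.assign 2 (.reg 1)).exec
    ((Cmd.loop 7 (.write 3 (.const 0) (.reg 7) (.reg 7))).exec σ₂) with hσ₃
  have hreg₃ : ∀ i ∈ [0, 1, 4, 5], σ₃.reg i = σ₂.reg i := by
    intro i hi
    rw [hσ₃, Cmd.exec_reg (by revert i; decide), Cmd.exec_reg (by revert i; decide)]
  have hpar₃ : ∀ v : Fin n, σ₃.arr 3 0 v = v := by
    intro v
    rw [hσ₃, he]
    exact hP v (by rw [h0₂]; exact v.isLt)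
  have h2₃ : σ₃.reg 2 = s := by
    rw [hσ₃, he]
    simp [Cmd.exec, Expr.eval, hf.2 1 (by decide) (by decide), h1₂]
  have hG₃ : IsMatrix (σ₃.arr 0) G := by
    rw [hσ₃, Cmd.exec_arr (by decide), Cmd.exec_arr (by decide), harr₂]
    exact hσG
  -- With the identity as parent function no edge fails, so this search yields the plain distances
  -- from which the tree is then read off.
  have hin : BFSInput G id s s 0 σ₃ :=
    ⟨by rw [hreg₃ 0 (by decide), h0₂], by rw [hreg₃ 1 (by decide), h1₂], h2₃,
      by rw [hreg₃ 4 (by decide), h4₂], hG₃, hpar₃⟩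
  set σ₄ := (bfs 0 2).exec σ₃ with hσ₄
  have hreg₄ : ∀ i ∈ [0, 1, 4, 5], σ₄.reg i = σ₂.reg i := by
    intro i hi
    rw [hσ₄, Cmd.exec_reg (by revert i; decide), hreg₃ i hi]
  have hd₄ : ∀ v : Fin n, σ₄.arr 2 s v = tdist G s v := by
    intro v
    rw [hσ₄, exec_bfs (by decide) (by decide) hin, cut_eq_self (rfl : id s = s)]
  have hG₄ : IsMatrix (σ₄.arr 0) G := by rw [hσ₄, Cmd.exec_arr (by decide)]; exact hG₃
  obtain ⟨par, hp, hpar⟩ := exec_computeParents (G := G) (s := s)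
    (by rw [hreg₄ 0 (by decide), h0₂]) (by rw [hreg₄ 1 (by decide), h1₂])
    (by rw [hreg₄ 4 (by decide), h4₂]) hG₄
    (by rw [hσ₄, Cmd.exec_arr (by decide)]; exact hpar₃) hd₄
  set σ₅ := computeParents.exec σ₄ with hσ₅
  have hreg₅ : ∀ i ∈ [0, 1, 4, 5], σ₅.reg i = σ₂.reg i := by
    intro i hi
    rw [hσ₅, Cmd.exec_reg (by revert i; decide), hreg₄ i hi]
  have hG₅ : IsMatrix (σ₅.arr 0) G := by rw [hσ₅, Cmd.exec_arr (by decide)]; exact hG₄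
  have h0₅ : σ₅.reg 0 = n := by rw [hreg₅ 0 (by decide), h0₂]
  have hin₅ : ∀ y : Fin n, BFSInput G par s y 0 (σ₅.setReg 2 y) := fun y =>
    ⟨h0₅, by simp [hreg₅ 1, h1₂], by simp, by simp [hreg₅ 4, h4₂], hG₅, hpar⟩
  obtain ⟨τ, hP, hf, he⟩ := Cmd.exec_loop (fun k τ => ∀ y v : Fin n, y.val < k →
      τ.arr 2 y v = tdist (cut G par y) s v) 2 (bfs 0 2) σ₅
    (fun y v hv => absurd hv (Nat.not_lt_zero _)) (by
      intro i hi τ hf h₁ y v hy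
      rw [h0₅] at hi
      have hin : BFSInput G par s ⟨i, hi⟩ 0 (τ.setReg 2 i) := by
        have hreg : ∀ j ∈ [0, 1, 4], τ.reg j = σ₂.reg j := by
          intro j hj
          rw [hf.2 j (by revert j; decide) (by revert j; decide), hreg₅ j (by revert j; decide)]
        refine ⟨by simp [hreg 0, h0₂], by simp [hreg 1, h1₂], by simp, by simp [hreg 4, h4₂],
          ?_, ?_⟩
        · rw [Store.setReg_arr, hf.1 0 (by decide)]; exact hG₅
        · rw [Store.setReg_arr, hf.1 3 (by decide)]; exact hpar
      by_cases hyi : y = ⟨i, hi⟩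
      · subst hyi
        exact exec_bfs (by decide) (by decide) hin v
      · have hyi' : y.val ≠ i := fun h => hyi (Fin.ext h)
        rw [Cmd.exec_row (y := 2) (by simp [bfs, bfsBody, Cmd.WritesRow]) (by decide)
          (by simpa using hyi')]
        exact h₁ y v (by omega))
  have hexec : setup.exec σ = τ.setReg 2 n := by
    change (Cmd.loop 2 (bfs 0 2)).exec σ₅ = _
    rw [he, h0₅]
  have hreg : ∀ i ∈ [0, 1, 4, 5], (τ.setReg 2 n).reg i = σ₂.reg i := by
    intro i hi
    have hi2 : i ≠ 2 := by revert i; decide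
    rw [Store.setReg_reg, if_neg hi2, hf.2 i (by revert i; decide) hi2, hreg₅ i hi]
  refine ⟨par, _, hp, hK₁, hK₂, hK₃, ?_⟩
  rw [hexec]
  refine ⟨by rw [hreg 0 (by decide), h0₂], by rw [hreg 1 (by decide), h1₂],
    by rw [hreg 4 (by decide), h4₂], hreg 5 (by decide), ?_, ?_, ?_⟩
  · rw [Store.setReg_arr, hf.1 0 (by decide)]; exact hG₅
  · rw [Store.setReg_arr, hf.1 3 (by decide)]; exact hpar
  · exact fun y v => hP y v (by rw [h0₅]; exact y.isLt)

end Setup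

/-! ### The skeleton -/

/-- Add the edge between the vertices in the registers `x` and `z` to the structure. -/
def addEdge (x z : ℕ) : Cmd :=
  .write 1 (.reg x) (.reg z) (.const 1) ;; .write 1 (.reg z) (.reg x) (.const 1)

/-- Add the edges of the tree. -/
def addTree : Cmd :=
  .loop 7 (.ite (Expr.eq (parExpr (.reg 7)) (.reg 7)).not
    (.assign 9 (parExpr (.reg 7)) ;; addEdge 9 7) .skip)

/-- The test of `Need` for the vertex in register `7`. -/
def needExpr (y : Expr) : Expr :=
  (Expr.eq (.reg 7) (.reg 1)).not.and
    (((Expr.lt (.read 2 y (.reg 7)) (.reg 4)).and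
      (Expr.lt (.add (depthExpr (.reg 7)) (.add (.reg 5) (.reg 5))) (.read 2 y (.reg 7))).not).and
    ((Expr.eq (.reg 7) y).not.and
      (.eq (.add (.read 2 y (parExpr (.reg 7))) (.const 1)) (.read 2 y (.reg 7)))).not)

/-- The test of `IsPred` for the failure of the edge above the vertex in register `2`. -/
def predExpr (u x : Expr) : Expr :=
  (cutAdjExpr 0 u x).and (.eq (.add (.read 2 (.reg 2) u) (.const 1)) (.read 2 (.reg 2) x))

/-- The test that the failure in register `3` is higher than that in register `2`. -/
def higherExpr : Expr :=
  (needExpr (.reg 3)).and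
    ((Expr.eq (.read 2 (.reg 3) (.reg 7)) (.read 2 (.reg 2) (.reg 7))).and
      (.lt (depthExpr (.reg 3)) (depthExpr (.reg 2))))

/-- Process a pair of a failure and a vertex whose replacement path has a small detour. -/
def smallDetoursBody : Cmd :=
  .ite (needExpr (.reg 2))
    (.find 9 3 higherExpr ;;
      .ite (.eq (.reg 9) (.reg 0))
        (.find 9 8 (predExpr (.reg 8) (.reg 7)) ;; addEdge 9 7) .skip) .skip

/-- Add the last edges of replacement paths with small detours. -/
def addSmallDetours : Cmd := .loop 7 (.loop 2 smallDetoursBody)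

/-- The test that `u` is an unmarked neighbor of `c` outside of the tree. -/
def freeExpr : Expr :=
  (Expr.read 0 (.reg 3) (.reg 8)).and
    ((Expr.eq (parExpr (.reg 3)) (.reg 8)).not.and
      ((Expr.eq (parExpr (.reg 8)) (.reg 3)).not.and (.eq (.read 5 (.const 0) (.reg 8)) (.const 0))))

/-- Put all free neighbors of `c` into its cluster. -/
def markCluster : Cmd :=
  .loop 8 (.ite freeExpr
    (.write 5 (.const 0) (.reg 8) (.add (.reg 3) (.const 1)) ;; addEdge 3 8) .skip)

/-- Greedily form clusters. -/
def addClusters : Cmd :=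
  .loop 3 (.count 11 8 freeExpr ;;
    .ite (Expr.lt (.reg 11) (.reg 5)).not
      (.write 5 (.const 1) (.reg 3) (.const 1) ;; markCluster) .skip)

/-- Add all edges at vertices outside of the clusters. -/
def addSparse : Cmd := .loop 3 (.loop 8 (.ite freeExpr (addEdge 3 8) .skip))

section Skeleton

variable {n : ℕ} {G H : SimpleGraph (Fin n)} {s : Fin n} {par : Fin n → Fin n} {K : ℕ}

theorem exec_addEdge {σ : Store} (hH : IsMatrix (σ.arr 1) H) {u v : Fin n} {x z : ℕ}
    (hu : σ.reg x = u) (hv : σ.reg z = v) (hne : u ≠ v) :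
    IsMatrix (((addEdge x z).exec σ).arr 1) (H ⊔ edge u v) := by
  intro a b
  have h := hH a b
  have hiff : (H ⊔ edge u v).Adj a b ↔ (a = v ∧ b = u) ∨ (a = u ∧ b = v) ∨ H.Adj a b := by
    rw [sup_adj, edge_adj]
    constructor
    · rintro (h | ⟨⟨rfl, rfl⟩ | ⟨rfl, rfl⟩, -⟩) <;> simp [*]
    · rintro (⟨rfl, rfl⟩ | ⟨rfl, rfl⟩ | h)
      · exact .inr ⟨.inr ⟨rfl, rfl⟩, hne.symm⟩
      · exact .inr ⟨.inl ⟨rfl, rfl⟩, hne⟩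
      · exact .inl h
  simp only [addEdge, Cmd.exec, Expr.eval, Store.setArr_arr, Store.setArr_reg, hu, hv, true_and,
    Fin.val_inj, h]
  by_cases h₁ : a = v ∧ b = u
  · rw [if_pos h₁, if_pos (hiff.2 (.inl h₁))]
  · rw [if_neg h₁]
    by_cases h₂ : a = u ∧ b = v
    · rw [if_pos h₂, if_pos (hiff.2 (.inr (.inl h₂)))]
    · rw [if_neg h₂]
      by_cases h₃ : H.Adj a b
      · rw [if_pos h₃, if_pos (hiff.2 (.inr (.inr h₃)))]
      · rw [if_neg h₃, if_neg (by rw [hiff]; tauto)]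

theorem sup_edge_le_of_adj {V : Type*} {G H : SimpleGraph V} {u v : V} (hH : H ≤ G)
    (h : G.Adj u v) : H ⊔ edge u v ≤ G :=
  sup_le hH (by
    intro a b hab
    rw [edge_adj] at hab
    rcases hab.1 with ⟨rfl, rfl⟩ | ⟨rfl, rfl⟩
    · exact h
    · exact h.symm)

theorem ncard_edgeSet_sup_edge_le (H : SimpleGraph (Fin n)) (u v : Fin n) :
    (H ⊔ edge u v).edgeSet.ncard ≤ H.edgeSet.ncard + 1 := by
  have h : (H ⊔ edge u v).edgeSet ⊆ insert s(u, v) H.edgeSet := by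
    intro e
    induction e with
    | _ a b =>
      rw [mem_edgeSet, sup_adj, edge_adj]
      rintro (h | ⟨h, -⟩)
      · exact .inr h
      · exact .inl (by rw [Sym2.eq_iff]; tauto)
  exact (Set.ncard_le_ncard h (Set.toFinite _)).trans (Set.ncard_insert_le _ _)

theorem sup_edge_adj {V : Type*} (H : SimpleGraph V) {u v : V} (h : u ≠ v) :
    (H ⊔ edge u v).Adj u v := by
  rw [sup_adj, edge_adj]
  exact .inr ⟨.inl ⟨rfl, rfl⟩, h⟩

open Classical in
/-- The number of elements below `k` that satisfy `P`. -/
noncomputable def countBelow (P : Fin n → Prop) (k : ℕ) : ℕ :=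
  (Finset.univ.filter fun y => y.val < k ∧ P y).card

theorem countBelow_mono (P : Fin n → Prop) {k l : ℕ} (h : k ≤ l) :
    countBelow P k ≤ countBelow P l := by
  classical
  refine Finset.card_le_card fun y hy => ?_
  have := (Finset.mem_filter.1 hy).2
  exact Finset.mem_filter.2 ⟨Finset.mem_univ _, this.1.trans_le h, this.2⟩

theorem countBelow_succ (P : Fin n → Prop) {i : ℕ} (hi : i < n) (h : P ⟨i, hi⟩) :
    countBelow P i + 1 ≤ countBelow P (i + 1) := by
  classical
  unfold countBelow
  refine Finset.card_lt_card (Finset.ssubset_iff.2 ⟨⟨i, hi⟩, by simp, ?_⟩)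
  intro y hy
  rcases Finset.mem_insert.1 hy with rfl | hy
  · simp [h]
  · have := (Finset.mem_filter.1 hy).2
    exact Finset.mem_filter.2 ⟨Finset.mem_univ _, by omega, this.2⟩

open Classical in
theorem countBelow_le (P : Fin n → Prop) (k : ℕ) :
    countBelow P k ≤ (Finset.univ.filter P).card :=
  Finset.card_le_card fun _ hy =>
    Finset.mem_filter.2 ⟨Finset.mem_univ _, (Finset.mem_filter.1 hy).2.2⟩

theorem isMatrix_bot {f : ℕ → ℕ → ℕ} (h : ∀ i j, f i j = 0) :
    IsMatrix f (⊥ : SimpleGraph (Fin n)) := by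
  intro u v
  simp [h]

/-- No tree edge lies above the source, so row `s` of the replacement distances is the row of
depths. -/
theorem Ready.depth {σ : Store} (h : Ready G s par K σ) (hp : IsBFSParent G s par) (v : Fin n) :
    σ.arr 2 s v = tdist G s v := by
  rw [h.dist, cut_eq_self (hp.fix s (.inl rfl))]

theorem exec_addTree (hp : IsBFSParent G s par) {σ : Store} (h : Ready G s par K σ)
    (h1 : ∀ i j, σ.arr 1 i j = 0) :
    ∃ H : SimpleGraph (Fin n), IsMatrix ((addTree.exec σ).arr 1) H ∧ H ≤ G ∧
      H.edgeSet.ncard ≤ n ∧ ContainsTree par H := by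
  obtain ⟨τ, ⟨H, hH, hle, hcard, hT⟩, -, he⟩ := Cmd.exec_loop (fun k τ =>
      ∃ H : SimpleGraph (Fin n), IsMatrix (τ.arr 1) H ∧ H ≤ G ∧ H.edgeSet.ncard ≤ k ∧
        ∀ v : Fin n, v.val < k → par v ≠ v → H.Adj (par v) v) 7
      (.ite (Expr.eq (parExpr (.reg 7)) (.reg 7)).not
        (.assign 9 (parExpr (.reg 7)) ;; addEdge 9 7) .skip) σ
    ⟨⊥, isMatrix_bot h1, bot_le, by simp, fun v hv => absurd hv (Nat.not_lt_zero _)⟩ (by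
      rintro i hi τ hf ⟨H, hH, hle, hcard, hT⟩
      rw [h.reg0] at hi
      have hτ : Ready G s par K (τ.setReg 7 i) := (h.of_frame hf (by decide)).setReg i (by decide)
      have hpi := hτ.parent ⟨i, hi⟩
      have hiff : (Expr.eq (parExpr (.reg 7)) (.reg 7)).not.Holds (τ.setReg 7 i) ↔
          par ⟨i, hi⟩ ≠ ⟨i, hi⟩ := by
        simp only [Store.setReg_arr] at hpi
        simp only [Expr.holds_not, Expr.holds_eq, parExpr, Expr.eval, Store.setReg_reg,
          Store.setReg_arr, if_true, hpi, ne_eq, Fin.ext_iff]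
      rw [Cmd.exec_ite]
      by_cases hpar : par ⟨i, hi⟩ ≠ ⟨i, hi⟩
      · rw [if_pos (hiff.2 hpar)]
        refine ⟨H ⊔ edge (par ⟨i, hi⟩) ⟨i, hi⟩, ?_,
          sup_edge_le_of_adj hle (hp.containsTree _ hpar),
          (ncard_edgeSet_sup_edge_le _ _ _).trans (by omega), fun v hv hpv => ?_⟩
        · refine exec_addEdge (σ := (Cmd.assign 9 (parExpr (.reg 7))).exec (τ.setReg 7 i)) hH
            ?_ ?_ hpar
          · simpa [Cmd.exec, parExpr, Expr.eval] using hpi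
          · simp [Cmd.exec]
        · by_cases hvi : v = ⟨i, hi⟩
          · subst hvi
            exact sup_edge_adj H hpar
          · have hvi' : v.val ≠ i := fun h => hvi (Fin.ext h)
            exact .inl (hT v (by omega) hpv)
      · rw [if_neg (mt hiff.1 hpar)]
        refine ⟨H, hH, hle, by omega, fun v hv hpv => ?_⟩
        have hvi' : v.val ≠ i := by
          rintro rfl
          exact hpar hpv
        exact hT v (by omega) hpv)
  rw [h.reg0] at hcard hT
  exact ⟨H, by rw [addTree, he]; exact hH, hle, hcard, fun v => hT v v.isLt⟩

theorem holds_needExpr (hp : IsBFSParent G s par) {σ : Store} (h : Ready G s par K σ)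
    {y z : Fin n} {ye : Expr} (hy : ye.eval σ = y) (hz : σ.reg 7 = z) :
    (needExpr ye).Holds σ ↔ Need G s par K y z := by
  simp only [needExpr, Expr.holds_and, Expr.holds_not, Expr.holds_eq, Expr.holds_lt, Expr.eval,
    depthExpr, parExpr, hy, hz, h.reg1, h.reg4, h.reg5, h.parent, h.depth hp, h.dist, Need, Near,
    Fintype.card_fin, Fin.val_inj, not_lt, ne_eq, two_mul]

theorem holds_predExpr {σ : Store} (h : Ready G s par K σ) {y u x : Fin n} {ue xe : Expr}
    (hy : σ.reg 2 = y) (hu : ue.eval σ = u) (hx : xe.eval σ = x) :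
    (predExpr ue xe).Holds σ ↔ IsPred G s par y u x := by
  simp only [predExpr, Expr.holds_and, holds_cutAdjExpr h.mat h.parent hy hu hx, Expr.holds_eq,
    Expr.eval, hy, hu, hx, h.dist, IsPred]

/-- The search for a predecessor succeeds. -/
theorem exec_find_pred {σ : Store} (h : Ready G s par K σ) {y x : Fin n} {rx : ℕ}
    (hy : σ.reg 2 = y) (hx : σ.reg rx = x) (hrx : rx ≠ 9 ∧ rx ≠ 8) (hxs : x ≠ s)
    (hfin : tdist (cut G par y) s x < n + 4) :
    ∃ u : Fin n, IsPred G s par y u x ∧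
      ((Cmd.find 9 8 (predExpr (.reg 8) (.reg rx))).exec σ).reg 9 = u := by
  have hiff : ∀ u : Fin n, (predExpr (.reg 8) (.reg rx)).Holds (σ.setReg 8 u) ↔
      IsPred G s par y u x := fun u =>
    holds_predExpr (h.setReg u (by decide)) (by simpa using hy) (by simp [Expr.eval])
      (by simp [Expr.eval, hrx.2, hx])
  obtain ⟨-, -, hfind⟩ := Cmd.exec_find (r := 9) (x := 8) (b := predExpr (.reg 8) (.reg rx))
    (by simp [predExpr, cutAdjExpr, Expr.and, Expr.not, Expr.vars, parExpr, hrx.1.symm])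
    (by decide) (by decide) σ
  rw [h.reg0] at hfind
  rcases hfind with ⟨hlt, hb⟩ | ⟨-, hall⟩
  · exact ⟨⟨_, hlt⟩, (hiff ⟨_, hlt⟩).1 hb, rfl⟩
  · obtain ⟨u, hu⟩ := exists_adj_tdist_add_one hxs (by rw [Fintype.card_fin]; exact hfin)
    exact absurd ((hiff u).2 hu) (hall u u.isLt)

/-- Topmost means that the search for a higher failure with the same replacement distance fails.
Only then is an edge added, and a predecessor exists since `Need` includes a finite distance and `z
≠ s`. -/
theorem exec_smallDetoursBody (hp : IsBFSParent G s par) {σ : Store} (h : Ready G s par K σ)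
    {y z : Fin n} (hy : σ.reg 2 = y) (hz : σ.reg 7 = z) (hH : IsMatrix (σ.arr 1) H) :
    (Topmost G s par K y z ∧ ∃ u, IsPred G s par y u z ∧
      IsMatrix ((smallDetoursBody.exec σ).arr 1) (H ⊔ edge u z)) ∨
    (¬ Topmost G s par K y z ∧ IsMatrix ((smallDetoursBody.exec σ).arr 1) H) := by
  rw [smallDetoursBody, Cmd.exec_ite]
  have hneed := holds_needExpr hp h (ye := .reg 2) hy hz
  by_cases hn : Need G s par K y z
  · rw [if_pos (hneed.2 hn)]
    obtain ⟨hfa, hfr, hfind⟩ := Cmd.exec_find (r := 9) (x := 3) (b := higherExpr) (by decide)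
      (by decide) (by decide) σ
    set σ₁ := (Cmd.find 9 3 higherExpr).exec σ with hσ₁
    have h₁ : Ready G s par K σ₁ := h.exec (by decide)
    have hy₁ : σ₁.reg 2 = y := by rw [hfr 2 (by decide) (by decide), hy]
    have hz₁ : σ₁.reg 7 = z := by rw [hfr 7 (by decide) (by decide), hz]
    have hiff : ∀ y' : Fin n, higherExpr.Holds (σ.setReg 3 y') ↔ Need G s par K y' z ∧
        tdist (cut G par y') s z = tdist (cut G par y) s z ∧ tdist G s y' < tdist G s y := by
      intro y'
      have hr := h.setReg (x := 3) y' (by decide)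
      have h₂ := holds_needExpr hp hr (ye := .reg 3) (y := y') (z := z) (by simp [Expr.eval])
        (by simpa using hz)
      have h2 : (σ.setReg 3 y').reg 2 = y := by simpa using hy
      have h7 : (σ.setReg 3 y').reg 7 = z := by simpa using hz
      have h3 : (σ.setReg 3 y').reg 3 = y' := by simp
      simp only [higherExpr, Expr.holds_and, Expr.holds_eq, Expr.holds_lt, Expr.eval, depthExpr,
        h₂, h2, h7, h3, hr.reg1, hr.depth hp, hr.dist]
    have hexec : (Cmd.find 9 3 higherExpr ;;
        .ite (.eq (.reg 9) (.reg 0))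
          (.find 9 8 (predExpr (.reg 8) (.reg 7)) ;; addEdge 9 7) .skip).exec σ =
        (Cmd.ite (.eq (.reg 9) (.reg 0))
          (.find 9 8 (predExpr (.reg 8) (.reg 7)) ;; addEdge 9 7) .skip).exec σ₁ := rfl
    rw [hexec, Cmd.exec_ite]
    have heq : (Expr.eq (.reg 9) (.reg 0)).Holds σ₁ ↔ σ₁.reg 9 = n := by
      rw [Expr.holds_eq, Expr.eval, Expr.eval, h₁.reg0]
    rw [h.reg0] at hfind
    rcases hfind with ⟨hlt, hb⟩ | ⟨h9, hall⟩
    · rw [if_neg (fun h => by have := heq.1 h; omega)]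
      refine .inr ⟨fun ht => ?_, by rw [Cmd.exec, hfa]; exact hH⟩
      have hb' := (hiff ⟨_, hlt⟩).1 hb
      exact absurd (ht.2 _ hb'.1 hb'.2.1) (not_le.2 hb'.2.2)
    · rw [if_pos (heq.2 h9)]
      have hfin := hn.2.1.1
      rw [Fintype.card_fin] at hfin
      obtain ⟨u, hu, h9'⟩ := exec_find_pred h₁ hy₁ hz₁ (by decide) hn.1 hfin
      refine .inl ⟨⟨hn, fun y' hy' hd => ?_⟩, u, hu, ?_⟩
      · by_contra hlt
        exact hall y' y'.isLt ((hiff y').2 ⟨hy', hd, not_le.1 hlt⟩)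
      · refine exec_addEdge (σ := (Cmd.find 9 8 (predExpr (.reg 8) (.reg 7))).exec σ₁) ?_ h9' ?_
          (cut_adj.1 hu.1).1.ne
        · rw [Cmd.exec_arr (by decide), hfa]; exact hH
        · rw [Cmd.exec_reg (by decide), hz₁]
  · rw [if_neg (mt hneed.1 hn)]
    exact .inr ⟨fun ht => hn ht.1, hH⟩

/-- The inner loop adds at most one edge per topmost failure, and `IsBFSParent.card_topmost_le`
allows `2 * K + 1` of these for each vertex. -/
theorem exec_addSmallDetours (hp : IsBFSParent G s par) {σ : Store} (h : Ready G s par K σ)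
    (hH : IsMatrix (σ.arr 1) H) (hle : H ≤ G) :
    ∃ H' : SimpleGraph (Fin n), IsMatrix ((addSmallDetours.exec σ).arr 1) H' ∧ H ≤ H' ∧ H' ≤ G ∧
      H'.edgeSet.ncard ≤ H.edgeSet.ncard + n * (2 * K + 1) ∧
      ∀ y z, Topmost G s par K y z → ∃ u, IsPred G s par y u z ∧ H'.Adj u z := by
  obtain ⟨τ, ⟨H', h₁, h₂, h₃, h₄, h₅⟩, -, he⟩ := Cmd.exec_loop (fun k τ =>
      ∃ H' : SimpleGraph (Fin n), IsMatrix (τ.arr 1) H' ∧ H ≤ H' ∧ H' ≤ G ∧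
      H'.edgeSet.ncard ≤ H.edgeSet.ncard + k * (2 * K + 1) ∧
      ∀ y z, z.val < k → Topmost G s par K y z → ∃ u, IsPred G s par y u z ∧ H'.Adj u z) 7
      (.loop 2 smallDetoursBody) σ
    ⟨H, hH, le_rfl, hle, by simp, fun _ _ hz => absurd hz (Nat.not_lt_zero _)⟩ (by
      rintro i hi τ hf ⟨H₁, h₁, h₂, h₃, h₄, h₅⟩
      rw [h.reg0] at hi
      have hτ : Ready G s par K (τ.setReg 7 i) := (h.of_frame hf (by decide)).setReg i (by decide)
      obtain ⟨τ', ⟨H₂, g₁, g₂, g₃, g₄, g₅⟩, -, he⟩ := Cmd.exec_loop (fun k τ' =>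
          ∃ H₂ : SimpleGraph (Fin n), IsMatrix (τ'.arr 1) H₂ ∧ H₁ ≤ H₂ ∧ H₂ ≤ G ∧
          H₂.edgeSet.ncard ≤ H₁.edgeSet.ncard +
            countBelow (fun y => Topmost G s par K y ⟨i, hi⟩) k ∧
          ∀ y, y.val < k → Topmost G s par K y ⟨i, hi⟩ →
            ∃ u, IsPred G s par y u ⟨i, hi⟩ ∧ H₂.Adj u ⟨i, hi⟩) 2
          smallDetoursBody (τ.setReg 7 i)
        ⟨H₁, h₁, le_rfl, h₃, by simp, fun _ hz => absurd hz (Nat.not_lt_zero _)⟩ (by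
          rintro j hj τ' hf' ⟨H₂, g₁, g₂, g₃, g₄, g₅⟩
          rw [hτ.reg0] at hj
          have hτ' : Ready G s par K (τ'.setReg 2 j) :=
            (hτ.of_frame hf' (by decide)).setReg j (by decide)
          have h7 : (τ'.setReg 2 j).reg 7 = i := by
            rw [Store.setReg_reg, if_neg (by decide), hf'.2 7 (by decide) (by decide)]; simp
          have hmono := countBelow_mono (fun y => Topmost G s par K y ⟨i, hi⟩) (Nat.le_succ j)
          rcases exec_smallDetoursBody hp hτ' (y := ⟨j, hj⟩) (z := ⟨i, hi⟩) (by simp) h7 g₁ with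
            ⟨ht, u, hu, hm⟩ | ⟨ht, hm⟩
          · have hadj := (cut_adj.1 hu.1).1
            refine ⟨_, hm, g₂.trans le_sup_left, sup_edge_le_of_adj g₃ hadj, ?_, fun y hy hty => ?_⟩
            · have e₁ := ncard_edgeSet_sup_edge_le H₂ u ⟨i, hi⟩
              have e₂ := countBelow_succ (fun y => Topmost G s par K y ⟨i, hi⟩) hj ht
              omega
            · by_cases hyj : y = ⟨j, hj⟩
              · subst hyj
                exact ⟨u, hu, sup_edge_adj H₂ hadj.ne⟩
              · have hyj' : y.val ≠ j := fun h => hyj (Fin.ext h)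
                obtain ⟨u', hu', ha⟩ := g₅ y (by omega) hty
                exact ⟨u', hu', .inl ha⟩
          · refine ⟨H₂, hm, g₂, g₃, by simp only [Nat.succ_eq_add_one] at hmono; omega,
              fun y hy hty => ?_⟩
            have hyj' : y.val ≠ j := by rintro rfl; exact ht hty
            exact g₅ y (by omega) hty)
      have hle' := (countBelow_le (fun y => Topmost G s par K y ⟨i, hi⟩)
        ((τ.setReg 7 i).reg 0)).trans (hp.card_topmost_le ⟨i, hi⟩)
      rw [hτ.reg0] at g₅
      refine ⟨H₂, by rw [he]; exact g₁, h₂.trans g₂, g₃, ?_, fun y z hz ht => ?_⟩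
      · rw [Nat.succ_mul]
        omega
      · by_cases hzi : z = ⟨i, hi⟩
        · subst hzi
          exact g₅ y y.isLt ht
        · have hzi' : z.val ≠ i := fun h => hzi (Fin.ext h)
          obtain ⟨u, hu, ha⟩ := h₅ y z (by omega) ht
          exact ⟨u, hu, g₂ ha⟩)
  rw [h.reg0] at h₄ h₅
  exact ⟨H', by rw [addSmallDetours, he]; exact h₁, h₂, h₃, h₄, fun y z => h₅ y z z.isLt⟩

/-- The unmarked neighbors of `c` outside of the tree. -/
def Free (G : SimpleGraph (Fin n)) (par : Fin n → Fin n) (mk : Fin n → ℕ) (c u : Fin n) : Prop :=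
  G.Adj c u ∧ par c ≠ u ∧ par u ≠ c ∧ mk u = 0

theorem holds_freeExpr {σ : Store} (h : Ready G s par K σ) {mk : Fin n → ℕ}
    (hmk : ∀ v : Fin n, σ.arr 5 0 v = mk v) {c u : Fin n} (hc : σ.reg 3 = c) (hu : σ.reg 8 = u) :
    freeExpr.Holds σ ↔ Free G par mk c u := by
  simp only [freeExpr, Expr.holds_and, Expr.holds_not, Expr.holds_eq, Expr.holds_read, Expr.eval,
    parExpr, hc, hu, h.mat.ne_zero_iff, h.parent, hmk, Fin.val_inj, Free, ne_eq]

/-- The test reads the current marks, yet the initial marks decide: a round changes at most the mark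
of the vertex it visits, so each vertex is tested before its own mark can change. -/
theorem exec_markCluster {σ : Store} (h : Ready G s par K σ) {mk : Fin n → ℕ}
    (hmk : ∀ v : Fin n, σ.arr 5 0 v = mk v) {c : Fin n} (hc : σ.reg 3 = c)
    (hH : IsMatrix (σ.arr 1) H) (hle : H ≤ G) :
    ∃ H' : SimpleGraph (Fin n), IsMatrix ((markCluster.exec σ).arr 1) H' ∧ H ≤ H' ∧ H' ≤ G ∧
      H'.edgeSet.ncard ≤ H.edgeSet.ncard + countBelow (Free G par mk c) n ∧
      (∀ v, Free G par mk c v → H'.Adj c v ∧ (markCluster.exec σ).arr 5 0 v = c + 1) ∧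
      (∀ v : Fin n, ¬ Free G par mk c v → (markCluster.exec σ).arr 5 0 v = mk v) ∧
      ∀ v, (markCluster.exec σ).arr 5 1 v = σ.arr 5 1 v := by
  obtain ⟨τ, ⟨H', h₁, h₂, h₃, h₄, h₅, h₆, h₇⟩, -, he⟩ := Cmd.exec_loop (fun k τ =>
      ∃ H' : SimpleGraph (Fin n), IsMatrix (τ.arr 1) H' ∧ H ≤ H' ∧ H' ≤ G ∧
      H'.edgeSet.ncard ≤ H.edgeSet.ncard + countBelow (Free G par mk c) k ∧
      (∀ v : Fin n, v.val < k → Free G par mk c v → H'.Adj c v ∧ τ.arr 5 0 v = c + 1) ∧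
      (∀ v : Fin n, k ≤ v.val ∨ ¬ Free G par mk c v → τ.arr 5 0 v = mk v) ∧
      ∀ v, τ.arr 5 1 v = σ.arr 5 1 v) 8
      (.ite freeExpr
        (.write 5 (.const 0) (.reg 8) (.add (.reg 3) (.const 1)) ;; addEdge 3 8) .skip) σ
    ⟨H, hH, le_rfl, hle, by simp, fun v hv => absurd hv (Nat.not_lt_zero _), fun v _ => hmk v,
      fun _ => rfl⟩ (by
      rintro i hi τ hf ⟨H₁, h₁, h₂, h₃, h₄, h₅, h₆, h₇⟩
      rw [h.reg0] at hi
      have hτ : Ready G s par K (τ.setReg 8 i) := (h.of_frame hf (by decide)).setReg i (by decide)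
      have hc' : (τ.setReg 8 i).reg 3 = c := by
        rw [Store.setReg_reg, if_neg (by decide), hf.2 3 (by decide) (by decide), hc]
      have hmono := countBelow_mono (Free G par mk c) (Nat.le_succ i)
      have hiff := holds_freeExpr hτ (mk := fun v : Fin n => τ.arr 5 0 v) (fun _ => rfl) hc'
        (u := ⟨i, hi⟩) (by simp)
      have hiff' : Free G par (fun v : Fin n => τ.arr 5 0 v) c ⟨i, hi⟩ ↔
          Free G par mk c ⟨i, hi⟩ := by
        simp only [Free, h₆ ⟨i, hi⟩ (.inl le_rfl)]
      rw [hiff'] at hiff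
      rw [Cmd.exec_ite]
      by_cases hfree : Free G par mk c ⟨i, hi⟩
      · rw [if_pos (hiff.2 hfree)]
        set τ₁ := (Cmd.write 5 (.const 0) (.reg 8) (.add (.reg 3) (.const 1))).exec
          (τ.setReg 8 i) with hτ₁
        have harr : ((Cmd.write 5 (.const 0) (.reg 8) (.add (.reg 3) (.const 1)) ;;
            addEdge 3 8).exec (τ.setReg 8 i)).arr 5 = τ₁.arr 5 := by
          rw [Cmd.exec, Cmd.exec_arr (by decide)]
        have hval : ∀ j k, τ₁.arr 5 j k = if j = 0 ∧ k = i then (c : ℕ) + 1 else τ.arr 5 j k := by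
          intro j k
          have hc'' : τ.reg 3 = c := by simpa using hc'
          simp [hτ₁, Cmd.exec, Expr.eval, hc'']
        have hm := exec_addEdge (σ := τ₁) (H := H₁) (x := 3) (z := 8) (u := c) (v := ⟨i, hi⟩)
          (by rw [hτ₁, Cmd.exec_arr (by decide)]; exact h₁) hc' (by simp [hτ₁, Cmd.exec])
          hfree.1.ne
        rw [harr]
        refine ⟨_, hm, h₂.trans le_sup_left, sup_edge_le_of_adj h₃ hfree.1, ?_, fun v hv hfv => ?_,
          fun v hv => ?_, fun v => ?_⟩
        · have e₁ := ncard_edgeSet_sup_edge_le H₁ c ⟨i, hi⟩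
          have e₂ := countBelow_succ (Free G par mk c) hi hfree
          omega
        · rw [hval]
          by_cases hvi : v = ⟨i, hi⟩
          · subst hvi
            exact ⟨sup_edge_adj H₁ hfree.1.ne, by simp⟩
          · have hvi' : v.val ≠ i := fun h => hvi (Fin.ext h)
            obtain ⟨g₁, g₂⟩ := h₅ v (by omega) hfv
            exact ⟨.inl g₁, by simpa [hvi'] using g₂⟩
        · have hvi' : v.val ≠ i := by
            rintro rfl
            rcases hv with hv | hv
            · omega
            · exact hv hfree
          rw [hval, if_neg (by simp [hvi'])]
          refine h₆ v (hv.imp (fun h => by omega) id)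
        · rw [hval, if_neg (by simp), h₇]
      · rw [if_neg (mt hiff.1 hfree)]
        refine ⟨H₁, h₁, h₂, h₃, by simp only [Nat.succ_eq_add_one] at hmono; omega,
          fun v hv hfv => ?_, fun v hv => ?_, h₇⟩
        · have hvi' : v.val ≠ i := by rintro rfl; exact hfree hfv
          exact h₅ v (by omega) hfv
        · refine h₆ v (hv.imp (fun h => by omega) id))
  rw [h.reg0] at h₄ h₅
  rw [markCluster, he]
  exact ⟨H', h₁, h₂, h₃, h₄, fun v => h₅ v v.isLt, fun v hv => h₆ v (.inr hv), h₇⟩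

/-- The clusters formed from the centers below `k`: the cluster of `v` is `mk v`, which is zero if
there is none and otherwise the center plus one. -/
structure IsClustering (G Hb H : SimpleGraph (Fin n)) (par : Fin n → Fin n) (K k : ℕ)
    (mk : Fin n → ℕ) (S : Finset (Fin n)) : Prop where
  base_le : Hb ≤ H
  le : H ≤ G
  ncard_le : H.edgeSet.ncard ≤ Hb.edgeSet.ncard + (Finset.univ.filter fun v => mk v ≠ 0).card
  card_mul_le : S.card * K ≤ (Finset.univ.filter fun v => mk v ≠ 0).card
  center : ∀ v, mk v ≠ 0 → ∃ c ∈ S, mk v = c + 1 ∧ H.Adj c v ∧ par c ≠ v ∧ par v ≠ c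
  free_le : ∀ c : Fin n, c.val < k → countBelow (Free G par mk c) n ≤ K

/-- Each new center marks at least `K` fresh vertices, which bounds the number of centers, and each
star edge is charged to the vertex it marks. A processed vertex is left with at most `K` free
neighbors, and later marks only decrease their number. -/
theorem exec_addClusters {σ : Store} (h : Ready G s par K σ) (hH : IsMatrix (σ.arr 1) H)
    (hle : H ≤ G) (h5 : ∀ i j, σ.arr 5 i j = 0) :
    ∃ (H' : SimpleGraph (Fin n)) (mk : Fin n → ℕ) (S : Finset (Fin n)),
      IsMatrix ((addClusters.exec σ).arr 1) H' ∧ IsClustering G H H' par K n mk S ∧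
      (∀ v : Fin n, (addClusters.exec σ).arr 5 0 v = mk v) ∧
      ∀ c : Fin n, (addClusters.exec σ).arr 5 1 c ≠ 0 ↔ c ∈ S := by
  obtain ⟨τ, ⟨H', mk, S, h₁, h₂, h₃, h₄⟩, -, he⟩ := Cmd.exec_loop (fun k τ =>
      ∃ (H' : SimpleGraph (Fin n)) (mk : Fin n → ℕ) (S : Finset (Fin n)),
      IsMatrix (τ.arr 1) H' ∧ IsClustering G H H' par K k mk S ∧
      (∀ v : Fin n, τ.arr 5 0 v = mk v) ∧ ∀ c : Fin n, τ.arr 5 1 c ≠ 0 ↔ c ∈ S) 3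
      (.count 11 8 freeExpr ;;
        .ite (Expr.lt (.reg 11) (.reg 5)).not
          (.write 5 (.const 1) (.reg 3) (.const 1) ;; markCluster) .skip) σ
    ⟨H, fun _ => 0, ∅, hH, ⟨le_rfl, hle, by simp, by simp, by simp,
      fun c hc => absurd hc (Nat.not_lt_zero _)⟩, fun v => h5 0 v, fun c => by simp [h5]⟩ (by
      rintro i hi τ hf ⟨H₁, mk, S, h₁, hcl, h₃, h₄⟩
      rw [h.reg0] at hi
      have hτ : Ready G s par K (τ.setReg 3 i) := (h.of_frame hf (by decide)).setReg i (by decide)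
      obtain ⟨hca, hcr, hcount⟩ := Cmd.exec_count (r := 11) (x := 8) (b := freeExpr) (by decide)
        (by decide) (by decide) (τ.setReg 3 i)
      set τ₁ := (Cmd.count 11 8 freeExpr).exec (τ.setReg 3 i) with hτ₁
      have hr₁ : Ready G s par K τ₁ := hτ.exec (by decide)
      have h3₁ : τ₁.reg 3 = i := by rw [hcr 3 (by decide) (by decide)]; simp
      have hcount' : τ₁.reg 11 = countBelow (Free G par mk ⟨i, hi⟩) n := by
        classical
        rw [hcount, hτ.reg0, countBelow]
        symm
        refine Finset.card_bij (fun u _ => u.val) ?_ (fun a _ b _ hab => Fin.ext hab) ?_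
        · intro u hu
          obtain ⟨hun, hfu⟩ := (Finset.mem_filter.1 hu).2
          exact Finset.mem_filter.2 ⟨Finset.mem_range.2 hun, (holds_freeExpr
            (hτ.setReg u (by decide)) (mk := mk) (c := ⟨i, hi⟩) h₃ (by simp) (by simp)).2 hfu⟩
        · intro u hu
          obtain ⟨hun, hfu⟩ := Finset.mem_filter.1 hu
          rw [Finset.mem_range] at hun
          exact ⟨⟨u, hun⟩, Finset.mem_filter.2 ⟨Finset.mem_univ _, hun, (holds_freeExpr
            (hτ.setReg u (by decide)) (mk := mk) (c := ⟨i, hi⟩) (u := ⟨u, hun⟩) h₃ (by simp)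
            (by simp)).1 hfu⟩, rfl⟩
      have hexec : (Cmd.count 11 8 freeExpr ;;
          .ite (Expr.lt (.reg 11) (.reg 5)).not
            (.write 5 (.const 1) (.reg 3) (.const 1) ;; markCluster) .skip).exec (τ.setReg 3 i) =
          (Cmd.ite (Expr.lt (.reg 11) (.reg 5)).not
            (.write 5 (.const 1) (.reg 3) (.const 1) ;; markCluster) .skip).exec τ₁ := rfl
      rw [hexec, Cmd.exec_ite]
      have hiff : (Expr.lt (.reg 11) (.reg 5)).not.Holds τ₁ ↔
          K ≤ countBelow (Free G par mk ⟨i, hi⟩) n := by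
        rw [Expr.holds_not, Expr.holds_lt, Expr.eval, Expr.eval, hr₁.reg5, hcount', not_lt]
      by_cases hK : K ≤ countBelow (Free G par mk ⟨i, hi⟩) n
      · rw [if_pos (hiff.2 hK)]
        set τ₂ := (Cmd.write 5 (.const 1) (.reg 3) (.const 1)).exec τ₁ with hτ₂
        have hr₂ : Ready G s par K τ₂ := hr₁.exec (by decide)
        have hval : ∀ j k, τ₂.arr 5 j k = if j = 1 ∧ k = i then 1 else τ.arr 5 j k := by
          intro j k
          simp [hτ₂, Cmd.exec, Expr.eval, h3₁, hca]
        obtain ⟨H₂, g₁, g₂, g₃, g₄, g₅, g₆, g₇⟩ := exec_markCluster hr₂ (mk := mk)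
          (fun v => by rw [hval, if_neg (by simp), h₃]) (c := ⟨i, hi⟩) (H := H₁)
          h3₁ (by rw [hτ₂, Cmd.exec_arr (by decide), hca]; exact h₁) hcl.le
        have hexec₂ : (Cmd.write 5 (.const 1) (.reg 3) (.const 1) ;; markCluster).exec τ₁ =
          markCluster.exec τ₂ := rfl
        rw [hexec₂]
        classical
        set mk' : Fin n → ℕ := fun v => (markCluster.exec τ₂).arr 5 0 v with hmk'
        have hmk0 : ∀ v, mk' v ≠ 0 ↔ mk v ≠ 0 ∨ Free G par mk ⟨i, hi⟩ v := by
          intro v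
          by_cases hfv : Free G par mk ⟨i, hi⟩ v
          · simp only [hmk', (g₅ v hfv).2, hfv]; simp
          · simp only [hmk', g₆ v hfv, hfv, or_false]
        -- Free vertices are unmarked, so the new cluster is disjoint from the vertices marked
        -- earlier.
        have hcard : (Finset.univ.filter fun v => mk v ≠ 0).card +
            countBelow (Free G par mk ⟨i, hi⟩) n ≤
            (Finset.univ.filter fun v => mk' v ≠ 0).card := by
          rw [countBelow, ← Finset.card_union_of_disjoint]
          · refine Finset.card_le_card fun v hv => Finset.mem_filter.2 ⟨Finset.mem_univ _, ?_⟩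
            rw [hmk0]
            rcases Finset.mem_union.1 hv with h | h
            · exact .inl (Finset.mem_filter.1 h).2
            · exact .inr (Finset.mem_filter.1 h).2.2
          · refine Finset.disjoint_left.2 fun v hv hv' => (Finset.mem_filter.1 hv).2 ?_
            exact (Finset.mem_filter.1 hv').2.2.2.2.2
        refine ⟨H₂, mk', insert ⟨i, hi⟩ S, g₁, ⟨hcl.base_le.trans g₂, g₃, ?_, ?_, ?_, ?_⟩,
          fun v => rfl, fun c => ?_⟩
        · have := hcl.ncard_le
          omega
        · have e₁ := hcl.card_mul_le
          have e₂ := Nat.mul_le_mul_right K (Finset.card_insert_le (⟨i, hi⟩ : Fin n) S)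
          rw [Nat.succ_mul] at e₂
          omega
        · intro v hv
          by_cases hfv : Free G par mk ⟨i, hi⟩ v
          · exact ⟨⟨i, hi⟩, Finset.mem_insert_self _ _, (g₅ v hfv).2, (g₅ v hfv).1, hfv.2.1,
              hfv.2.2.1⟩
          · obtain ⟨c, hc, e₁, e₂, e₃⟩ := hcl.center v (((hmk0 v).1 hv).resolve_right hfv)
            exact ⟨c, Finset.mem_insert_of_mem hc, (g₆ v hfv).trans e₁, g₂ e₂, e₃⟩
        · intro c hc
          have hzero : ∀ v, mk' v = 0 → mk v = 0 ∧ ¬ Free G par mk ⟨i, hi⟩ v := by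
            intro v hv
            have := (hmk0 v).not.1 (not_not.2 hv)
            tauto
          -- All free neighbors of the new center have just been marked, so none remain. For earlier
          -- vertices the free neighbors form a subset of the previous ones.
          by_cases hci : c = ⟨i, hi⟩
          · subst hci
            refine le_trans (le_of_eq ?_) (Nat.zero_le K)
            rw [countBelow, Finset.card_eq_zero, Finset.filter_eq_empty_iff]
            rintro v - ⟨-, hv⟩
            obtain ⟨e₁, e₂⟩ := hzero v hv.2.2.2
            exact e₂ ⟨hv.1, hv.2.1, hv.2.2.1, e₁⟩
          · have hci' : c.val ≠ i := fun h => hci (Fin.ext h)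
            refine le_trans (Finset.card_le_card ?_) (hcl.free_le c (by omega))
            intro v hv
            obtain ⟨e₁, e₂⟩ := (Finset.mem_filter.1 hv).2
            exact Finset.mem_filter.2 ⟨Finset.mem_univ _, e₁, e₂.1, e₂.2.1, e₂.2.2.1,
              (hzero v e₂.2.2.2).1⟩
        · rw [g₇, hval, Finset.mem_insert, ← h₄ c]
          by_cases hci : c = ⟨i, hi⟩
          · subst hci
            simp
          · have hci' : c.val ≠ i := fun h => hci (Fin.ext h)
            simp [hci, hci']
      · rw [if_neg (mt hiff.1 hK)]
        refine ⟨H₁, mk, S, by rw [Cmd.exec, hca]; exact h₁, ⟨hcl.base_le, hcl.le, hcl.ncard_le,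
          hcl.card_mul_le, hcl.center, fun c hc => ?_⟩, fun v => by rw [Cmd.exec, hca]; exact h₃ v,
          fun c => by rw [Cmd.exec, hca]; exact h₄ c⟩
        by_cases hci : c = ⟨i, hi⟩
        · subst hci
          exact (not_le.1 hK).le
        · have hci' : c.val ≠ i := fun h => hci (Fin.ext h)
          exact hcl.free_le c (by omega))
  rw [h.reg0] at h₂
  rw [addClusters, he]
  exact ⟨H', mk, S, h₁, h₂, h₃, h₄⟩

/-- Marks no longer change, so at most `K` edges are added per vertex. -/
theorem exec_addSparse {σ : Store} (h : Ready G s par K σ) (hH : IsMatrix (σ.arr 1) H)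
    (hle : H ≤ G) {mk : Fin n → ℕ} (hmk : ∀ v : Fin n, σ.arr 5 0 v = mk v)
    (hfree : ∀ c, countBelow (Free G par mk c) n ≤ K) :
    ∃ H' : SimpleGraph (Fin n), IsMatrix ((addSparse.exec σ).arr 1) H' ∧ H ≤ H' ∧ H' ≤ G ∧
      H'.edgeSet.ncard ≤ H.edgeSet.ncard + n * K ∧
      ∀ c u, Free G par mk c u → H'.Adj c u := by
  obtain ⟨τ, ⟨H', h₁, h₂, h₃, h₄, h₅⟩, -, he⟩ := Cmd.exec_loop (fun k τ =>
      ∃ H' : SimpleGraph (Fin n), IsMatrix (τ.arr 1) H' ∧ H ≤ H' ∧ H' ≤ G ∧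
      H'.edgeSet.ncard ≤ H.edgeSet.ncard + k * K ∧
      ∀ c u : Fin n, c.val < k → Free G par mk c u → H'.Adj c u) 3
      (.loop 8 (.ite freeExpr (addEdge 3 8) .skip)) σ
    ⟨H, hH, le_rfl, hle, by simp, fun _ _ hz => absurd hz (Nat.not_lt_zero _)⟩ (by
      rintro i hi τ hf ⟨H₁, h₁, h₂, h₃, h₄, h₅⟩
      rw [h.reg0] at hi
      have hτ : Ready G s par K (τ.setReg 3 i) := (h.of_frame hf (by decide)).setReg i (by decide)
      have hmk' : ∀ v : Fin n, τ.arr 5 0 v = mk v := by rw [hf.1 5 (by decide)]; exact hmk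
      obtain ⟨τ', ⟨H₂, g₁, g₂, g₃, g₄, g₅⟩, -, he⟩ := Cmd.exec_loop (fun k τ' =>
          ∃ H₂ : SimpleGraph (Fin n), IsMatrix (τ'.arr 1) H₂ ∧ H₁ ≤ H₂ ∧ H₂ ≤ G ∧
          H₂.edgeSet.ncard ≤ H₁.edgeSet.ncard + countBelow (Free G par mk ⟨i, hi⟩) k ∧
          ∀ u : Fin n, u.val < k → Free G par mk ⟨i, hi⟩ u → H₂.Adj ⟨i, hi⟩ u) 8
          (.ite freeExpr (addEdge 3 8) .skip) (τ.setReg 3 i)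
        ⟨H₁, h₁, le_rfl, h₃, by simp, fun _ hz => absurd hz (Nat.not_lt_zero _)⟩ (by
          rintro j hj τ' hf' ⟨H₂, g₁, g₂, g₃, g₄, g₅⟩
          rw [hτ.reg0] at hj
          have hτ' : Ready G s par K (τ'.setReg 8 j) :=
            (hτ.of_frame hf' (by decide)).setReg j (by decide)
          have h3 : (τ'.setReg 8 j).reg 3 = i := by
            rw [Store.setReg_reg, if_neg (by decide), hf'.2 3 (by decide) (by decide)]; simp
          have hiff := holds_freeExpr hτ' (mk := mk)
            (by rw [Store.setReg_arr, hf'.1 5 (by decide)]; exact hmk') (c := ⟨i, hi⟩)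
            (u := ⟨j, hj⟩) h3 (by simp)
          have hmono := countBelow_mono (Free G par mk ⟨i, hi⟩) (Nat.le_succ j)
          rw [Cmd.exec_ite]
          by_cases hfr : Free G par mk ⟨i, hi⟩ ⟨j, hj⟩
          · rw [if_pos (hiff.2 hfr)]
            refine ⟨_, exec_addEdge (σ := τ'.setReg 8 j) (u := ⟨i, hi⟩) (v := ⟨j, hj⟩) g₁ h3 (by simp) hfr.1.ne,
              g₂.trans le_sup_left, sup_edge_le_of_adj g₃ hfr.1, ?_, fun u hu hfu => ?_⟩
            · have e₁ := ncard_edgeSet_sup_edge_le H₂ ⟨i, hi⟩ ⟨j, hj⟩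
              have e₂ := countBelow_succ (Free G par mk ⟨i, hi⟩) hj hfr
              omega
            · by_cases huj : u = ⟨j, hj⟩
              · subst huj
                exact sup_edge_adj H₂ hfr.1.ne
              · have huj' : u.val ≠ j := fun h => huj (Fin.ext h)
                exact .inl (g₅ u (by omega) hfu)
          · rw [if_neg (mt hiff.1 hfr)]
            refine ⟨H₂, g₁, g₂, g₃, by simp only [Nat.succ_eq_add_one] at hmono; omega,
              fun u hu hfu => ?_⟩
            have huj' : u.val ≠ j := by rintro rfl; exact hfr hfu
            exact g₅ u (by omega) hfu)
      rw [hτ.reg0] at g₄ g₅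
      refine ⟨H₂, by rw [he]; exact g₁, h₂.trans g₂, g₃, ?_, fun c u hc hfu => ?_⟩
      · have := hfree ⟨i, hi⟩
        rw [Nat.succ_mul]
        omega
      · by_cases hci : c = ⟨i, hi⟩
        · subst hci
          exact g₅ u u.isLt hfu
        · have hci' : c.val ≠ i := fun h => hci (Fin.ext h)
          exact g₂ (h₅ c u (by omega) hfu))
  rw [h.reg0] at h₄ h₅
  exact ⟨H', by rw [addSparse, he]; exact h₁, h₂, h₃, h₄, fun c u => h₅ c u c.isLt⟩

/-- The computation of the skeleton. -/
def buildSkeleton : Cmd := addTree ;; addSmallDetours ;; addClusters ;; addSparse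

theorem exec_buildSkeleton (hp : IsBFSParent G s par) {σ : Store} (h : Ready G s par K σ)
    (h1 : ∀ i j, σ.arr 1 i j = 0) (h5 : ∀ i j, σ.arr 5 i j = 0) :
    ∃ (H : SimpleGraph (Fin n)) (S : Finset (Fin n)) (marked : Fin n → Prop)
      (cl : Fin n → Fin n), IsMatrix ((buildSkeleton.exec σ).arr 1) H ∧
      IsSkeleton G H s par K S marked cl ∧ H.edgeSet.ncard ≤ n * (3 * K + 3) ∧ S.card * K ≤ n ∧
      ∀ c : Fin n, (buildSkeleton.exec σ).arr 5 1 c ≠ 0 ↔ c ∈ S := by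
  obtain ⟨H₁, hm₁, hle₁, hcard₁, hT⟩ := exec_addTree hp h h1
  set σ₁ := addTree.exec σ with hσ₁
  have hr₁ : Ready G s par K σ₁ := h.exec (by decide)
  obtain ⟨H₂, hm₂, hle₁₂, hle₂, hcard₂, hpred⟩ := exec_addSmallDetours hp hr₁ hm₁ hle₁
  set σ₂ := addSmallDetours.exec σ₁ with hσ₂
  have hr₂ : Ready G s par K σ₂ := hr₁.exec (by decide)
  obtain ⟨H₃, mk, S, hm₃, hcl, hmk, hS⟩ := exec_addClusters hr₂ hm₂ hle₂ (by
    rw [hσ₂, Cmd.exec_arr (by decide), hσ₁, Cmd.exec_arr (by decide)]; exact h5)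
  set σ₃ := addClusters.exec σ₂ with hσ₃
  have hr₃ : Ready G s par K σ₃ := hr₂.exec (by decide)
  obtain ⟨H₄, hm₄, hle₃₄, hle₄, hcard₄, hfree⟩ := exec_addSparse hr₃ hm₃ hcl.le hmk
    (fun c => hcl.free_le c c.isLt)
  have hexec : buildSkeleton.exec σ = addSparse.exec σ₃ := rfl
  have hmarked : (Finset.univ.filter fun v => mk v ≠ 0).card ≤ n :=
    (Finset.card_le_univ _).trans (Fintype.card_fin n).le
  have hT₄ : ContainsTree par H₄ := fun v hv => hle₃₄ (hcl.base_le (hle₁₂ (hT v hv)))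
  choose cl hcl' using fun v => (by
    by_cases hv : mk v ≠ 0
    · obtain ⟨c, hc⟩ := hcl.center v hv
      exact ⟨c, fun _ => hc⟩
    · exact ⟨v, fun h => absurd h hv⟩ :
      ∃ c, mk v ≠ 0 → c ∈ S ∧ mk v = c + 1 ∧ H₃.Adj c v ∧ par c ≠ v ∧ par v ≠ c)
  refine ⟨H₄, S, fun v => mk v ≠ 0, cl, hexec ▸ hm₄, ⟨hle₄, hT₄, fun y z hn => ?_,
    fun z hz => (hcl' z hz).1, fun z hz => hle₃₄ (hcl' z hz).2.2.1, fun z hz y he => ?_,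
    fun u v hG hH hv => ?_⟩, ?_, hcl.card_mul_le.trans hmarked, fun c => ?_⟩
  · refine hp.tdist_cut_le_of_near hT₄ (fun y z ht => ?_) hn
    obtain ⟨u, hu, ha⟩ := hpred y z ht
    exact ⟨u, hu, hle₃₄ (hcl.base_le ha)⟩
  · rcases Sym2.eq_iff.1 he with ⟨e₁, e₂⟩ | ⟨e₁, e₂⟩
    · exact (hcl' z hz).2.2.2.2 (by rw [e₁, e₂])
    · exact (hcl' z hz).2.2.2.1 (by rw [e₁, e₂])
  -- A missing edge `uv` is not a tree edge; if `v` were unmarked, `v` would be a free neighbor of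
  -- `u`, and the edge would have been added.
  · refine hH (hfree u v ⟨hG, fun he => ?_, fun he => ?_, hv⟩)
    · have := hT₄ u (by rw [he]; exact hG.ne.symm)
      rw [he] at this
      exact hH this.symm
    · have := hT₄ v (by rw [he]; exact hG.ne)
      rw [he] at this
      exact hH this
  · have := hcl.ncard_le
    -- The summands count the tree, the last edges of small detours, the stars and the edges at
    -- unmarked vertices.
    calc H₄.edgeSet.ncard ≤ n + n * (2 * K + 1) + n + n * K := by omega
      _ = n * (3 * K + 3) := by ring
  · rw [hexec, Cmd.exec_arr (by decide)]
    exact hS c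

end Skeleton

/-! ### Path buying -/

/-- Add the last missing edge of the current path and go to its other end. -/
def walkBody : Cmd :=
  .ite (Expr.eq (.read 4 (.reg 2) (.reg 10)) (.read 2 (.reg 2) (.reg 10))).not
    (.find 9 8 (predExpr (.reg 8) (.reg 10)) ;; addEdge 9 10 ;; .assign 10 (.reg 9)) .skip

/-- Add the end of a shortest path to the vertex in register `3`, from the last vertex that is
reached in the structure by a shortest path on. -/
def walk : Cmd := .assign 10 (.reg 3) ;; .loop 6 walkBody

/-- Repair the distance to the center in register `3` if it is too large. -/
def repairCenter : Cmd :=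
  bfs 1 4 ;;
    .ite (.lt (.add (.read 2 (.reg 2) (.reg 3)) (.const 2)) (.read 4 (.reg 2) (.reg 3))) walk .skip

/-- Repair the distances to all centers after all failures. -/
def buyPaths : Cmd :=
  .loop 2 (.loop 3 (.ite (.read 5 (.const 1) (.reg 3)) repairCenter .skip))

section Buying

variable {n : ℕ} {G H H' H'' : SimpleGraph (Fin n)} {s : Fin n} {par : Fin n → Fin n} {K : ℕ}
  {S : Finset (Fin n)} {marked : Fin n → Prop} {cl : Fin n → Fin n}

/-- `H'` arises from `H` by adding the last `m` edges of a shortest path to `c` that avoids the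
edge above `y`; its vertices are listed by `x`, beginning with `c`. -/
structure IsTrace (G H H' : SimpleGraph (Fin n)) (s : Fin n) (par : Fin n → Fin n) (y c : Fin n)
    (x : ℕ → Fin n) (m : ℕ) : Prop where
  start : x 0 = c
  ne : ∀ j < m, tdist (cut H par y) s (x j) ≠ tdist (cut G par y) s (x j)
  pred : ∀ j < m, IsPred G s par y (x (j + 1)) (x j)
  base_le : H ≤ H'
  le : H' ≤ G
  adj : ∀ j < m, H'.Adj (x (j + 1)) (x j)
  edge : ∀ e ∈ H'.edgeSet, e ∈ H.edgeSet ∨ ∃ j < m, e = s(x (j + 1), x j)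

theorem IsTrace.dist {y c : Fin n} {x : ℕ → Fin n} {m : ℕ} (h : IsTrace G H H' s par y c x m) :
    tdist (cut G par y) s (x m) + m = tdist (cut G par y) s c := by
  have key : ∀ i ≤ m, tdist (cut G par y) s (x i) + i = tdist (cut G par y) s c := by
    intro i hi
    induction i with
    | zero => rw [h.start, add_zero]
    | succ i ih =>
      have := (h.pred i hi).2
      have := ih (by omega)
      omega
  exact key m le_rfl

/-- After the whole path has been added, its end is reached by a shortest path. -/
theorem IsTrace.tdist_le {y c : Fin n} {x : ℕ → Fin n} {m : ℕ}
    (h : IsTrace G H H' s par y c x m)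
    (hend : tdist (cut H par y) s (x m) = tdist (cut G par y) s (x m)) :
    tdist (cut H' par y) s c ≤ tdist (cut G par y) s c := by
  have key : ∀ i ≤ m, tdist (cut H' par y) s (x (m - i)) ≤ tdist (cut G par y) s (x (m - i)) := by
    intro i hi
    induction i with
    | zero => exact (tdist_anti (cut_mono h.base_le y) s _).trans hend.le
    | succ i ih =>
      obtain ⟨j, rfl⟩ : ∃ j, m = j + (i + 1) := ⟨m - (i + 1), by omega⟩
      have h₁ := ih (by omega)
      have e₁ : j + (i + 1) - i = j + 1 := by omega
      rw [e₁] at h₁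
      rw [Nat.add_sub_cancel]
      have h₂ := h.pred j (by omega)
      have h₃ : (cut H' par y).Adj (x (j + 1)) (x j) :=
        cut_adj.2 ⟨h.adj j (by omega), (cut_adj.1 h₂.1).2⟩
      have := tdist_le_add_one s h₃
      have := h₂.2
      omega
  have := key m le_rfl
  rwa [Nat.sub_self, h.start] at this

theorem IsTrace.extend {y c u : Fin n} {x : ℕ → Fin n} {m : ℕ}
    (h : IsTrace G H H' s par y c x m)
    (hne : tdist (cut H par y) s (x m) ≠ tdist (cut G par y) s (x m))
    (hu : IsPred G s par y u (x m)) :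
    IsTrace G H (H' ⊔ SimpleGraph.edge u (x m)) s par y c (fun j => if j ≤ m then x j else u)
      (m + 1) := by
  have hG := (cut_adj.1 hu.1).1
  have hlt : ∀ j < m + 1, ((if j + 1 ≤ m then x (j + 1) else u) = x (j + 1) ∧ j < m) ∨
      ((if j + 1 ≤ m then x (j + 1) else u) = u ∧ j = m) := by
    intro j hj
    by_cases hjm : j + 1 ≤ m
    · exact .inl ⟨if_pos hjm, hjm⟩
    · exact .inr ⟨if_neg hjm, by omega⟩
  refine ⟨by simp [h.start], fun j hj => ?_, fun j hj => ?_, h.base_le.trans le_sup_left,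
    sup_edge_le_of_adj h.le hG, fun j hj => ?_, fun e he => ?_⟩
  · rw [if_pos (by omega)]
    rcases Nat.lt_succ_iff_lt_or_eq.1 hj with hj | rfl
    · exact h.ne j hj
    · exact hne
  · simp only [if_pos (Nat.lt_succ_iff.1 hj)]
    rcases hlt j hj with ⟨e, hj⟩ | ⟨e, rfl⟩
    · rw [e]; exact h.pred j hj
    · rw [e]; exact hu
  · simp only [if_pos (Nat.lt_succ_iff.1 hj)]
    rcases hlt j hj with ⟨e, hj⟩ | ⟨e, rfl⟩
    · rw [e]; exact .inl (h.adj j hj)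
    · rw [e]; exact sup_edge_adj H' hG.ne
  · have he' : e ∈ H'.edgeSet ∨ e = s(u, x m) := by
      induction e with
      | _ a b =>
        rw [mem_edgeSet, sup_adj, edge_adj] at he
        rcases he with he | ⟨he, -⟩
        · exact .inl he
        · exact .inr (by rw [Sym2.eq_iff]; tauto)
    rcases he' with he' | rfl
    · rcases h.edge e he' with he' | ⟨j, hj, rfl⟩
      · exact .inl he'
      · exact .inr ⟨j, by omega, by rw [if_pos (by omega), if_pos (by omega)]⟩
    · exact .inr ⟨m, by omega, by rw [if_neg (by omega), if_pos le_rfl]⟩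

/-- Array `4` is not recomputed while edges are added, so every comparison refers to the initial
graph `H`, as `IsTrace` requires. The walk goes down in replacement distance until the distances in
`H` and `G` agree. -/
theorem exec_walk {σ : Store} (h : Ready G s par K σ) {y c : Fin n} (hy : σ.reg 2 = y)
    (hc : σ.reg 3 = c) (hH : IsMatrix (σ.arr 1) H) (hle : H ≤ G)
    (hD : ∀ v : Fin n, σ.arr 4 y v = tdist (cut H par y) s v)
    (hfin : tdist (cut G par y) s c < n + 4) :
    ∃ (H' : SimpleGraph (Fin n)) (x : ℕ → Fin n) (m : ℕ),
      IsMatrix ((walk.exec σ).arr 1) H' ∧ IsTrace G H H' s par y c x m ∧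
      tdist (cut H par y) s (x m) = tdist (cut G par y) s (x m) := by
  set σ₁ := (Cmd.assign 10 (.reg 3)).exec σ with hσ₁
  have hr₁ : Ready G s par K σ₁ := h.exec (by decide)
  have hy₁ : σ₁.reg 2 = y := by rw [hσ₁, Cmd.exec_reg (by decide), hy]
  obtain ⟨τ, ⟨H', x, m, h₁, h₂, -, h₄⟩, -, he⟩ := Cmd.exec_loop (fun k τ =>
      ∃ (H' : SimpleGraph (Fin n)) (x : ℕ → Fin n) (m : ℕ), IsMatrix (τ.arr 1) H' ∧
        IsTrace G H H' s par y c x m ∧ τ.reg 10 = x m ∧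
        (m = k ∨ tdist (cut H par y) s (x m) = tdist (cut G par y) s (x m))) 6 walkBody σ₁
    ⟨H, fun _ => c, 0, hH, ⟨rfl, fun _ hj => absurd hj (Nat.not_lt_zero _),
      fun _ hj => absurd hj (Nat.not_lt_zero _), le_rfl, hle,
      fun _ hj => absurd hj (Nat.not_lt_zero _), fun _ he => .inl he⟩,
      by simp [hσ₁, Cmd.exec, Expr.eval, hc], .inl rfl⟩ (by
      rintro i hi τ hf ⟨H', x, m, h₁, h₂, h₃, h₄⟩
      have hτ : Ready G s par K (τ.setReg 6 i) := (hr₁.of_frame hf (by decide)).setReg i (by decide)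
      have hyτ : (τ.setReg 6 i).reg 2 = y := by
        rw [Store.setReg_reg, if_neg (by decide), hf.2 2 (by decide) (by decide), hy₁]
      have hxτ : (τ.setReg 6 i).reg 10 = x m := by simpa using h₃
      have hDτ : ∀ v : Fin n, (τ.setReg 6 i).arr 4 y v = tdist (cut H par y) s v := by
        rw [Store.setReg_arr, hf.1 4 (by decide), hσ₁, Cmd.exec_arr (by decide)]; exact hD
      have hiff : (Expr.eq (.read 4 (.reg 2) (.reg 10)) (.read 2 (.reg 2) (.reg 10))).not.Holds
          (τ.setReg 6 i) ↔ tdist (cut H par y) s (x m) ≠ tdist (cut G par y) s (x m) := by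
        simp only [Expr.holds_not, Expr.holds_eq, Expr.eval, hyτ, hxτ, hDτ, hτ.dist, ne_eq]
      rw [walkBody, Cmd.exec_ite]
      by_cases hne : tdist (cut H par y) s (x m) ≠ tdist (cut G par y) s (x m)
      · rw [if_pos (hiff.2 hne)]
        have hxs : x m ≠ s := by
          intro h
          rw [h, tdist_self, tdist_self] at hne
          exact hne rfl
        have hdist := h₂.dist
        obtain ⟨u, hu, h9⟩ := exec_find_pred hτ hyτ hxτ (by decide) hxs (by omega)
        set τ₁ := (Cmd.find 9 8 (predExpr (.reg 8) (.reg 10))).exec (τ.setReg 6 i) with hτ₁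
        have h10 : τ₁.reg 10 = x m := by rw [hτ₁, Cmd.exec_reg (by decide), hxτ]
        have hm := exec_addEdge (σ := τ₁) (H := H') (by
          rw [hτ₁, Cmd.exec_arr (by decide)]; exact h₁) h9 h10 (cut_adj.1 hu.1).1.ne
        refine ⟨_, _, m + 1, hm, h₂.extend hne hu, ?_, ?_⟩
        · rw [if_neg (by omega)]
          exact h9
        · exact .inl (by rw [h₄.resolve_right hne])
      · rw [if_neg (mt hiff.1 hne)]
        exact ⟨H', x, m, h₁, h₂, hxτ, .inr (not_not.1 hne)⟩)
  refine ⟨H', x, m, ?_, h₂, h₄.resolve_left fun hm => ?_⟩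
  · change IsMatrix (((Cmd.loop 6 walkBody).exec σ₁).arr 1) H'
    rw [he]
    exact h₁
  -- The replacement distance of `c` is finite and therefore below `n`, while each of `n` steps
  -- would have lowered it by one. So `n` rounds suffice for the walk to stop.
  · have h₅ := h₂.dist
    have h₆ := tdist_lt_card (G := cut G par y) (u := s) (v := c)
      (by rw [Fintype.card_fin]; exact hfin)
    rw [Fintype.card_fin] at h₆
    rw [hr₁.reg0] at hm
    omega

/-- `H'` is obtained from `H` by adding edges that the potential pays for. -/
structure IsPurchase (G H H' : SimpleGraph (Fin n)) (K : ℕ) (S : Finset (Fin n)) : Prop where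
  base_le : H ≤ H'
  le : H' ≤ G
  cost_le : K * H'.edgeSet.ncard + 3 * potential G K S H' ≤
    K * H.edgeSet.ncard + 3 * potential G K S H

theorem IsPurchase.trans (h : IsPurchase G H H' K S) (h' : IsPurchase G H' H'' K S) :
    IsPurchase G H H'' K S :=
  ⟨h.base_le.trans h'.base_le, h'.le, h'.cost_le.trans h.cost_le⟩

theorem exec_repairCenter (hp : IsBFSParent G s par) (hK : 1 ≤ K) {σ : Store}
    (h : Ready G s par K σ) {y c : Fin n} (hy : σ.reg 2 = y) (hc : σ.reg 3 = c)
    (hH : IsMatrix (σ.arr 1) H) (hsk : IsSkeleton G H s par K S marked cl) (hcS : c ∈ S) :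
    ∃ H', IsMatrix ((repairCenter.exec σ).arr 1) H' ∧ IsPurchase G H H' K S ∧
      tdist (cut H' par y) s c ≤ tdist (cut G par y) s c + 2 := by
  have hD := exec_bfs (a := 1) (d := 4) (by decide) (by decide)
    ⟨h.reg0, h.reg1, hy, h.reg4, hH, h.parent⟩
  set σ₁ := (bfs 1 4).exec σ with hσ₁
  have hr₁ : Ready G s par K σ₁ := h.exec (by decide)
  have hy₁ : σ₁.reg 2 = y := by rw [hσ₁, Cmd.exec_reg (by decide), hy]
  have hc₁ : σ₁.reg 3 = c := by rw [hσ₁, Cmd.exec_reg (by decide), hc]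
  have hH₁ : IsMatrix (σ₁.arr 1) H := by rw [hσ₁, Cmd.exec_arr (by decide)]; exact hH
  have hiff : (Expr.lt (.add (.read 2 (.reg 2) (.reg 3)) (.const 2))
      (.read 4 (.reg 2) (.reg 3))).Holds σ₁ ↔
      tdist (cut G par y) s c + 2 < tdist (cut H par y) s c := by
    simp only [Expr.holds_lt, Expr.eval, hy₁, hc₁, hD, hr₁.dist]
  have hexec : repairCenter.exec σ = (Cmd.ite (.lt (.add (.read 2 (.reg 2) (.reg 3)) (.const 2))
      (.read 4 (.reg 2) (.reg 3))) walk .skip).exec σ₁ := rfl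
  rw [hexec, Cmd.exec_ite]
  by_cases hbad : tdist (cut G par y) s c + 2 < tdist (cut H par y) s c
  · rw [if_pos (hiff.2 hbad)]
    have hcard := tdist_le_card (cut H par y) s c
    rw [Fintype.card_fin] at hcard
    obtain ⟨H', x, m, hm, ht, hend⟩ := exec_walk hr₁ hy₁ hc₁ hH₁ hsk.le hD (by omega)
    refine ⟨H', hm, ⟨ht.base_le, ht.le, buy_path hp hK hsk hcS hbad ht.start ht.ne ht.pred hend
      ht.base_le ht.adj ht.edge⟩, ?_⟩
    have := ht.tdist_le hend
    omega
  · rw [if_neg (mt hiff.1 hbad)]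
    exact ⟨H, hH₁, ⟨le_rfl, hsk.le, le_rfl⟩, not_lt.1 hbad⟩

/-- The graph only grows, so repaired pairs stay repaired, and `IsSkeleton.mono` provides the
hypotheses of the next purchase with the same clusters. -/
theorem exec_buyPaths (hp : IsBFSParent G s par) (hK : 1 ≤ K) {σ : Store}
    (h : Ready G s par K σ) (hH : IsMatrix (σ.arr 1) H)
    (hsk : IsSkeleton G H s par K S marked cl) (hS : ∀ c : Fin n, σ.arr 5 1 c ≠ 0 ↔ c ∈ S) :
    ∃ H', IsMatrix ((buyPaths.exec σ).arr 1) H' ∧ IsPurchase G H H' K S ∧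
      ∀ y, ∀ c ∈ S, tdist (cut H' par y) s c ≤ tdist (cut G par y) s c + 2 := by
  obtain ⟨τ, ⟨H', h₁, h₂, h₃⟩, -, he⟩ := Cmd.exec_loop (fun k τ =>
      ∃ H', IsMatrix (τ.arr 1) H' ∧ IsPurchase G H H' K S ∧
      ∀ y : Fin n, y.val < k → ∀ c ∈ S,
        tdist (cut H' par y) s c ≤ tdist (cut G par y) s c + 2) 2
      (.loop 3 (.ite (.read 5 (.const 1) (.reg 3)) repairCenter .skip)) σ
    ⟨H, hH, ⟨le_rfl, hsk.le, le_rfl⟩, fun _ hy => absurd hy (Nat.not_lt_zero _)⟩ (by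
      rintro i hi τ hf ⟨H₁, h₁, h₂, h₃⟩
      rw [h.reg0] at hi
      have hτ : Ready G s par K (τ.setReg 2 i) := (h.of_frame hf (by decide)).setReg i (by decide)
      have h5 : τ.arr 5 = σ.arr 5 := hf.1 5 (by decide)
      have hsk₁ := hsk.mono h₂.base_le h₂.le
      obtain ⟨τ', ⟨H₂, g₁, g₂, g₃⟩, -, he⟩ := Cmd.exec_loop (fun k τ' =>
          ∃ H₂, IsMatrix (τ'.arr 1) H₂ ∧ IsPurchase G H₁ H₂ K S ∧ ∀ c ∈ S, c.val < k →
            tdist (cut H₂ par ⟨i, hi⟩) s c ≤ tdist (cut G par ⟨i, hi⟩) s c + 2) 3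
          (.ite (.read 5 (.const 1) (.reg 3)) repairCenter .skip) (τ.setReg 2 i)
        ⟨H₁, h₁, ⟨le_rfl, h₂.le, le_rfl⟩, fun _ _ hc => absurd hc (Nat.not_lt_zero _)⟩ (by
          rintro j hj τ' hf' ⟨H₂, g₁, g₂, g₃⟩
          rw [hτ.reg0] at hj
          have hτ' : Ready G s par K (τ'.setReg 3 j) :=
            (hτ.of_frame hf' (by decide)).setReg j (by decide)
          have h5' : τ'.arr 5 = σ.arr 5 := by
            rw [hf'.1 5 (by decide), Store.setReg_arr, h5]
          have hiff : (Expr.read 5 (.const 1) (.reg 3)).Holds (τ'.setReg 3 j) ↔ ⟨j, hj⟩ ∈ S := by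
            rw [← hS, Expr.holds_read]
            simp [Expr.eval, h5']
          rw [Cmd.exec_ite]
          by_cases hjS : ⟨j, hj⟩ ∈ S
          · rw [if_pos (hiff.2 hjS)]
            obtain ⟨H₃, e₁, e₂, e₃⟩ := exec_repairCenter hp hK hτ' (y := ⟨i, hi⟩) (c := ⟨j, hj⟩)
              (by
                rw [Store.setReg_reg, if_neg (by decide), hf'.2 2 (by decide) (by decide)]
                simp) (by simp) g₁ (hsk₁.mono g₂.base_le g₂.le) hjS
            refine ⟨H₃, e₁, g₂.trans e₂, fun c hc hcj => ?_⟩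
            by_cases hcj' : c = ⟨j, hj⟩
            · rw [hcj']
              exact e₃
            · have hcj'' : c.val ≠ j := fun h => hcj' (Fin.ext h)
              exact (tdist_anti (cut_mono e₂.base_le _) s c).trans (g₃ c hc (by omega))
          · rw [if_neg (mt hiff.1 hjS)]
            refine ⟨H₂, g₁, g₂, fun c hc hcj => g₃ c hc ?_⟩
            have hcj' : c.val ≠ j := by rintro rfl; exact hjS hc
            omega)
      rw [hτ.reg0] at g₃
      refine ⟨H₂, by rw [he]; exact g₁, h₂.trans g₂, fun y hy c hc => ?_⟩
      by_cases hyi : y = ⟨i, hi⟩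
      · rw [hyi]
        exact g₃ c hc c.isLt
      · have hyi' : y.val ≠ i := fun h => hyi (Fin.ext h)
        exact (tdist_anti (cut_mono g₂.base_le _) s c).trans (h₃ y (by omega) c hc))
  rw [h.reg0] at h₃
  exact ⟨H', by rw [buyPaths, he]; exact h₁, h₂, fun y => h₃ y y.isLt⟩

/-- Purchases cost at most three times the drop of the potential, which is at most `6 * n` per
center since `S.card * K ≤ n`; and `3 * K + 3 ≤ 6 * K`. Another factor `K` turns `S.card` into `n /
K` without division. -/
theorem IsPurchase.sq_mul_ncard_le (h : IsPurchase G H H' K S) (hK : 1 ≤ K)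
    (hH : H.edgeSet.ncard ≤ n * (3 * K + 3)) (hS : S.card * K ≤ n) :
    K ^ 2 * H'.edgeSet.ncard ≤ 6 * n * K ^ 3 + 18 * n ^ 2 := by
  have h₁ : potential G K S H ≤ _ := potential_le_add (K := K) (S := S) (H := H) h.le
  have h₂ := h.cost_le
  rw [Fintype.card_fin] at h₁
  have h₃ : K * H'.edgeSet.ncard ≤ K * (n * (6 * K)) + S.card * (18 * n) := by
    have e₁ : K * H.edgeSet.ncard ≤ K * (n * (6 * K)) :=
      Nat.mul_le_mul_left _ (hH.trans (Nat.mul_le_mul_left _ (by omega)))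
    have e₂ : S.card * (3 * (n + S.card * K)) ≤ S.card * (6 * n) :=
      Nat.mul_le_mul_left _ (by omega)
    have e₃ : S.card * (18 * n) = 3 * (S.card * (6 * n)) := by ring
    omega
  calc K ^ 2 * H'.edgeSet.ncard = K * (K * H'.edgeSet.ncard) := by ring
    _ ≤ K * (K * (n * (6 * K)) + S.card * (18 * n)) := Nat.mul_le_mul_left _ h₃
    _ = 6 * n * K ^ 3 + 18 * n * (S.card * K) := by ring
    _ ≤ 6 * n * K ^ 3 + 18 * n * n := by gcongr
    _ = 6 * n * K ^ 3 + 18 * n ^ 2 := by ring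

/-- With `t = n^(1/3)` one has `t ≤ K ≤ t + 1 ≤ 2t`. The two terms on the right of the bound are
then at most `12 t⁴ K²` and `18 t⁴ K²`, whence the constant `30`. -/
theorem le_rpow_of_sq_mul_le {n K E : ℕ} (hn : 1 ≤ n) (hK : 1 ≤ K) (h₁ : n ≤ K ^ 3)
    (h₂ : (K - 1) ^ 3 < n) (hE : K ^ 2 * E ≤ 6 * n * K ^ 3 + 18 * n ^ 2) :
    (E : ℝ) ≤ 30 * (n : ℝ) ^ ((4 : ℝ) / 3) := by
  have hn0 : (0 : ℝ) ≤ n := n.cast_nonneg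
  set t : ℝ := (n : ℝ) ^ ((1 : ℝ) / 3) with ht
  have ht0 : 0 ≤ t := Real.rpow_nonneg hn0 _
  have ht3 : t ^ 3 = n := by
    rw [ht, ← Real.rpow_natCast, ← Real.rpow_mul hn0]; norm_num
  have ht4 : (n : ℝ) ^ ((4 : ℝ) / 3) = t ^ 4 := by
    rw [ht, ← Real.rpow_natCast, ← Real.rpow_mul hn0]; norm_num
  have ht1 : 1 ≤ t := Real.one_le_rpow (by exact_mod_cast hn) (by norm_num)
  have hK0 : (0 : ℝ) < K := by exact_mod_cast hK
  have htK : t ≤ K := by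
    refine le_of_pow_le_pow_left₀ (n := 3) (by norm_num) hK0.le ?_
    rw [ht3]
    exact_mod_cast h₁
  have hKt : (K : ℝ) ≤ 2 * t := by
    have h : ((K - 1 : ℕ) : ℝ) ≤ t := by
      refine le_of_pow_le_pow_left₀ (n := 3) (by norm_num) ht0 ?_
      rw [ht3]
      exact_mod_cast h₂.le
    rw [Nat.cast_sub hK, Nat.cast_one] at h
    linarith
  rw [ht4]
  refine le_of_mul_le_mul_left ?_ (pow_pos hK0 2)
  have hE' : (K : ℝ) ^ 2 * E ≤ 6 * t ^ 3 * K ^ 3 + 18 * (t ^ 3) ^ 2 := by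
    rw [ht3]
    exact_mod_cast hE
  have e₁ : t ^ 3 * (K : ℝ) ^ 3 ≤ t ^ 3 * (K ^ 2 * (2 * t)) := by
    rw [pow_succ (K : ℝ) 2]
    gcongr
  have e₂ : t ^ 4 * t ^ 2 ≤ t ^ 4 * (K : ℝ) ^ 2 := by gcongr
  nlinarith [e₁, e₂, hE']

end Buying

/-! ### The complete algorithm and the theorem. -/

/-- The construction of a fault-tolerant approximate BFS structure. -/
def construction : Cmd := setup ;; buildSkeleton ;; buyPaths

theorem exec_construction {n : ℕ} (G : SimpleGraph (Fin n)) (s : Fin n) :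
    ∃ H : SimpleGraph (Fin n), IsMatrix ((construction.exec (inputStore G s)).arr 1) H ∧
      IsEdgeFTApproxBFS 1 1 4 G H s ∧
      (H.edgeSet.ncard : ℝ) ≤ 30 * (n : ℝ) ^ ((4 : ℝ) / 3) := by
  obtain ⟨par, K, hp, hK, hK₁, hK₂, hr⟩ := exec_setup G s
  obtain ⟨H, S, marked, cl, hH, hsk, hcard, hSK, hS⟩ := exec_buildSkeleton hp hr
    (fun i j => by rw [Cmd.exec_arr setup_regs_arrs.1]; rfl)
    (fun i j => by rw [Cmd.exec_arr setup_regs_arrs.2]; rfl)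
  obtain ⟨H', hH', hbuy, hS'⟩ := exec_buyPaths hp hK (hr.exec (by decide)) hH hsk hS
  exact ⟨H', hH', (hsk.mono hbuy.base_le hbuy.le).isEdgeFTApproxBFS hp hS',
    le_rpow_of_sq_mul_le (by have := s.isLt; omega) hK hK₁ hK₂
      (hbuy.sq_mul_ncard_le hK hcard hSK)⟩

end FaultTolerant

theorem theorem5 :
    ∃ (p : FaultTolerant.Program) (time : Polynomial ℕ) (C : ℝ),
      ∀ (n : ℕ) (G : SimpleGraph (Fin n)) (s : Fin n),
        ∃ (H : SimpleGraph (Fin n)) (t : ℕ) (τ : FaultTolerant.Store),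
          FaultTolerant.Runs p (FaultTolerant.inputStore G s) t τ ∧
          t ≤ time.eval n ∧
          FaultTolerant.IsOutput τ H ∧
          FaultTolerant.IsEdgeFTApproxBFS 1 1 4 G H s ∧
          (H.edgeSet.ncard : ℝ) ≤ C * (n : ℝ) ^ ((4 : ℝ) / 3) := by
  refine ⟨FaultTolerant.construction.toProgram, FaultTolerant.construction.time, 30,
    fun n G s => ?_⟩
  obtain ⟨H, hH, hft, hcard⟩ := FaultTolerant.exec_construction G s
  obtain ⟨t, ht, hrun⟩ := FaultTolerant.Cmd.exists_runs (p := FaultTolerant.construction)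
    (by decide) (by decide) (FaultTolerant.inputStore G s)
  exact ⟨H, t, _, hrun, ht, fun u v => by rw [hH u v, FaultTolerant.adjEntry_eq H u v], hft, hcard⟩
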